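/- Let $X=\{X_t:t\ge 0\}$ be a real-valued Lévy process (almost surely càdlàg paths, stationary independent increments, started at $x$ under $\mathbb{P}_x$) with $\mathbb{E}_0[|X_1|]<\infty$, and let $q>0$. For $a>0$ let $\pi^a=(L^{\pi^a},R^{\pi^a})$ be the double barrier strategy at $a$, with $L^{\pi^a}_{0-}=R^{\pi^a}_{0-}=0$ and controlled process $U=X-L^{\pi^a}+R^{\pi^a}$, constructed path by path as follows. Until the first exit of $X$ from $[0,a]$ nothing is paid. Whenever, at a time $T$, the process goes above $a$ (from the first phase or from a phase of reflection at $0$), and its position at $T$ before the new control acts is $\eta$, then from $T$ on $L^{\pi^a}$ increases by $\eta-a+\sup_{s\in[T,t]}(X_s-X_T)$ and $R^{\pi^a}$ stays constant, until $U$ goes below $0$. Whenever, at a time $T$, the process goes below $0$ from position $\eta$ (from the first phase or from a phase of reflection at $a$), then from $T$ on $R^{\pi^a}$ increases by $-\eta-\inf_{s\in[T,t]}(X_s-X_T)$ and $L^{\pi^a}$ stays constant, until $U$ goes above $a$. Put $$V_x^L(a)=\mathbb{E}_x\Big[\int_{[0,\infty)}e^{-qt}\,dL_t^{\pi^a}\Big],\qquad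 V_x^R(a)=\mathbb{E}_x\Big[\int_{[0,\infty)}e^{-qt}\,dR_t^{\pi^a}\Big],$$ $$\bar\nu_x(a)=\mathbb{E}_x\big[e^{-q\bar\rho}\big],\quad \bar\rho=\inf\{t\ge 0:L_t^{\pi^a}>0\},\qquad \underline\nu(a)=\mathbb{E}_a\big[e^{-q\kappa}\big],\quad \kappa=\inf\{t>0:Y_t^a<0\},$$ where $Y^a_t=X_t-\big((\sup_{s\in[0,t]}X_s-a)\vee 0\big)$, $\inf\emptyset=\infty$ and $e^{-q\infty}=0$. **Lemma 4.2.** For every $x\in\mathbb{R}$ and $a\in(0,\infty)$, $V_x^L$ and $V_x^R$ are finite on $(0,\infty)$, $1-\underline\nu(a)\bar\nu_0(a)>0$, and $$\lim_{\epsilon\downarrow 0}\frac{V_x^L(a+\epsilon)-V_x^L(a)}{\epsilon}=\frac{-\bar\nu_x(a)}{1-\underline\nu(a)\bar\nu_0(a)},\qquad \lim_{\epsilon\downarrow 0}\frac{V_x^R(a+\epsilon)-V_x^R(a)}{\epsilon}=\frac{-\bar\nu_x(a)\,\underline\nu(a)}{1-\underline\nu(a)\bar\nu_0(a)}.$$ 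-/

import Mathlib

open MeasureTheory ProbabilityTheory Filter Set Topology
open scoped NNReal ENNReal

noncomputable section

namespace DoubleBarrier

/-- A real-valued Lévy process started at `0`: independent and stationary increments and,
almost surely, càdlàg paths. -/
structure IsLevyProcess {Ω : Type*} [MeasurableSpace Ω] (X : ℝ≥0 → Ω → ℝ) (P : Measure Ω) :
    Prop where
  measurable : ∀ t, Measurable (X t)
  zero : ∀ᵐ ω ∂P, X 0 ω = 0
  indep : HasIndepIncrements X P
  stationary : ∀ s t, IdentDistrib (fun ω => X (s + t) ω - X s ω) (X t) P P
  cadlag : ∀ᵐ ω ∂P, ∀ t : ℝ≥0,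
    ContinuousWithinAt (fun s => X s ω) (Ici t) t ∧
      ∃ l : ℝ, Tendsto (fun s => X s ω) (𝓝[<] t) (𝓝 l)

/-- The path of the process started at `x`; the law `ℙ_x` is the law of this path under `P`. -/
def path {Ω : Type*} (X : ℝ≥0 → Ω → ℝ) (x : ℝ) (ω : Ω) : ℝ≥0 → ℝ := fun t => x + X t ω

/-- The infimum of a set of times, with `inf ∅ = ∞`. -/
def firstTime (S : Set ℝ≥0) : ℝ≥0∞ := ⨅ t ∈ S, (t : ℝ≥0∞)

/-- `e^{-qT}` for a possibly infinite time `T`, with `e^{-q∞} = 0`. -/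
def discount (q : ℝ) (T : ℝ≥0∞) : ℝ := if T = ∞ then 0 else Real.exp (-q * T.toReal)

/-! ### The double barrier strategy, path by path

The strategy alternates between phases. In the initial phase (`free`) nothing is paid; in an
`upper` phase the risk process is reflected downwards at the barrier `a`, in a `lower` phase it is
reflected upwards at `0`. -/

/-- The kind of control that is exercised in a phase. -/
inductive Mode where
  | free
  | upper
  | lower

/-- A phase of the strategy: its mode, its starting time `T`, the position `η` of the risk process
at time `T` before the control of this phase acts, and the cumulative dividends `L = L_{T-}` and
injections `R = R_{T-}` of the earlier phases. -/
structure Phase where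
  mode : Mode
  start : ℝ≥0∞
  η : ℝ
  L : ℝ
  R : ℝ

/-- Dividends paid in the phase up to time `t`: in an upper phase
`η - a + sup_{s ∈ [T, t]} (w s - w T)`, otherwise none. -/
def Phase.divs (a : ℝ) (w : ℝ≥0 → ℝ) (p : Phase) (t : ℝ≥0) : ℝ :=
  match p.mode with
  | .upper =>
      p.η - a + sSup ((fun s => w s - w p.start.toNNReal) '' Icc p.start.toNNReal t)
  | _ => 0

/-- Capital injected in the phase up to time `t`: in a lower phase
`-η - inf_{s ∈ [T, t]} (w s - w T)`, otherwise none. -/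
def Phase.injs (w : ℝ≥0 → ℝ) (p : Phase) (t : ℝ≥0) : ℝ :=
  match p.mode with
  | .lower =>
      -p.η - sInf ((fun s => w s - w p.start.toNNReal) '' Icc p.start.toNNReal t)
  | _ => 0

/-- The risk process controlled as in the phase. -/
def Phase.risk (a : ℝ) (w : ℝ≥0 → ℝ) (p : Phase) (t : ℝ≥0) : ℝ :=
  p.η + (w t - w p.start.toNNReal) - p.divs a w t + p.injs w t

/-- First time after the start at which the risk process of the phase is below `0`. -/
def Phase.exitBelow (a : ℝ) (w : ℝ≥0 → ℝ) (p : Phase) : ℝ≥0∞ :=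
  firstTime {t | p.start < t ∧ p.risk a w t < 0}

/-- First time after the start at which the risk process of the phase is above `a`. -/
def Phase.exitAbove (a : ℝ) (w : ℝ≥0 → ℝ) (p : Phase) : ℝ≥0∞ :=
  firstTime {t | p.start < t ∧ a < p.risk a w t}

/-- The phase of mode `m` that starts at time `T`, when the phase `p` ends. At that time `p` itself
pays no dividend (an upper phase ends when the risk process is at most `0 < a`) and injects nothing
(a lower phase ends when it is at least `a > 0`), so that the values at `T` of the controls of `p`
are their left limits. -/
def Phase.switch (a : ℝ) (w : ℝ≥0 → ℝ) (p : Phase) (m : Mode) (T : ℝ≥0∞) : Phase where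
  mode := m
  start := T
  η := p.risk a w T.toNNReal
  L := p.L + p.divs a w T.toNNReal
  R := p.R + p.injs w T.toNNReal

open Classical in
/-- The phase that follows `p` (it starts at time `∞` if `p` never ends). -/
def Phase.next (a : ℝ) (w : ℝ≥0 → ℝ) (p : Phase) : Phase :=
  match p.mode with
  | .free =>
      if p.exitBelow a w < p.exitAbove a w then p.switch a w .lower (p.exitBelow a w)
      else p.switch a w .upper (p.exitAbove a w)
  | .upper => p.switch a w .lower (p.exitBelow a w)
  | .lower => p.switch a w .upper (p.exitAbove a w)

/-- The successive phases of the double barrier strategy at `a` along the path `w`. -/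
def phase (a : ℝ) (w : ℝ≥0 → ℝ) : ℕ → Phase
  | 0 => ⟨.free, 0, w 0, 0, 0⟩
  | n + 1 => (phase a w n).next a w

/-- The phase in force at time `t`: the first one that ends after `t`. -/
def activePhase (a : ℝ) (w : ℝ≥0 → ℝ) (t : ℝ≥0) : Phase :=
  phase a w (sInf {n : ℕ | (t : ℝ≥0∞) < (phase a w (n + 1)).start})

/-- Cumulative dividends `L_t` of the double barrier strategy at `a` along the path `w`. -/
def dividends (a : ℝ) (w : ℝ≥0 → ℝ) (t : ℝ≥0) : ℝ :=
  (activePhase a w t).L + (activePhase a w t).divs a w t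

/-- Cumulative capital injections `R_t` of the double barrier strategy at `a` along `w`. -/
def injections (a : ℝ) (w : ℝ≥0 → ℝ) (t : ℝ≥0) : ℝ :=
  (activePhase a w t).R + (activePhase a w t).injs w t

/-! ### Expected net present values -/

/-- Extension of a cumulative process to negative times by `0`, so that its value at `0-` is `0`. -/
def extendByZero (A : ℝ≥0 → ℝ) (t : ℝ) : ℝ := if 0 ≤ t then A t.toNNReal else 0

open Classical in
/-- The Lebesgue–Stieltjes integral `∫_{[0,∞)} e^{-qt} dA_t` of a non-decreasing right-continuous
`A` with `A_{0-} = 0`; a jump of `A` at time `0` counts. -/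
def presentValue (q : ℝ) (A : ℝ≥0 → ℝ) : ℝ≥0∞ :=
  if h : Monotone (extendByZero A) then
    ∫⁻ t in Ici (0 : ℝ), ENNReal.ofReal (Real.exp (-q * t)) ∂h.stieltjesFunction.measure
  else 0

section Values

variable {Ω : Type*} [MeasurableSpace Ω] (X : ℝ≥0 → Ω → ℝ) (P : Measure Ω)

/-- `V_x^L(a)`, the expected discounted dividends of the double barrier strategy at `a`. -/
def VL (q x a : ℝ) : ℝ≥0∞ := ∫⁻ ω, presentValue q (dividends a (path X x ω)) ∂P

/-- `V_x^R(a)`, the expected discounted injections of the double barrier strategy at `a`. -/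
def VR (q x a : ℝ) : ℝ≥0∞ := ∫⁻ ω, presentValue q (injections a (path X x ω)) ∂P

/-- `ν̄_x(a) = 𝔼_x[e^{-qρ}]`, where `ρ = inf {t ≥ 0 : L_t > L_{0-} = 0}` is the first time at which
the double barrier strategy at `a` pays dividends. -/
def nuUpper (q x a : ℝ) : ℝ :=
  ∫ ω, discount q (firstTime {t | 0 < dividends a (path X x ω) t}) ∂P

/-- The path `w` reflected downwards at `a`. -/
def reflectedAt (a : ℝ) (w : ℝ≥0 → ℝ) (t : ℝ≥0) : ℝ :=
  w t - max (sSup (w '' Icc 0 t) - a) 0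

/-- `ν(a) = 𝔼_a[e^{-qκ}]` (written with an underbar), where `κ` is the first time at which the
process reflected at `a` is below `0`. -/
def nuLower (q a : ℝ) : ℝ :=
  ∫ ω, discount q (firstTime {t | 0 < t ∧ reflectedAt a (path X a ω) t < 0}) ∂P

end Values

end DoubleBarrier

end

open DoubleBarrier

noncomputable section

namespace DoubleBarrier

/-! ### Càdlàg paths -/

/-! The strategies at two levels are compared path by path. In an upper phase begun at `T` the risk
process is `a` plus the increment of `w` since `T` minus the running supremum of these increments.
So the phase ends once the path has fallen by more than `a` from a value taken since `T`, and lower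
phases are the mirror image. The switching times are thus iterated drawdown times of `w` and `-w`,
whatever the overshoots. Conversely, any monotone controls `(L, R)` keeping the path in `[0, b]`
must pay at least `w v - w u - b` and inject at least `w u - w v - b` over `[u, v]`
(`Reflects.sub_le_left`, `Reflects.sub_le_right`). Chaining these bounds along the phases at `a`
shows that by time `t` such a pair pays at least the dividends at `a` plus `m (a - b)`, and injects
at least the injections at `a` plus `n (a - b)`. Here `m` counts the upper phases begun, and `n` the
lower phases begun after an upper one (`compare_phase`, `exists_count`). Used both ways for `a ≤ b`,
this gives `L^b + (b - a) m_b ≤ L^a ≤ L^b + (b - a) m_a`, and likewise for injections.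

Discounting is evaluation at an independent exponential time (`presentValue_eq`), so `V(b) + (b - a)
K(b) ≤ V(a) ≤ V(b) + (b - a) K(a)`, where `K` is the expected discounted number of phases begun. The
difference quotient lies between `-K(a)` and `-K(a + ε)`; it remains to compute `K` and to see that
it is right-continuous. The strong Markov property at switching times
(`lintegral_ediscount_drawdownTime`) turns `K` into a geometric series with first term `ν̄_x(a)` and
ratio `ν(a) ν̄_0(a)`; lower phases bring one more factor `ν(a)`. The ratio is below `1` because
drawdown times are positive, and right continuity in the level is inherited from the drawdown times.

Integrability of `X 1` enters only through finiteness of the values. Telescoping over the levels `a,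
a + 1, ...` bounds the dividends by the numbers of upper phases at all these levels. In expectation
this is at most a constant times the discounted number of levels ever reached, which the running
supremum controls; that supremum is integrable by Ottaviani's inequality
(`IsCadlagLevy.measure_lt_meshMax_le`). The injections are then bounded through `U ≤ a`. -/

/-- A path that is right-continuous with left limits. -/
structure IsCadlag (w : ℝ≥0 → ℝ) : Prop where
  right : ∀ t, ContinuousWithinAt w (Ici t) t
  left : ∀ t, ∃ l : ℝ, Tendsto w (𝓝[<] t) (𝓝 l)

theorem IsCadlag.neg {w : ℝ≥0 → ℝ} (hw : IsCadlag w) : IsCadlag (-w) where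
  right t := (hw.right t).neg
  left t := by
    obtain ⟨l, hl⟩ := hw.left t
    exact ⟨-l, hl.neg⟩

theorem IsCadlag.const_add {w : ℝ≥0 → ℝ} (hw : IsCadlag w) (x : ℝ) :
    IsCadlag (fun t => x + w t) where
  right t := continuousWithinAt_const.add (hw.right t)
  left t := by
    obtain ⟨l, hl⟩ := hw.left t
    exact ⟨x + l, hl.const_add x⟩

/-- The left limit and right continuity bound the path near each point; compactness of `[0, t]` does
the rest. -/
theorem IsCadlag.exists_bound {w : ℝ≥0 → ℝ} (hw : IsCadlag w) (t : ℝ≥0) :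
    ∃ C, ∀ s ≤ t, |w s| ≤ C := by
  have h : ∃ C, ∀ s ∈ Icc 0 t, |w s| ≤ C := by
    refine (isCompact_Icc (a := (0 : ℝ≥0)) (b := t)).induction_on
      (p := fun S => ∃ C, ∀ s ∈ S, |w s| ≤ C) ⟨0, by simp⟩ ?_ ?_ ?_
    · rintro S S' h ⟨C, hC⟩
      exact ⟨C, fun s hs => hC s (h hs)⟩
    · rintro S S' ⟨C, hC⟩ ⟨C', hC'⟩
      refine ⟨max C C', fun s hs => ?_⟩
      rcases hs with hs | hs
      · exact (hC s hs).trans (le_max_left _ _)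
      · exact (hC' s hs).trans (le_max_right _ _)
    · intro s _
      obtain ⟨l, hl⟩ := hw.left s
      have h1 : ∀ᶠ v in 𝓝[<] s, |w v| ≤ |l| + 1 := by
        filter_upwards [hl.abs.eventually_lt_const (lt_add_one |l|)] with v hv using hv.le
      have h2 : ∀ᶠ v in 𝓝[≥] s, |w v| ≤ |w s| + 1 := by
        filter_upwards [(hw.right s).abs.eventually_lt_const (lt_add_one |w s|)] with v hv
          using hv.le
      have h3 : ∀ᶠ v in 𝓝 s, |w v| ≤ max (|l| + 1) (|w s| + 1) := by
        rw [← nhdsLT_sup_nhdsGE s, eventually_sup]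
        exact ⟨h1.mono fun v hv => hv.trans (le_max_left _ _),
          h2.mono fun v hv => hv.trans (le_max_right _ _)⟩
      exact ⟨{v | |w v| ≤ max (|l| + 1) (|w s| + 1)}, mem_nhdsWithin_of_mem_nhds h3, _,
        fun v hv => hv⟩
  obtain ⟨C, hC⟩ := h
  exact ⟨C, fun s hs => hC s ⟨zero_le, hs⟩⟩

/-- A dense sequence of times. -/
def grid (n : ℕ) : ℝ≥0 := TopologicalSpace.denseSeq ℝ≥0 n

/-- Strict inequalities between values of a càdlàg path persist to the right, so a time can be moved
to a grid time just after it. This is how first times become countable events. -/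
theorem exists_grid_of_eventually {p : ℝ≥0 → Prop} {u c : ℝ≥0} (h : ∀ᶠ v in 𝓝[≥] u, p v)
    (hc : u < c) : ∃ n, u < grid n ∧ grid n < c ∧ p (grid n) := by
  obtain ⟨d, hd, hdp⟩ := (mem_nhdsGE_iff_exists_Ico_subset' hc).1 h
  obtain ⟨n, hn⟩ := (TopologicalSpace.denseRange_denseSeq ℝ≥0).exists_mem_open
    (isOpen_Ioo (a := u) (b := min c d)) (nonempty_Ioo.2 (lt_min hc hd))
  exact ⟨n, hn.1, hn.2.trans_le (min_le_left _ _),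
    hdp ⟨hn.1.le, hn.2.trans_le (min_le_right _ _)⟩⟩

/-! ### First times -/

theorem firstTime_lt_iff {S : Set ℝ≥0} {τ : ℝ≥0∞} :
    firstTime S < τ ↔ ∃ t ∈ S, (t : ℝ≥0∞) < τ := by
  simp only [firstTime, iInf_lt_iff, exists_prop]

theorem firstTime_le {S : Set ℝ≥0} {t : ℝ≥0} (h : t ∈ S) : firstTime S ≤ t :=
  iInf₂_le t h

theorem le_firstTime {S : Set ℝ≥0} {τ : ℝ≥0∞} (h : ∀ t ∈ S, τ ≤ t) : τ ≤ firstTime S :=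
  le_iInf₂ h

theorem firstTime_anti {S S' : Set ℝ≥0} (h : S ⊆ S') : firstTime S' ≤ firstTime S :=
  le_firstTime fun _ ht => firstTime_le (h ht)

/-- The first time at which the path has fallen by more than `a` since its running maximum
from time `s` on. -/
def drawdownTime (w : ℝ≥0 → ℝ) (a : ℝ) (s : ℝ≥0∞) : ℝ≥0∞ :=
  firstTime {t | ∃ u ≤ t, s ≤ u ∧ a < w u - w t}

/-- The first time at which the path, reflected upwards at `0`, is above `a`. -/
def firstUpTime (w : ℝ≥0 → ℝ) (a : ℝ) : ℝ≥0∞ :=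
  firstTime {t | a < w t ∨ ∃ u ≤ t, a < w t - w u}

/-- The successive times at which the process between the barriers `0` and `a` starts to be
reflected at `a`. -/
def upTime (w : ℝ≥0 → ℝ) (a : ℝ) : ℕ → ℝ≥0∞
  | 0 => firstUpTime w a
  | k + 1 => drawdownTime (-w) a (drawdownTime w a (upTime w a k))

variable {w : ℝ≥0 → ℝ} {a b : ℝ} {s s' τ : ℝ≥0∞}

theorem le_drawdownTime : s ≤ drawdownTime w a s := by
  refine le_firstTime ?_
  rintro t ⟨u, hut, hsu, _⟩
  exact hsu.trans (by exact_mod_cast hut)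

theorem drawdownTime_mono (hab : a ≤ b) (hs : s ≤ s') :
    drawdownTime w a s ≤ drawdownTime w b s' := by
  refine firstTime_anti ?_
  rintro t ⟨u, hut, hsu, h⟩
  exact ⟨u, hut, hs.trans hsu, hab.trans_lt h⟩

theorem firstUpTime_mono (hab : a ≤ b) : firstUpTime w a ≤ firstUpTime w b := by
  refine firstTime_anti ?_
  rintro t (h | ⟨u, hut, h⟩)
  · exact Or.inl (hab.trans_lt h)
  · exact Or.inr ⟨u, hut, hab.trans_lt h⟩

theorem IsCadlag.eventually_sub_gt (hw : IsCadlag w) (t : ℝ≥0) {c : ℝ} (hc : c < w t) :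
    ∀ᶠ v in 𝓝[≥] t, c < w v :=
  (hw.right t).eventually_const_lt hc

theorem IsCadlag.eventually_sub_lt (hw : IsCadlag w) (t : ℝ≥0) {c : ℝ} (hc : w t < c) :
    ∀ᶠ v in 𝓝[≥] t, w v < c :=
  (hw.right t).eventually_lt_const hc

/-- Both the peak and the trough can be moved slightly to the right. The peak then lies strictly
after `s`; that strictness later makes the event observable when `s` is itself random. -/
theorem IsCadlag.drawdownTime_lt_iff (hw : IsCadlag w) (ha : 0 < a) :
    drawdownTime w a s < τ ↔ ∃ m n, s < grid m ∧ grid m ≤ grid n ∧ (grid n : ℝ≥0∞) < τ ∧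
      a < w (grid m) - w (grid n) := by
  rw [drawdownTime, firstTime_lt_iff]
  constructor
  · rintro ⟨t, ⟨u, hut, hsu, h⟩, htτ⟩
    -- A fall by more than `a > 0` takes positive time, which leaves room for a grid time between
    -- peak and trough.
    have hut' : u < t := hut.lt_of_ne (by rintro rfl; simp at h; linarith)
    obtain ⟨δ, hδ, h⟩ : ∃ δ > 0, a + 2 * δ < w u - w t :=
      ⟨(w u - w t - a) / 4, by linarith, by linarith⟩
    obtain ⟨m, hm1, hm2, hm3⟩ := exists_grid_of_eventually
      (hw.eventually_sub_gt u (c := w u - δ) (by linarith)) hut'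
    obtain ⟨τ', hτ', hτ''⟩ := ENNReal.lt_iff_exists_nnreal_btwn.1 htτ
    obtain ⟨n, hn1, hn2, hn3⟩ := exists_grid_of_eventually
      (hw.eventually_sub_lt t (c := w t + δ) (by linarith))
      (by exact_mod_cast hτ' : t < τ')
    refine ⟨m, n, hsu.trans_lt (by exact_mod_cast hm1), (hm2.trans hn1).le,
      lt_trans (by exact_mod_cast hn2) hτ'', by linarith⟩
  · rintro ⟨m, n, h1, h2, h3, h4⟩
    exact ⟨grid n, ⟨grid m, h2, h1.le, h4⟩, h3⟩

theorem IsCadlag.firstUpTime_lt_iff (hw : IsCadlag w) (ha : 0 < a) :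
    firstUpTime w a < τ ↔ (∃ n, (grid n : ℝ≥0∞) < τ ∧ a < w (grid n)) ∨
      ∃ m n, grid m ≤ grid n ∧ (grid n : ℝ≥0∞) < τ ∧ a < w (grid n) - w (grid m) := by
  rw [firstUpTime, firstTime_lt_iff]
  constructor
  · rintro ⟨t, h | ⟨u, hut, h⟩, htτ⟩
    · left
      obtain ⟨τ', hτ', hτ''⟩ := ENNReal.lt_iff_exists_nnreal_btwn.1 htτ
      obtain ⟨n, hn1, hn2, hn3⟩ := exists_grid_of_eventually (hw.eventually_sub_gt t h)
        (by exact_mod_cast hτ' : t < τ')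
      exact ⟨n, lt_trans (by exact_mod_cast hn2) hτ'', hn3⟩
    · right
      have h' : drawdownTime (-w) a 0 < τ := by
        rw [drawdownTime, firstTime_lt_iff]
        exact ⟨t, ⟨u, hut, zero_le, by simpa [neg_add_eq_sub] using h⟩, htτ⟩
      obtain ⟨m, n, -, h2, h3, h4⟩ := (hw.neg.drawdownTime_lt_iff ha).1 h'
      exact ⟨m, n, h2, h3, by simpa [neg_add_eq_sub] using h4⟩
  · rintro (⟨n, h1, h2⟩ | ⟨m, n, h1, h2, h3⟩)
    · exact ⟨grid n, Or.inl h2, h1⟩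
    · exact ⟨grid n, Or.inr ⟨grid m, h1, h3⟩, h2⟩

/-- Upper semicontinuity from the right, jointly in start and level. With monotonicity it yields
right continuity in each variable: in the start for the strong Markov property, in the level for the
limit of `K`. -/
theorem IsCadlag.exists_drawdownTime_lt (hw : IsCadlag w) (ha : 0 < a)
    (h : drawdownTime w a s < τ) : ∃ s' > s, ∃ b > a, drawdownTime w b s' < τ := by
  obtain ⟨m, n, h1, h2, h3, h4⟩ := (hw.drawdownTime_lt_iff ha).1 h
  obtain ⟨b, hb, hb'⟩ := exists_between h4
  refine ⟨grid m, h1, b, hb, firstTime_lt_iff.2 ⟨grid n, ⟨grid m, h2, le_rfl, hb'⟩, h3⟩⟩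

theorem exists_firstUpTime_lt (h : firstUpTime w a < τ) : ∃ b > a, firstUpTime w b < τ := by
  obtain ⟨t, ht, htτ⟩ := firstTime_lt_iff.1 h
  rcases ht with ht | ⟨u, hut, ht⟩
  · obtain ⟨b, hb, hb'⟩ := exists_between ht
    exact ⟨b, hb, firstTime_lt_iff.2 ⟨t, Or.inl hb', htτ⟩⟩
  · obtain ⟨b, hb, hb'⟩ := exists_between ht
    exact ⟨b, hb, firstTime_lt_iff.2 ⟨t, Or.inr ⟨u, hut, hb'⟩, htτ⟩⟩

theorem IsCadlag.lt_drawdownTime (hw : IsCadlag w) (ha : 0 < a) (hs : s ≠ ∞) :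
    s < drawdownTime w a s := by
  lift s to ℝ≥0 using hs
  have h1 := (hw.eventually_sub_gt s (c := w s - a / 2) (by linarith)).and
    (hw.eventually_sub_lt s (c := w s + a / 2) (by linarith))
  obtain ⟨d, hd, hdp⟩ := (mem_nhdsGE_iff_exists_Ico_subset' (lt_add_one s)).1 h1
  refine lt_of_lt_of_le (b := (d : ℝ≥0∞)) (by exact_mod_cast hd) (le_firstTime ?_)
  rintro t ⟨u, hut, hsu, h⟩
  by_contra! hlt
  have htd : t < d := by exact_mod_cast hlt
  have hsu' : s ≤ u := by exact_mod_cast hsu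
  have := hdp ⟨hsu', hut.trans_lt htd⟩
  have := hdp ⟨hsu'.trans hut, htd⟩
  simp only [mem_ofPred_eq] at *
  linarith

/-- At the drawdown time the path has fallen by at least `a`. -/
theorem IsCadlag.exists_of_drawdownTime_eq (hw : IsCadlag w) (ha : 0 < a) {E : ℝ≥0}
    (hE : drawdownTime w a s = E) {δ : ℝ} (hδ : 0 < δ) :
    ∃ u ≤ E, s ≤ u ∧ a - δ < w u - w E := by
  obtain ⟨η, hη, hηδ, hηa⟩ : ∃ η > 0, 2 * η ≤ δ ∧ 2 * η < a :=
    ⟨min (δ / 2) (a / 4), by positivity, by linarith [min_le_left (δ / 2) (a / 4)],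
      by linarith [min_le_right (δ / 2) (a / 4)]⟩
  have h1 := (hw.eventually_sub_gt E (c := w E - η) (by linarith)).and
    (hw.eventually_sub_lt E (c := w E + η) (by linarith))
  obtain ⟨d, hd, hdp⟩ := (mem_nhdsGE_iff_exists_Ico_subset' (lt_add_one E)).1 h1
  have h2 : drawdownTime w a s < d := by rw [hE]; exact_mod_cast hd
  obtain ⟨t, ⟨u, hut, hsu, h⟩, htd⟩ := firstTime_lt_iff.1 h2
  have htd' : t < d := by exact_mod_cast htd
  have hEt : E ≤ t := by
    have : drawdownTime w a s ≤ t := firstTime_le ⟨u, hut, hsu, h⟩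
    rw [hE] at this
    exact_mod_cast this
  have ht := hdp ⟨hEt, htd'⟩
  simp only [mem_ofPred_eq] at ht
  rcases le_or_gt u E with huE | huE
  · exact ⟨u, huE, hsu, by linarith⟩
  -- Peak and trough would both lie in the window where the path stays within `η` of `w E`, a fall
  -- of less than `2 * η < a`.
  · have hu := hdp ⟨huE.le, hut.trans_lt htd'⟩
    simp only [mem_ofPred_eq] at hu
    linarith

/-! ### Switching times and their non-accumulation -/

theorem upTime_le_drawdownTime (k : ℕ) : upTime w a k ≤ drawdownTime w a (upTime w a k) :=
  le_drawdownTime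

theorem drawdownTime_le_upTime_succ (k : ℕ) :
    drawdownTime w a (upTime w a k) ≤ upTime w a (k + 1) :=
  le_drawdownTime

theorem monotone_upTime : Monotone (upTime w a) :=
  monotone_nat_of_le_succ fun k => (upTime_le_drawdownTime k).trans (drawdownTime_le_upTime_succ k)

/-- The path has no oscillation of size `a` accumulating at a finite time. -/
theorem IsCadlag.exists_lt_upTime (hw : IsCadlag w) (ha : 0 < a) (t : ℝ≥0) :
    ∃ k, (t : ℝ≥0∞) < upTime w a k := by
  by_contra! hle
  have hfin : ∀ k, upTime w a k ≠ ∞ := fun k => ((hle k).trans_lt ENNReal.coe_lt_top).ne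
  have hfin' : ∀ k, drawdownTime w a (upTime w a k) ≠ ∞ := fun k =>
    (((drawdownTime_le_upTime_succ k).trans (hle _)).trans_lt ENNReal.coe_lt_top).ne
  set T : ℝ≥0∞ := ⨆ k, upTime w a k with hT
  have hTfin : T ≠ ∞ := ((iSup_le hle).trans_lt ENNReal.coe_lt_top).ne
  have hlt : ∀ k, upTime w a k < drawdownTime w a (upTime w a k) := fun k =>
    hw.lt_drawdownTime ha (hfin k)
  have hltT : ∀ k, drawdownTime w a (upTime w a k) < T := fun k =>
    (hw.neg.lt_drawdownTime ha (hfin' k)).trans_le (le_iSup (upTime w a) (k + 1))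
  lift T to ℝ≥0 using hTfin with T' hT'
  -- The left limit at the supremum `T'` confines the path to a band of width `a` just before `T'`,
  -- yet infinitely many falls by more than `a` take place there.
  obtain ⟨l, hl⟩ := hw.left T'
  have hT0 : 0 < T' := by
    have := lt_of_le_of_lt zero_le (hltT 0)
    exact_mod_cast this
  have h1 := (hl.eventually_const_lt (u := l - a / 2) (by linarith)).and
    (hl.eventually_lt_const (u := l + a / 2) (by linarith))
  obtain ⟨d, hd, hdp⟩ := (mem_nhdsLT_iff_exists_Ioo_subset' hT0).1 h1
  have hdT : (d : ℝ≥0∞) < ⨆ k, upTime w a k := by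
    rw [← hT]
    exact_mod_cast hd
  obtain ⟨k, hk⟩ := lt_iSup_iff.1 hdT
  obtain ⟨t, ⟨u, hut, hsu, h⟩, htT⟩ := firstTime_lt_iff.1 (hltT k)
  have hdu : d < u := by exact_mod_cast hk.trans_le hsu
  have htT' : t < T' := by exact_mod_cast htT
  have hu := hdp ⟨hdu, hut.trans_lt htT'⟩
  have ht := hdp ⟨hdu.trans_le hut, htT'⟩
  simp only [mem_ofPred_eq] at hu ht
  linarith

end DoubleBarrier

end

noncomputable section

namespace DoubleBarrier

/-! ### Phases of the double barrier strategy -/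

/-- The running supremum from time `T` on of the increments of the path. -/
def runSup (w : ℝ≥0 → ℝ) (T t : ℝ≥0) : ℝ := sSup ((fun s => w s - w T) '' Icc T t)

variable {w : ℝ≥0 → ℝ} {a b : ℝ} {p : Phase} {T t u : ℝ≥0}

theorem IsCadlag.bddAbove_image (hw : IsCadlag w) (T t : ℝ≥0) :
    BddAbove ((fun s => w s - w T) '' Icc T t) := by
  obtain ⟨C, hC⟩ := hw.exists_bound t
  refine ⟨C - w T, ?_⟩
  rintro _ ⟨s, hs, rfl⟩
  have := (abs_le.1 (hC s hs.2)).2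
  simp only
  linarith

theorem IsCadlag.le_runSup (hw : IsCadlag w) (hT : T ≤ u) (ht : u ≤ t) :
    w u - w T ≤ runSup w T t :=
  le_csSup (hw.bddAbove_image T t) ⟨u, ⟨hT, ht⟩, rfl⟩

theorem runSup_le {c : ℝ} (hT : T ≤ t) (h : ∀ u, T ≤ u → u ≤ t → w u - w T ≤ c) :
    runSup w T t ≤ c := by
  refine csSup_le ⟨_, ⟨T, ⟨le_rfl, hT⟩, rfl⟩⟩ ?_
  rintro _ ⟨s, hs, rfl⟩
  exact h s hs.1 hs.2

theorem IsCadlag.lt_runSup_iff (hw : IsCadlag w) {c : ℝ} (hT : T ≤ t) :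
    c < runSup w T t ↔ ∃ u, T ≤ u ∧ u ≤ t ∧ c < w u - w T := by
  rw [runSup, lt_csSup_iff (hw.bddAbove_image T t) ⟨_, ⟨T, ⟨le_rfl, hT⟩, rfl⟩⟩]
  simp [and_assoc]

theorem IsCadlag.runSup_nonneg (hw : IsCadlag w) (hT : T ≤ t) : 0 ≤ runSup w T t := by
  simpa using hw.le_runSup le_rfl hT

theorem IsCadlag.runSup_mono (hw : IsCadlag w) (hT : T ≤ u) (ht : u ≤ t) :
    runSup w T u ≤ runSup w T t :=
  runSup_le hT fun _ h1 h2 => hw.le_runSup h1 (h2.trans ht)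

theorem toNNReal_le_of_le_coe {s : ℝ≥0∞} (h : s ≤ t) : s.toNNReal ≤ t := by
  simpa using ENNReal.toNNReal_mono ENNReal.coe_ne_top h

/-- With this, lower phases are handled by the running supremum of `-w`. -/
theorem sInf_image_eq_neg_runSup :
    sInf ((fun s => w s - w T) '' Icc T t) = -runSup (-w) T t := by
  rw [Real.sInf_def, runSup]
  congr 2
  ext y
  simp only [Set.mem_neg, mem_image, Pi.neg_apply]
  constructor
  · rintro ⟨s, hs, h⟩
    exact ⟨s, hs, by linarith⟩
  · rintro ⟨s, hs, h⟩
    exact ⟨s, hs, by linarith⟩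

/-! ### The risk process of a phase and the time at which it exits -/

theorem Phase.divs_upper (hm : p.mode = .upper) :
    p.divs a w t = p.η - a + runSup w p.start.toNNReal t := by
  simp [Phase.divs, hm, runSup]

theorem Phase.divs_of_ne (hm : p.mode ≠ .upper) : p.divs a w t = 0 := by
  unfold Phase.divs
  split <;> simp_all

theorem Phase.injs_lower (hm : p.mode = .lower) :
    p.injs w t = -p.η + runSup (-w) p.start.toNNReal t := by
  simp [Phase.injs, hm, sInf_image_eq_neg_runSup]

theorem Phase.injs_of_ne (hm : p.mode ≠ .lower) : p.injs w t = 0 := by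
  unfold Phase.injs
  split <;> simp_all

theorem Phase.risk_upper (hm : p.mode = .upper) :
    p.risk a w t = a + (w t - w p.start.toNNReal) - runSup w p.start.toNNReal t := by
  rw [Phase.risk, Phase.divs_upper hm, Phase.injs_of_ne (by simp [hm])]
  ring

theorem Phase.risk_lower (hm : p.mode = .lower) :
    p.risk a w t = (w t - w p.start.toNNReal) + runSup (-w) p.start.toNNReal t := by
  rw [Phase.risk, Phase.injs_lower hm, Phase.divs_of_ne (by simp [hm])]
  ring

/-- The overshoot `η` is paid out at once, so the risk process depends only on the increments of `w`
since the start; it is negative exactly when the drawdown exceeds `a`. -/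
theorem Phase.exitBelow_upper (hw : IsCadlag w) (ha : 0 < a) (hm : p.mode = .upper) :
    p.exitBelow a w = drawdownTime w a p.start := by
  rw [Phase.exitBelow, drawdownTime]
  congr 1
  ext t
  simp only [mem_ofPred_eq, Phase.risk_upper hm]
  constructor
  · rintro ⟨h1, h2⟩
    have hst : p.start ≠ ∞ := (h1.trans ENNReal.coe_lt_top).ne
    have hT : p.start.toNNReal ≤ t := toNNReal_le_of_le_coe h1.le
    obtain ⟨u, hu1, hu2, hu3⟩ := (hw.lt_runSup_iff hT
      (c := a + (w t - w p.start.toNNReal))).1 (by linarith)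
    exact ⟨u, hu2, by rw [← ENNReal.coe_toNNReal hst]; exact_mod_cast hu1, by linarith⟩
  · rintro ⟨u, hut, hsu, h⟩
    have hut' : u < t := hut.lt_of_ne (by rintro rfl; simp at h; linarith)
    have hT : p.start.toNNReal ≤ u := toNNReal_le_of_le_coe hsu
    refine ⟨hsu.trans_lt (by exact_mod_cast hut'), ?_⟩
    have := hw.le_runSup hT hut
    linarith

theorem Phase.exitAbove_lower (hw : IsCadlag w) (ha : 0 < a) (hm : p.mode = .lower) :
    p.exitAbove a w = drawdownTime (-w) a p.start := by
  rw [Phase.exitAbove, drawdownTime]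
  congr 1
  ext t
  simp only [mem_ofPred_eq, Phase.risk_lower hm, Pi.neg_apply]
  constructor
  · rintro ⟨h1, h2⟩
    have hst : p.start ≠ ∞ := (h1.trans ENNReal.coe_lt_top).ne
    have hT : p.start.toNNReal ≤ t := toNNReal_le_of_le_coe h1.le
    obtain ⟨u, hu1, hu2, hu3⟩ := (hw.neg.lt_runSup_iff hT
      (c := a - (w t - w p.start.toNNReal))).1 (by linarith)
    simp only [Pi.neg_apply] at hu3
    exact ⟨u, hu2, by rw [← ENNReal.coe_toNNReal hst]; exact_mod_cast hu1, by linarith⟩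
  · rintro ⟨u, hut, hsu, h⟩
    have hut' : u < t := hut.lt_of_ne (by rintro rfl; simp at h; linarith)
    have hT : p.start.toNNReal ≤ u := toNNReal_le_of_le_coe hsu
    refine ⟨hsu.trans_lt (by exact_mod_cast hut'), ?_⟩
    have := hw.neg.le_runSup hT hut
    simp only [Pi.neg_apply] at this
    linarith

/-- The first time at which the path is below `0`. -/
def belowTime (w : ℝ≥0 → ℝ) : ℝ≥0∞ := firstTime {t | w t < 0}

/-- The first time at which the path is above `a`. -/
def aboveTime (w : ℝ≥0 → ℝ) (a : ℝ) : ℝ≥0∞ := firstTime {t | a < w t}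

/-- Exit times are taken strictly after the start, but the initial position may already lie outside
`[0, a]`. The violation then persists just after time `0`, so the infimum is unchanged. -/
theorem firstTime_pos_and {c : ℝ≥0 → Prop} (h : ∀ t, c t → ∀ᶠ v in 𝓝[≥] t, c v) :
    firstTime {t | (0 : ℝ≥0∞) < t ∧ c t} = firstTime {t | c t} := by
  refine le_antisymm (le_firstTime fun t ht => le_of_forall_gt fun τ hτ => ?_)
    (firstTime_anti fun t ht => ht.2)
  obtain ⟨τ', hτ', hτ''⟩ := ENNReal.lt_iff_exists_nnreal_btwn.1 hτ
  obtain ⟨n, hn1, hn2, hn3⟩ := exists_grid_of_eventually (h t ht)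
    (by exact_mod_cast hτ' : t < τ')
  exact firstTime_lt_iff.2 ⟨grid n, ⟨by exact_mod_cast (zero_le.trans_lt hn1), hn3⟩,
    lt_trans (by exact_mod_cast hn2) hτ''⟩

theorem phase_zero_risk : (phase a w 0).risk a w t = w t := by
  simp [phase, Phase.risk, Phase.divs, Phase.injs]

theorem exitBelow_phase_zero (hw : IsCadlag w) : (phase a w 0).exitBelow a w = belowTime w := by
  rw [Phase.exitBelow, belowTime, ← firstTime_pos_and fun t ht => hw.eventually_sub_lt t ht]
  simp only [phase_zero_risk]
  rfl

theorem exitAbove_phase_zero (hw : IsCadlag w) :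
    (phase a w 0).exitAbove a w = aboveTime w a := by
  rw [Phase.exitAbove, aboveTime, ← firstTime_pos_and fun t ht => hw.eventually_sub_gt t ht]
  simp only [phase_zero_risk]
  rfl

theorem IsCadlag.le_zero_of_belowTime_eq (hw : IsCadlag w) (h : belowTime w = T) : w T ≤ 0 := by
  by_contra! hT
  obtain ⟨d, hd, hdp⟩ := (mem_nhdsGE_iff_exists_Ico_subset' (lt_add_one T)).1
    (hw.eventually_sub_gt T hT)
  obtain ⟨t, ht, htd⟩ := firstTime_lt_iff.1 (h.trans_lt (by exact_mod_cast hd : (T : ℝ≥0∞) < d))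
  have hTt : (T : ℝ≥0∞) ≤ t := h ▸ firstTime_le ht
  have := hdp ⟨by exact_mod_cast hTt, by exact_mod_cast htd⟩
  simp only [mem_ofPred_eq] at this ht
  linarith

theorem IsCadlag.le_of_aboveTime_eq (hw : IsCadlag w) (h : aboveTime w a = T) : a ≤ w T := by
  by_contra! hT
  obtain ⟨d, hd, hdp⟩ := (mem_nhdsGE_iff_exists_Ico_subset' (lt_add_one T)).1
    (hw.eventually_sub_lt T hT)
  obtain ⟨t, ht, htd⟩ := firstTime_lt_iff.1 (h.trans_lt (by exact_mod_cast hd : (T : ℝ≥0∞) < d))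
  have hTt : (T : ℝ≥0∞) ≤ t := h ▸ firstTime_le ht
  have := hdp ⟨by exact_mod_cast hTt, by exact_mod_cast htd⟩
  simp only [mem_ofPred_eq] at this ht
  linarith

theorem nonneg_of_lt_belowTime (h : (t : ℝ≥0∞) < belowTime w) : 0 ≤ w t := by
  by_contra! ht
  exact h.not_ge (firstTime_le ht)

theorem le_of_lt_aboveTime (h : (t : ℝ≥0∞) < aboveTime w a) : w t ≤ a := by
  by_contra! ht
  exact h.not_ge (firstTime_le ht)

/-- Until the path exceeds `a` it stays in `[0, a]`, where a rise by more than `a` is impossible. -/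
theorem firstUpTime_of_aboveTime_le (h : aboveTime w a ≤ belowTime w) :
    firstUpTime w a = aboveTime w a := by
  refine le_antisymm (firstTime_anti fun t ht => Or.inl ht) (le_firstTime ?_)
  rintro t (ht | ⟨u, hut, ht⟩)
  · exact firstTime_le ht
  · by_contra! hlt
    have h1 := le_of_lt_aboveTime hlt
    have h2 : (u : ℝ≥0∞) < belowTime w :=
      lt_of_le_of_lt (by exact_mod_cast hut) (hlt.trans_le h)
    have := nonneg_of_lt_belowTime h2
    linarith

/-- At the first passage below `0` the path is at most `0`, so any later value above `a` is a rise
of more than `a` from there. A rise from an earlier time starts at a nonnegative value and hence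
also ends above `a`. The initial phase thus needs no case distinction in the definition of
`firstUpTime`. -/
theorem IsCadlag.firstUpTime_of_belowTime_lt (hw : IsCadlag w)
    (h : belowTime w < aboveTime w a) :
    firstUpTime w a = drawdownTime (-w) a (belowTime w) := by
  refine le_antisymm (firstTime_anti ?_) (le_firstTime ?_)
  · rintro t ⟨u, hut, -, ht⟩
    exact Or.inr ⟨u, hut, by simpa [neg_add_eq_sub] using ht⟩
  · have key : ∀ t, a < w t → drawdownTime (-w) a (belowTime w) ≤ t := by
      intro t ht
      obtain ⟨B, hB⟩ : ∃ B : ℝ≥0, belowTime w = B :=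
        ⟨_, (ENNReal.coe_toNNReal (h.trans_le le_top).ne).symm⟩
      have hBt : (B : ℝ≥0∞) < t := (hB ▸ h).trans_le (firstTime_le ht)
      refine firstTime_le ⟨B, by exact_mod_cast hBt.le, hB.le, ?_⟩
      have := hw.le_zero_of_belowTime_eq hB
      simp only [Pi.neg_apply]
      linarith
    rintro t (ht | ⟨u, hut, ht⟩)
    · exact key t ht
    · rcases lt_or_ge (u : ℝ≥0∞) (belowTime w) with hu | hu
      · have := nonneg_of_lt_belowTime hu
        exact key t (by linarith)
      · exact firstTime_le ⟨u, hut, hu, by simpa [neg_add_eq_sub] using ht⟩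

/-! ### The sequence of phases -/

theorem next_upper (hw : IsCadlag w) (ha : 0 < a) (hm : p.mode = .upper) :
    p.next a w = p.switch a w .lower (drawdownTime w a p.start) := by
  simp [Phase.next, hm, Phase.exitBelow_upper hw ha hm]

theorem next_lower (hw : IsCadlag w) (ha : 0 < a) (hm : p.mode = .lower) :
    p.next a w = p.switch a w .upper (drawdownTime (-w) a p.start) := by
  simp [Phase.next, hm, Phase.exitAbove_lower hw ha hm]

open Classical in
theorem phase_one (hw : IsCadlag w) :
    phase a w 1 = if belowTime w < aboveTime w a then
      (phase a w 0).switch a w .lower (belowTime w)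
      else (phase a w 0).switch a w .upper (aboveTime w a) := by
  rw [← exitBelow_phase_zero (a := a) hw, ← exitAbove_phase_zero (a := a) hw]
  rfl

open Classical in
/-- The index of the first upper phase. -/
def firstUpper (w : ℝ≥0 → ℝ) (a : ℝ) : ℕ := if belowTime w < aboveTime w a then 2 else 1

theorem phase_firstUpper (hw : IsCadlag w) (ha : 0 < a) :
    (phase a w (firstUpper w a)).mode = .upper ∧
      (phase a w (firstUpper w a)).start = firstUpTime w a := by
  unfold firstUpper
  split_ifs with h
  · have h1 : phase a w 1 = (phase a w 0).switch a w .lower (belowTime w) := by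
      rw [phase_one hw, if_pos h]
    have h2 : phase a w 2 = (phase a w 1).switch a w .upper
        (drawdownTime (-w) a (belowTime w)) := by
      have := next_lower hw ha (p := phase a w 1) (by rw [h1]; rfl)
      rw [phase, this, h1]
      rfl
    rw [h2, hw.firstUpTime_of_belowTime_lt h]
    exact ⟨rfl, rfl⟩
  · rw [phase_one hw, if_neg h, firstUpTime_of_aboveTime_le (not_lt.1 h)]
    exact ⟨rfl, rfl⟩

theorem phase_upper_lower (hw : IsCadlag w) (ha : 0 < a) (k : ℕ) :
    ((phase a w (firstUpper w a + 2 * k)).mode = .upper ∧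
      (phase a w (firstUpper w a + 2 * k)).start = upTime w a k) ∧
    (phase a w (firstUpper w a + 2 * k + 1)).mode = .lower ∧
      (phase a w (firstUpper w a + 2 * k + 1)).start = drawdownTime w a (upTime w a k) := by
  have step : ∀ k, ((phase a w (firstUpper w a + 2 * k)).mode = .upper ∧
      (phase a w (firstUpper w a + 2 * k)).start = upTime w a k) →
      (phase a w (firstUpper w a + 2 * k + 1)).mode = .lower ∧
      (phase a w (firstUpper w a + 2 * k + 1)).start = drawdownTime w a (upTime w a k) := by
    rintro k ⟨h1, h2⟩
    rw [phase, next_upper hw ha h1, h2]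
    exact ⟨rfl, rfl⟩
  induction k with
  | zero =>
    have h := phase_firstUpper hw ha
    exact ⟨h, step 0 h⟩
  | succ k ih =>
    have h : (phase a w (firstUpper w a + 2 * (k + 1))).mode = .upper ∧
        (phase a w (firstUpper w a + 2 * (k + 1))).start = upTime w a (k + 1) := by
      rw [show firstUpper w a + 2 * (k + 1) = (firstUpper w a + 2 * k + 1) + 1 by ring, phase,
        next_lower hw ha ih.2.1, ih.2.2]
      exact ⟨rfl, rfl⟩
    exact ⟨h, step _ h⟩

/-! ### Invariants of the phases -/

/-- Cumulative dividends at time `t` if the phase is still in force. -/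
def Phase.totalDivs (a : ℝ) (w : ℝ≥0 → ℝ) (p : Phase) (t : ℝ≥0) : ℝ := p.L + p.divs a w t

/-- Cumulative injections at time `t` if the phase is still in force. -/
def Phase.totalInjs (w : ℝ≥0 → ℝ) (p : Phase) (t : ℝ≥0) : ℝ := p.R + p.injs w t

/-- The properties of the phases of the strategy that make it a reflection at both barriers. -/
structure Phase.Valid (a : ℝ) (w : ℝ≥0 → ℝ) (p : Phase) : Prop where
  eq_zero : p.mode = .free → p = phase a w 0
  η_eq : p.start ≠ ∞ → p.η = w p.start.toNNReal - p.L + p.R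
  le_η : p.start ≠ ∞ → p.mode = .upper → a ≤ p.η
  η_le : p.start ≠ ∞ → p.mode = .lower → p.η ≤ 0

theorem valid_zero : (phase a w 0).Valid a w where
  eq_zero _ := rfl
  η_eq _ := by simp [phase]
  le_η _ h := by simp [phase] at h
  η_le _ h := by simp [phase] at h

theorem Phase.Valid.risk_eq (hp : p.Valid a w) (hs : p.start ≠ ∞) (t : ℝ≥0) :
    p.risk a w t = w t - p.totalDivs a w t + p.totalInjs w t := by
  rw [Phase.risk, hp.η_eq hs, Phase.totalDivs, Phase.totalInjs]
  ring

theorem Phase.Valid.switch (hp : p.Valid a w) (hs : p.start ≠ ∞) {m : Mode} {τ : ℝ≥0∞}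
    (hm : m ≠ .free) (h1 : τ ≠ ∞ → m = .upper → a ≤ p.risk a w τ.toNNReal)
    (h2 : τ ≠ ∞ → m = .lower → p.risk a w τ.toNNReal ≤ 0) : (p.switch a w m τ).Valid a w where
  eq_zero h := absurd h hm
  η_eq _ := hp.risk_eq hs _
  le_η h h' := h1 h h'
  η_le h h' := h2 h h'

/-- A phase that never begins carries meaningless data, since `∞.toNNReal = 0`; this is why the
invariants are guarded by `start ≠ ∞`. -/
theorem Phase.valid_of_start_eq_top (h : p.start = ∞) (hm : p.mode ≠ .free) : p.Valid a w where
  eq_zero h := absurd h hm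
  η_eq h' := absurd h h'
  le_η h' := absurd h h'
  η_le h' := absurd h h'

/-- The content is the sign of the overshoot: when the drawdown time is reached the path has fallen,
or risen, by at least `a`, so the new position is at most `0`, respectively at least `a`. -/
theorem Phase.Valid.next (hw : IsCadlag w) (ha : 0 < a) (hp : p.Valid a w) :
    (p.next a w).Valid a w := by
  rcases hm : p.mode with _ | _ | _
  · have h0 := hp.eq_zero hm
    rw [h0] at hp ⊢
    have h1 : (phase a w 0).next a w = _ := phase_one (a := a) hw
    rw [h1]
    have hs : (phase a w 0).start ≠ ∞ := by simp [phase]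
    split_ifs with h
    · refine hp.switch hs (by simp) (by simp) fun hB _ => ?_
      rw [phase_zero_risk]
      exact hw.le_zero_of_belowTime_eq (ENNReal.coe_toNNReal hB).symm
    · refine hp.switch hs (by simp) (fun hA _ => ?_) (by simp)
      rw [phase_zero_risk]
      exact hw.le_of_aboveTime_eq (ENNReal.coe_toNNReal hA).symm
  · rw [next_upper hw ha hm]
    by_cases hs : p.start = ∞
    · exact Phase.valid_of_start_eq_top
        (top_le_iff.1 (hs.ge.trans le_drawdownTime)) (by simp [Phase.switch])
    refine hp.switch hs (by simp) (by simp) fun hE _ => ?_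
    rw [Phase.risk_upper hm]
    set E := (drawdownTime w a p.start).toNNReal with hEdef
    have hE' : drawdownTime w a p.start = E := (ENNReal.coe_toNNReal hE).symm
    refine le_of_forall_pos_le_add fun δ hδ => ?_
    obtain ⟨u, huE, hsu, h⟩ := hw.exists_of_drawdownTime_eq ha hE' hδ
    have := hw.le_runSup (toNNReal_le_of_le_coe hsu) huE
    linarith
  · rw [next_lower hw ha hm]
    by_cases hs : p.start = ∞
    · exact Phase.valid_of_start_eq_top
        (top_le_iff.1 (hs.ge.trans le_drawdownTime)) (by simp [Phase.switch])
    refine hp.switch hs (by simp) (fun hE _ => ?_) (by simp)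
    rw [Phase.risk_lower hm]
    set E := (drawdownTime (-w) a p.start).toNNReal with hEdef
    have hE' : drawdownTime (-w) a p.start = E := (ENNReal.coe_toNNReal hE).symm
    refine le_of_forall_pos_le_add fun δ hδ => ?_
    obtain ⟨u, huE, hsu, h⟩ := hw.neg.exists_of_drawdownTime_eq ha hE' hδ
    have := hw.neg.le_runSup (toNNReal_le_of_le_coe hsu) huE
    simp only [Pi.neg_apply] at this h
    linarith

theorem valid_phase (hw : IsCadlag w) (ha : 0 < a) (n : ℕ) : (phase a w n).Valid a w := by
  induction n with
  | zero => exact valid_zero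
  | succ n ih => exact ih.next hw ha

theorem Phase.start_le_next_start (a : ℝ) (w : ℝ≥0 → ℝ) (p : Phase) :
    p.start ≤ (p.next a w).start := by
  have h1 : p.start ≤ p.exitBelow a w := le_firstTime fun t ht => ht.1.le
  have h2 : p.start ≤ p.exitAbove a w := le_firstTime fun t ht => ht.1.le
  unfold Phase.next
  split
  · split_ifs <;> assumption
  · exact h1
  · exact h2

theorem Phase.next_L (a : ℝ) (w : ℝ≥0 → ℝ) (p : Phase) :
    (p.next a w).L = p.totalDivs a w (p.next a w).start.toNNReal := by
  unfold Phase.next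
  split
  · split_ifs <;> rfl
  · rfl
  · rfl

theorem Phase.next_R (a : ℝ) (w : ℝ≥0 → ℝ) (p : Phase) :
    (p.next a w).R = p.totalInjs w (p.next a w).start.toNNReal := by
  unfold Phase.next
  split
  · split_ifs <;> rfl
  · rfl
  · rfl

theorem Phase.Valid.totalDivs_mono (hw : IsCadlag w) (hs : p.start ≤ u) (hut : u ≤ t) :
    p.totalDivs a w u ≤ p.totalDivs a w t := by
  unfold Phase.totalDivs
  by_cases hm : p.mode = .upper
  · simp only [Phase.divs_upper hm]
    have := hw.runSup_mono (toNNReal_le_of_le_coe hs) hut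
    linarith
  · simp [Phase.divs_of_ne hm]

theorem Phase.Valid.totalInjs_mono (hw : IsCadlag w) (hs : p.start ≤ u) (hut : u ≤ t) :
    p.totalInjs w u ≤ p.totalInjs w t := by
  unfold Phase.totalInjs
  by_cases hm : p.mode = .lower
  · simp only [Phase.injs_lower hm]
    have := hw.neg.runSup_mono (toNNReal_le_of_le_coe hs) hut
    linarith
  · simp [Phase.injs_of_ne hm]

theorem Phase.Valid.le_totalDivs (hp : p.Valid a w) (hw : IsCadlag w) (hs : p.start ≤ u) :
    p.L ≤ p.totalDivs a w u := by
  have hs' : p.start ≠ ∞ := (hs.trans_lt ENNReal.coe_lt_top).ne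
  unfold Phase.totalDivs
  by_cases hm : p.mode = .upper
  · simp only [Phase.divs_upper hm]
    have := hw.runSup_nonneg (toNNReal_le_of_le_coe hs)
    have := hp.le_η hs' hm
    linarith
  · simp [Phase.divs_of_ne hm]

theorem Phase.Valid.le_totalInjs (hp : p.Valid a w) (hw : IsCadlag w) (hs : p.start ≤ u) :
    p.R ≤ p.totalInjs w u := by
  have hs' : p.start ≠ ∞ := (hs.trans_lt ENNReal.coe_lt_top).ne
  unfold Phase.totalInjs
  by_cases hm : p.mode = .lower
  · simp only [Phase.injs_lower hm]
    have := hw.neg.runSup_nonneg (toNNReal_le_of_le_coe hs)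
    have := hp.η_le hs' hm
    linarith
  · simp [Phase.injs_of_ne hm]

/-- In a reflecting phase one barrier is respected because of its control, the other because the
phase has not ended yet. -/
theorem Phase.Valid.risk_mem (hp : p.Valid a w) (hw : IsCadlag w) (ha : 0 < a)
    (hs : p.start ≤ t) (ht : (t : ℝ≥0∞) < (p.next a w).start) : p.risk a w t ∈ Icc 0 a := by
  have hT := toNNReal_le_of_le_coe hs
  have hs' : p.start ≠ ∞ := (hs.trans_lt ENNReal.coe_lt_top).ne
  rcases hm : p.mode with _ | _ | _
  · have h0 := hp.eq_zero hm
    rw [h0] at ht ⊢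
    have h1 : (phase a w 0).next a w = _ := phase_one (a := a) hw
    rw [h1] at ht
    rw [phase_zero_risk]
    split_ifs at ht with h
    · exact ⟨nonneg_of_lt_belowTime ht, le_of_lt_aboveTime (lt_trans ht h)⟩
    · exact ⟨nonneg_of_lt_belowTime (lt_of_lt_of_le ht (not_lt.1 h)), le_of_lt_aboveTime ht⟩
  · rw [next_upper hw ha hm] at ht
    rw [Phase.risk_upper hm]
    constructor
    · by_contra! hlt
      obtain ⟨u, hu1, hu2, hu3⟩ := (hw.lt_runSup_iff hT
        (c := a + (w t - w p.start.toNNReal))).1 (by linarith)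
      refine ht.not_ge (firstTime_le ⟨u, hu2, ?_, by linarith⟩)
      rw [← ENNReal.coe_toNNReal hs']
      exact_mod_cast hu1
    · have := hw.le_runSup hT le_rfl
      linarith
  · rw [next_lower hw ha hm] at ht
    rw [Phase.risk_lower hm]
    constructor
    · have := hw.neg.le_runSup hT le_rfl
      simp only [Pi.neg_apply] at this
      linarith
    · by_contra! hlt
      obtain ⟨u, hu1, hu2, hu3⟩ := (hw.neg.lt_runSup_iff hT
        (c := a - (w t - w p.start.toNNReal))).1 (by linarith)
      simp only [Pi.neg_apply] at hu3
      refine ht.not_ge (firstTime_le ⟨u, hu2, ?_, by simp only [Pi.neg_apply]; linarith⟩)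
      rw [← ENNReal.coe_toNNReal hs']
      exact_mod_cast hu1

/-! ### The active phase -/

/-- The index of the phase in force at time `t`. -/
def activeIndex (a : ℝ) (w : ℝ≥0 → ℝ) (t : ℝ≥0) : ℕ :=
  sInf {n : ℕ | (t : ℝ≥0∞) < (phase a w (n + 1)).start}

theorem monotone_phase_start : Monotone fun n => (phase a w n).start :=
  monotone_nat_of_le_succ fun n => Phase.start_le_next_start a w (phase a w n)

/-- Non-accumulation of the switching times makes the set of indices nonempty, so that its `sInf` is
a genuine minimum and not the default `0`. -/
theorem lt_start_activeIndex (hw : IsCadlag w) (ha : 0 < a) (t : ℝ≥0) :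
    (t : ℝ≥0∞) < (phase a w (activeIndex a w t + 1)).start := by
  refine Nat.sInf_mem (s := {n : ℕ | (t : ℝ≥0∞) < (phase a w (n + 1)).start}) ?_
  obtain ⟨k, hk⟩ := hw.exists_lt_upTime ha t
  refine ⟨firstUpper w a + 2 * k, ?_⟩
  simp only [mem_ofPred_eq, (phase_upper_lower hw ha k).2.2]
  exact hk.trans_le le_drawdownTime

theorem start_activeIndex_le (t : ℝ≥0) : (phase a w (activeIndex a w t)).start ≤ t := by
  rcases h : activeIndex a w t with _ | n
  · simp [phase]
  · by_contra! hlt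
    have : activeIndex a w t ≤ n := Nat.sInf_le hlt
    omega

theorem activeIndex_mono (hw : IsCadlag w) (ha : 0 < a) (hut : u ≤ t) :
    activeIndex a w u ≤ activeIndex a w t :=
  Nat.sInf_le (lt_of_le_of_lt (by exact_mod_cast hut) (lt_start_activeIndex hw ha t))

theorem activeIndex_eq_of {n : ℕ} (hw : IsCadlag w) (ha : 0 < a)
    (h1 : (phase a w n).start ≤ t) (h2 : (t : ℝ≥0∞) < (phase a w (n + 1)).start) :
    activeIndex a w t = n := by
  refine le_antisymm (Nat.sInf_le h2) ?_
  by_contra! hlt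
  have := monotone_phase_start (a := a) (w := w) (Nat.succ_le_of_lt hlt)
  exact (lt_start_activeIndex hw ha t).not_ge (this.trans h1)

theorem dividends_eq (a : ℝ) (w : ℝ≥0 → ℝ) (t : ℝ≥0) :
    dividends a w t = (phase a w (activeIndex a w t)).totalDivs a w t := rfl

theorem injections_eq (a : ℝ) (w : ℝ≥0 → ℝ) (t : ℝ≥0) :
    injections a w t = (phase a w (activeIndex a w t)).totalInjs w t := rfl

/-- A pair of controls that keeps the path within `[0, a]`. -/
structure Reflects (w : ℝ≥0 → ℝ) (a : ℝ) (L R : ℝ≥0 → ℝ) : Prop where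
  monotone_left : Monotone L
  monotone_right : Monotone R
  left_nonneg : 0 ≤ L 0
  right_nonneg : 0 ≤ R 0
  mem : ∀ t, w t - L t + R t ∈ Icc 0 a

theorem L_le_L_of_le (hw : IsCadlag w) (ha : 0 < a) {m n : ℕ} (hmn : m ≤ n)
    (hs : (phase a w n).start ≠ ∞) :
    (phase a w m).L ≤ (phase a w n).L ∧ (phase a w m).R ≤ (phase a w n).R := by
  induction n, hmn using Nat.le_induction with
  | base => exact ⟨le_rfl, le_rfl⟩
  | succ n _ ih =>
    have h1 := Phase.start_le_next_start a w (phase a w n)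
    have h2 := ih ((h1.trans_lt (lt_top_iff_ne_top.2 hs)).ne)
    change ((phase a w n).next a w).start ≠ ∞ at hs
    have h3 : (phase a w n).start ≤ (((phase a w n).next a w).start.toNNReal : ℝ≥0∞) := by
      rwa [ENNReal.coe_toNNReal hs]
    change _ ≤ ((phase a w n).next a w).L ∧ _ ≤ ((phase a w n).next a w).R
    rw [Phase.next_L, Phase.next_R]
    exact ⟨h2.1.trans ((valid_phase hw ha n).le_totalDivs hw h3),
      h2.2.trans ((valid_phase hw ha n).le_totalInjs hw h3)⟩

theorem reflects_doubleBarrier (hw : IsCadlag w) (ha : 0 < a) :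
    Reflects w a (dividends a w) (injections a w) := by
  have hfin : ∀ t, (phase a w (activeIndex a w t)).start ≠ ∞ := fun t =>
    ((start_activeIndex_le t).trans_lt ENNReal.coe_lt_top).ne
  have key : ∀ u t, u ≤ t → dividends a w u ≤ dividends a w t ∧
      injections a w u ≤ injections a w t := by
    intro u t hut
    simp only [dividends_eq, injections_eq]
    rcases (activeIndex_mono hw ha hut).eq_or_lt with h | h
    · rw [h]
      have hs : (phase a w (activeIndex a w t)).start ≤ u := h ▸ start_activeIndex_le u
      exact ⟨Phase.Valid.totalDivs_mono hw hs hut, Phase.Valid.totalInjs_mono hw hs hut⟩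
    -- From `u` to the end of its phase, then through the stored totals of the phases in between,
    -- and finally inside the phase in force at `t`.
    · have h1 := L_le_L_of_le hw ha (Nat.succ_le_of_lt h) (hfin t)
      have hv := valid_phase hw ha (activeIndex a w t)
      have hst := start_activeIndex_le (a := a) (w := w) t
      set p := phase a w (activeIndex a w u) with hp
      have hlt : (u : ℝ≥0∞) < (p.next a w).start := lt_start_activeIndex hw ha u
      have hne : (p.next a w).start ≠ ∞ :=
        ((monotone_phase_start (Nat.succ_le_of_lt h)).trans_lt
          (lt_top_iff_ne_top.2 (hfin t))).ne
      have hle : u ≤ (p.next a w).start.toNNReal := by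
        rw [← ENNReal.coe_le_coe, ENNReal.coe_toNNReal hne]
        exact hlt.le
      have hL : (phase a w (activeIndex a w u).succ).L
        = p.totalDivs a w (p.next a w).start.toNNReal := Phase.next_L a w p
      have hR : (phase a w (activeIndex a w u).succ).R
        = p.totalInjs w (p.next a w).start.toNNReal := Phase.next_R a w p
      rw [hL, hR] at h1
      have hsu := start_activeIndex_le (a := a) (w := w) u
      exact ⟨(Phase.Valid.totalDivs_mono hw hsu hle).trans (h1.1.trans (hv.le_totalDivs hw hst)),
        (Phase.Valid.totalInjs_mono hw hsu hle).trans (h1.2.trans (hv.le_totalInjs hw hst))⟩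
  have h0 := L_le_L_of_le hw ha (Nat.zero_le _) (hfin 0)
  have hv0 := valid_phase hw ha (activeIndex a w 0)
  refine ⟨fun u t h => (key u t h).1, fun u t h => (key u t h).2, ?_, ?_, fun t => ?_⟩
  · exact h0.1.trans (hv0.le_totalDivs hw (start_activeIndex_le 0))
  · exact h0.2.trans (hv0.le_totalInjs hw (start_activeIndex_le 0))
  · have hv := valid_phase hw ha (activeIndex a w t)
    have := hv.risk_mem hw ha (start_activeIndex_le t) (lt_start_activeIndex hw ha t)
    rwa [hv.risk_eq (hfin t)] at this

end DoubleBarrier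

end

noncomputable section

namespace DoubleBarrier

/-! ### Comparison of the double barrier strategy with other reflections -/

variable {w : ℝ≥0 → ℝ} {a b c d : ℝ} {p : Phase} {T t u E : ℝ≥0} {L R : ℝ≥0 → ℝ}

/-- An interval of width `b` absorbs a rise of at most `b`, and injections only push further up.
With its mirror image below, this drives the comparison across each later switch. -/
theorem Reflects.sub_le_left (h : Reflects w b L R) (hut : u ≤ t) :
    w t - w u - b ≤ L t - L u := by
  have := (h.mem t).2
  have := (h.mem u).1
  have := h.monotone_right hut
  linarith

theorem Reflects.sub_le_right (h : Reflects w b L R) (hut : u ≤ t) :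
    w u - w t - b ≤ R t - R u := by
  have := (h.mem t).1
  have := (h.mem u).2
  have := h.monotone_left hut
  linarith

theorem Reflects.left_nonneg' (h : Reflects w b L R) (t : ℝ≥0) : 0 ≤ L t :=
  h.left_nonneg.trans (h.monotone_left zero_le)

theorem Reflects.right_nonneg' (h : Reflects w b L R) (t : ℝ≥0) : 0 ≤ R t :=
  h.right_nonneg.trans (h.monotone_right zero_le)

theorem Reflects.le_left (h : Reflects w b L R) (t : ℝ≥0) : w t - b ≤ L t := by
  have := (h.mem t).2
  have := h.right_nonneg' t
  linarith

theorem Reflects.neg_le_right (h : Reflects w b L R) (t : ℝ≥0) : -w t ≤ R t := by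
  have := (h.mem t).1
  have := h.left_nonneg' t
  linarith

theorem Reflects.right_le (h : Reflects w b L R) (t : ℝ≥0) : R t ≤ b + |w t| + L t := by
  have := (h.mem t).2
  have := neg_abs_le (w t)
  linarith

/-- With `T` and `E` the start and end of the phase, the injections of the next phase total `p.R - a
+ sup (w u - w v)` over `T ≤ u ≤ E ≤ v ≤ t`. The competitor has `R u ≥ R T ≥ p.R + d` and injects at
least `w u - w v - b` between `u` and `v`. The margin therefore changes by exactly `a - b` at the
switch, while the margin `c` for dividends is carried over unchanged. -/
theorem compare_upper (hw : IsCadlag w) (ha : 0 < a) (hr : Reflects w b L R)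
    (hm : p.mode = .upper) (hE : (p.next a w).start = E)
    (h1 : ∀ t : ℝ≥0, p.start ≤ t → p.totalDivs a w t + c ≤ L t)
    (h2 : p.R + d ≤ R p.start.toNNReal) :
    (p.next a w).L + c ≤ L E ∧
      ∀ t, E ≤ t → (p.next a w).totalInjs w t + d + (a - b) ≤ R t := by
  have hsE : p.start ≤ E := hE ▸ Phase.start_le_next_start a w p
  have hTE := toNNReal_le_of_le_coe hsE
  refine ⟨?_, fun t hEt => ?_⟩
  · rw [Phase.next_L, hE, ENNReal.toNNReal_coe]
    exact h1 E hsE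
  · have hη : (p.next a w).η = p.risk a w E := by
      rw [← ENNReal.toNNReal_coe E, ← hE, next_upper hw ha hm]
      rfl
    have hm' : (p.next a w).mode = .lower := by rw [next_upper hw ha hm]; rfl
    rw [Phase.totalInjs, Phase.injs_lower hm', Phase.next_R, Phase.totalInjs,
      Phase.injs_of_ne (by simp [hm]), hη, Phase.risk_upper hm, hE, ENNReal.toNNReal_coe]
    have h3 : runSup (-w) E t ≤ R t - p.R - runSup w p.start.toNNReal E - w p.start.toNNReal
        + w E - d + b := by
      refine runSup_le hEt fun v hv1 hv2 => ?_
      have h4 : runSup w p.start.toNNReal E ≤ R t - p.R - w p.start.toNNReal + w v - d + b := by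
        refine runSup_le hTE fun u hu1 hu2 => ?_
        have := hr.sub_le_right (hu2.trans hv1)
        have := hr.monotone_right hv2
        have := hr.monotone_right hu1
        linarith
      simp only [Pi.neg_apply]
      linarith
    linarith

theorem compare_lower (hw : IsCadlag w) (ha : 0 < a) (hr : Reflects w b L R)
    (hm : p.mode = .lower) (hE : (p.next a w).start = E)
    (h1 : ∀ t : ℝ≥0, p.start ≤ t → p.totalInjs w t + d ≤ R t)
    (h2 : p.L + c ≤ L p.start.toNNReal) :
    (p.next a w).R + d ≤ R E ∧
      ∀ t, E ≤ t → (p.next a w).totalDivs a w t + c + (a - b) ≤ L t := by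
  have hsE : p.start ≤ E := hE ▸ Phase.start_le_next_start a w p
  have hTE := toNNReal_le_of_le_coe hsE
  refine ⟨?_, fun t hEt => ?_⟩
  · rw [Phase.next_R, hE, ENNReal.toNNReal_coe]
    exact h1 E hsE
  · have hη : (p.next a w).η = p.risk a w E := by
      rw [← ENNReal.toNNReal_coe E, ← hE, next_lower hw ha hm]
      rfl
    have hm' : (p.next a w).mode = .upper := by rw [next_lower hw ha hm]; rfl
    rw [Phase.totalDivs, Phase.divs_upper hm', Phase.next_L, Phase.totalDivs,
      Phase.divs_of_ne (by simp [hm]), hη, Phase.risk_lower hm, hE, ENNReal.toNNReal_coe]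
    have h3 : runSup w E t ≤ L t - p.L - runSup (-w) p.start.toNNReal E + w p.start.toNNReal
        - w E - c + b := by
      refine runSup_le hEt fun v hv1 hv2 => ?_
      have h4 : runSup (-w) p.start.toNNReal E
          ≤ L t - p.L + w p.start.toNNReal - w v - c + b := by
        refine runSup_le hTE fun u hu1 hu2 => ?_
        have := hr.sub_le_left (hu2.trans hv1)
        have := hr.monotone_left hv2
        have := hr.monotone_left hu1
        simp only [Pi.neg_apply]
        linarith
      linarith
    linarith

/-- The induction starts here. If the path leaves below, the injections of the first lower phase are
bounded by those of any competitor, since `R ≥ -w`; the margin `a - b` then appears first for the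
dividends. If it leaves above, `L ≥ w - b` gives the bound directly. -/
theorem compare_firstUpper (hw : IsCadlag w) (ha : 0 < a) (hr : Reflects w b L R)
    (hE : (phase a w (firstUpper w a)).start = E) :
    (phase a w (firstUpper w a)).R ≤ R E ∧
      ∀ t, E ≤ t → (phase a w (firstUpper w a)).totalDivs a w t + (a - b) ≤ L t := by
  unfold firstUpper at hE ⊢
  split_ifs at hE ⊢ with h
  · have h1 : phase a w 1 = (phase a w 0).switch a w .lower (belowTime w) := by
      rw [phase_one hw, if_pos h]
    have hB : belowTime w ≠ ∞ := (h.trans_le le_top).ne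
    -- No margin has been lost before the first upper phase, hence `c = d = 0`.
    have := compare_lower (p := phase a w 1) (c := 0) (d := 0) hw ha hr (by rw [h1]; rfl) hE
      (fun t ht => ?_) ?_
    · simp only [add_zero] at this
      exact this
    · have hBt : (belowTime w).toNNReal ≤ t := by
        rw [h1] at ht
        exact toNNReal_le_of_le_coe ht
      rw [h1, Phase.totalInjs, Phase.injs_lower rfl]
      have hη : (phase a w 0).risk a w (belowTime w).toNNReal
        = w (belowTime w).toNNReal := phase_zero_risk
      simp only [Phase.switch, hη, Phase.injs_of_ne (p := phase a w 0) (by simp [phase])]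
      have : runSup (-w) (belowTime w).toNNReal t ≤ R t + w (belowTime w).toNNReal := by
        refine runSup_le hBt fun v hv1 hv2 => ?_
        have := hr.neg_le_right v
        have := hr.monotone_right hv2
        simp only [Pi.neg_apply]
        linarith
      simp only [phase]
      linarith
    · rw [h1]
      simp only [Phase.switch, Phase.divs_of_ne (p := phase a w 0) (by simp [phase])]
      simpa [phase] using hr.left_nonneg' _
  · have h1 : phase a w 1 = (phase a w 0).switch a w .upper (aboveTime w a) := by
      rw [phase_one hw, if_neg h]
    rw [h1] at hE ⊢
    replace hE : aboveTime w a = E := hE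
    constructor
    · simp only [Phase.switch, Phase.injs_of_ne (p := phase a w 0) (by simp [phase])]
      simpa [phase] using hr.right_nonneg' _
    · intro t hEt
      rw [Phase.totalDivs, Phase.divs_upper rfl]
      simp only [Phase.switch, phase_zero_risk, hE, ENNReal.toNNReal_coe,
        Phase.divs_of_ne (p := phase a w 0) (by simp [phase])]
      have : runSup w E t ≤ L t - w E + b := by
        refine runSup_le hEt fun v hv1 hv2 => ?_
        have := hr.le_left v
        have := hr.monotone_left hv2
        linarith
      simp only [phase]
      linarith

/-- The two margins advance in turn: `compare_upper` adds `a - b` to the one for injections,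
`compare_lower` to the one for dividends. In the `k`-th upper phase they are `k` and `k + 1`
multiples respectively; in the lower phase that follows, both are `k + 1`. -/
theorem compare_phase (hw : IsCadlag w) (ha : 0 < a) (hr : Reflects w b L R) (k : ℕ) :
    (∀ E : ℝ≥0, upTime w a k = E →
      (phase a w (firstUpper w a + 2 * k)).R + k * (a - b) ≤ R E ∧
      ∀ t, E ≤ t → (phase a w (firstUpper w a + 2 * k)).totalDivs a w t + (k + 1) * (a - b)
        ≤ L t) ∧
    (∀ E : ℝ≥0, drawdownTime w a (upTime w a k) = E →
      (phase a w (firstUpper w a + 2 * k + 1)).L + (k + 1) * (a - b) ≤ L E ∧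
      ∀ t, E ≤ t → (phase a w (firstUpper w a + 2 * k + 1)).totalInjs w t + (k + 1) * (a - b)
        ≤ R t) := by
  have step : ∀ k : ℕ, (∀ E : ℝ≥0, upTime w a k = E →
      (phase a w (firstUpper w a + 2 * k)).R + k * (a - b) ≤ R E ∧
      ∀ t, E ≤ t → (phase a w (firstUpper w a + 2 * k)).totalDivs a w t + (k + 1) * (a - b)
        ≤ L t) →
    (∀ E : ℝ≥0, drawdownTime w a (upTime w a k) = E →
      (phase a w (firstUpper w a + 2 * k + 1)).L + (k + 1) * (a - b) ≤ L E ∧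
      ∀ t, E ≤ t → (phase a w (firstUpper w a + 2 * k + 1)).totalInjs w t + (k + 1) * (a - b)
        ≤ R t) := by
    intro k hk E hE
    have hph := phase_upper_lower hw ha k
    have hU : upTime w a k ≠ ∞ :=
      ((upTime_le_drawdownTime k).trans_lt (hE ▸ ENNReal.coe_lt_top)).ne
    have hU' := (ENNReal.coe_toNNReal hU).symm
    obtain ⟨h1, h2⟩ := hk _ hU'
    have := compare_upper (p := phase a w (firstUpper w a + 2 * k)) (E := E)
      (c := (k + 1) * (a - b)) (d := k * (a - b)) hw ha hr hph.1.1
      (by rw [← hE]; exact hph.2.2) (fun t ht => h2 t ?_) (by rw [hph.1.2]; exact h1)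
    · refine ⟨this.1, fun t ht => ?_⟩
      have := this.2 t ht
      change (Phase.next a w _).totalInjs w t + _ ≤ _
      linarith
    · rw [hph.1.2] at ht
      exact toNNReal_le_of_le_coe ht
  induction k with
  | zero =>
    have h0 : ∀ E : ℝ≥0, upTime w a 0 = E →
        (phase a w (firstUpper w a + 2 * 0)).R + (0 : ℕ) * (a - b) ≤ R E ∧
        ∀ t, E ≤ t → (phase a w (firstUpper w a + 2 * 0)).totalDivs a w t
          + ((0 : ℕ) + 1) * (a - b) ≤ L t := by
      intro E hE
      have := compare_firstUpper (E := E) hw ha hr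
        (by rw [(phase_firstUpper hw ha).2]; exact hE)
      simpa using this
    exact ⟨h0, step 0 h0⟩
  | succ k ih =>
    have h0 : ∀ E : ℝ≥0, upTime w a (k + 1) = E →
        (phase a w (firstUpper w a + 2 * (k + 1))).R + (k + 1 : ℕ) * (a - b) ≤ R E ∧
        ∀ t, E ≤ t → (phase a w (firstUpper w a + 2 * (k + 1))).totalDivs a w t
          + ((k + 1 : ℕ) + 1) * (a - b) ≤ L t := by
      intro E hE
      have hph := phase_upper_lower hw ha k
      have hph' := phase_upper_lower hw ha (k + 1)
      have hD : drawdownTime w a (upTime w a k) ≠ ∞ :=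
        ((drawdownTime_le_upTime_succ k).trans_lt (hE ▸ ENNReal.coe_lt_top)).ne
      have hD' := (ENNReal.coe_toNNReal hD).symm
      obtain ⟨h1, h2⟩ := ih.2 _ hD'
      have := compare_lower (p := phase a w (firstUpper w a + 2 * k + 1)) (E := E)
        (c := (k + 1) * (a - b)) (d := (k + 1) * (a - b)) hw ha hr hph.2.1
        (by rw [← hE]; exact hph'.1.2) (fun t ht => h2 t ?_) (by rw [hph.2.2]; exact h1)
      · push_cast
        refine ⟨this.1, fun t ht => ?_⟩
        have := this.2 t ht
        change (Phase.next a w (phase a w (firstUpper w a + 2 * k + 1))).totalDivs a w t + _ ≤ _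
        linarith
      · rw [hph.2.2] at ht
        exact toNNReal_le_of_le_coe ht
    exact ⟨h0, step (k + 1) h0⟩

/-! ### The comparison at a fixed time -/

theorem activeIndex_lt_firstUpper (hw : IsCadlag w) (ha : 0 < a) (ht : (t : ℝ≥0∞) < upTime w a 0) :
    activeIndex a w t < firstUpper w a := by
  have h0 : 0 < firstUpper w a := by unfold firstUpper; split_ifs <;> omega
  have : activeIndex a w t ≤ firstUpper w a - 1 := by
    refine Nat.sInf_le ?_
    rw [mem_ofPred_eq, Nat.sub_add_cancel h0, (phase_firstUpper hw ha).2]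
    exact ht
  omega

theorem dividends_eq_zero (hw : IsCadlag w) (ha : 0 < a) (ht : (t : ℝ≥0∞) < upTime w a 0) :
    dividends a w t = 0 := by
  have hi := activeIndex_lt_firstUpper hw ha ht
  rw [dividends_eq, Phase.totalDivs]
  unfold firstUpper at hi
  split_ifs at hi with h
  · have h1 : phase a w 1 = (phase a w 0).switch a w .lower (belowTime w) := by
      rw [phase_one hw, if_pos h]
    interval_cases activeIndex a w t
    · simp [phase, Phase.divs]
    · rw [h1, Phase.divs_of_ne (by simp [Phase.switch])]
      simp [Phase.switch, phase, Phase.divs]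
  · interval_cases activeIndex a w t
    simp [phase, Phase.divs]

theorem injections_le_of_lt_upTime (hw : IsCadlag w) (ha : 0 < a) (hr : Reflects w b L R)
    (ht : (t : ℝ≥0∞) < upTime w a 0) : injections a w t ≤ R t := by
  have hi := activeIndex_lt_firstUpper hw ha ht
  have hst := start_activeIndex_le (a := a) (w := w) t
  rw [injections_eq, Phase.totalInjs]
  have h0 := hr.right_nonneg' t
  unfold firstUpper at hi
  split_ifs at hi with h
  · have h1 : phase a w 1 = (phase a w 0).switch a w .lower (belowTime w) := by
      rw [phase_one hw, if_pos h]
    interval_cases activeIndex a w t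
    · simpa [phase, Phase.injs] using h0
    · rw [h1] at hst ⊢
      have hBt : (belowTime w).toNNReal ≤ t := toNNReal_le_of_le_coe hst
      rw [Phase.injs_lower rfl]
      simp only [Phase.switch, phase_zero_risk,
        Phase.injs_of_ne (p := phase a w 0) (by simp [phase])]
      have : runSup (-w) (belowTime w).toNNReal t ≤ R t + w (belowTime w).toNNReal := by
        refine runSup_le hBt fun v hv1 hv2 => ?_
        have := hr.neg_le_right v
        have := hr.monotone_right hv2
        simp only [Pi.neg_apply]
        linarith
      simp only [phase]
      linarith
  · interval_cases activeIndex a w t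
    simpa [phase, Phase.injs] using h0

/-- Every time belongs to one of the phases. -/
theorem exists_phase (hw : IsCadlag w) (ha : 0 < a) (t : ℝ≥0) :
    (t : ℝ≥0∞) < upTime w a 0 ∨
    (∃ k, upTime w a k ≤ t ∧ (t : ℝ≥0∞) < drawdownTime w a (upTime w a k)) ∨
    ∃ k, drawdownTime w a (upTime w a k) ≤ t ∧ (t : ℝ≥0∞) < upTime w a (k + 1) := by
  classical
  have hex := hw.exists_lt_upTime ha t
  rcases h : Nat.find hex with _ | k
  · left
    have := Nat.find_spec hex
    rwa [h] at this
  · right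
    have h1 := Nat.find_spec hex
    rw [h] at h1
    have h2 : upTime w a k ≤ t := not_lt.1 (Nat.find_min hex (by omega))
    rcases lt_or_ge (t : ℝ≥0∞) (drawdownTime w a (upTime w a k)) with h3 | h3
    · exact Or.inl ⟨k, h2, h3⟩
    · exact Or.inr ⟨k, h3, h1⟩

theorem monotone_drawdownTime_upTime : Monotone fun k => drawdownTime w a (upTime w a k) :=
  fun _ _ h => drawdownTime_mono le_rfl (monotone_upTime h)

/-- The numbers of upper phases and of subsequent lower phases begun by time `t` bound the gain of
a reflection at another level. -/
theorem exists_count (hw : IsCadlag w) (ha : 0 < a) (t : ℝ≥0) :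
    ∃ m n : ℕ, (∀ k, upTime w a k ≤ t ↔ k < m) ∧
      (∀ k, drawdownTime w a (upTime w a k) ≤ t ↔ k < n) ∧
      ∀ (b : ℝ) (L R : ℝ≥0 → ℝ), Reflects w b L R →
        dividends a w t + m * (a - b) ≤ L t ∧ injections a w t + n * (a - b) ≤ R t := by
  have hmU := monotone_upTime (w := w) (a := a)
  have hmD := monotone_drawdownTime_upTime (w := w) (a := a)
  rcases exists_phase hw ha t with h | ⟨k, h1, h2⟩ | ⟨k, h1, h2⟩
  · refine ⟨0, 0, fun k => ?_, fun k => ?_, fun b L R hr => ⟨?_, ?_⟩⟩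
    · simpa using h.trans_le (hmU (Nat.zero_le k))
    · simpa using (h.trans_le (hmU (Nat.zero_le k))).trans_le le_drawdownTime
    · simpa [dividends_eq_zero hw ha h] using hr.left_nonneg' t
    · simpa using injections_le_of_lt_upTime hw ha hr h
  · have hph := phase_upper_lower hw ha k
    have hidx : activeIndex a w t = firstUpper w a + 2 * k :=
      activeIndex_eq_of hw ha (by rwa [hph.1.2]) (by rwa [hph.2.2])
    have hU := (ENNReal.coe_toNNReal (h1.trans_lt ENNReal.coe_lt_top).ne).symm
    refine ⟨k + 1, k, fun j => ⟨fun hj => ?_, fun hj => (hmU (by omega)).trans h1⟩,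
      fun j => ⟨fun hj => ?_, fun hj => ?_⟩, fun b L R hr => ?_⟩
    · by_contra! hkj
      exact ((h2.trans_le (drawdownTime_le_upTime_succ k)).trans_le (hmU hkj)).not_ge hj
    · by_contra! hkj
      exact (h2.trans_le (hmD hkj)).not_ge hj
    · exact (drawdownTime_le_upTime_succ j).trans ((hmU hj).trans h1)
    · obtain ⟨h3, h4⟩ := (compare_phase hw ha hr k).1 _ hU
      have hle := toNNReal_le_of_le_coe h1
      rw [dividends_eq, injections_eq, hidx]
      have := h4 t hle
      rw [Phase.totalInjs, Phase.injs_of_ne (by simp [hph.1.1])]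
      have := hr.monotone_right hle
      push_cast
      exact ⟨by linarith, by linarith⟩
  · have hph := phase_upper_lower hw ha k
    have hph' := phase_upper_lower hw ha (k + 1)
    have hidx : activeIndex a w t = firstUpper w a + 2 * k + 1 :=
      activeIndex_eq_of hw ha (by rwa [hph.2.2])
        (by rw [show firstUpper w a + 2 * k + 1 + 1 = firstUpper w a + 2 * (k + 1) by ring,
              hph'.1.2]; exact h2)
    have hD := (ENNReal.coe_toNNReal (h1.trans_lt ENNReal.coe_lt_top).ne).symm
    refine ⟨k + 1, k + 1, fun j => ⟨fun hj => ?_, fun hj => ?_⟩,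
      fun j => ⟨fun hj => ?_, fun hj => ?_⟩, fun b L R hr => ?_⟩
    · by_contra! hkj
      exact (h2.trans_le (hmU hkj)).not_ge hj
    · exact (hmU (Nat.lt_succ_iff.1 hj)).trans ((upTime_le_drawdownTime k).trans h1)
    · by_contra! hkj
      exact ((h2.trans_le (hmU hkj)).trans_le le_drawdownTime).not_ge hj
    · exact (hmD (Nat.lt_succ_iff.1 hj)).trans h1
    · obtain ⟨h3, h4⟩ := (compare_phase hw ha hr k).2 _ hD
      have hle := toNNReal_le_of_le_coe h1
      rw [dividends_eq, injections_eq, hidx]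
      have := h4 t hle
      rw [Phase.totalDivs, Phase.divs_of_ne (by simp [hph.2.1])]
      have := hr.monotone_left hle
      push_cast
      exact ⟨by linarith, by linarith⟩

/-- Every reflection has paid once the path exceeds `a` or has risen by more than `a`, and nothing
is paid before the first upper phase. -/
theorem firstTime_dividends (hw : IsCadlag w) (ha : 0 < a) :
    firstTime {t | 0 < dividends a w t} = firstUpTime w a := by
  have hr := reflects_doubleBarrier hw ha
  refine le_antisymm (firstTime_anti ?_) (le_firstTime fun t ht => ?_)
  · rintro t (h | ⟨u, hut, h⟩)
    · have := hr.le_left t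
      simp only [mem_ofPred_eq]
      linarith
    · have := hr.sub_le_left hut
      have := hr.left_nonneg' u
      simp only [mem_ofPred_eq]
      linarith
  · by_contra! hlt
    rw [mem_ofPred_eq, dividends_eq_zero hw ha hlt] at ht
    exact lt_irrefl _ ht

end DoubleBarrier

end

noncomputable section

namespace DoubleBarrier

/-! ### Present values as integrals against an exponential law -/

/-- The exponential law of rate `q`, on nonnegative times. -/
def expLaw (q : ℝ) : Measure ℝ≥0 := (expMeasure q).map Real.toNNReal

/-- The discount factor as an extended nonnegative number. -/
def ediscount (q : ℝ) (T : ℝ≥0∞) : ℝ≥0∞ := ENNReal.ofReal (discount q T)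

theorem isProbabilityMeasure_expLaw {q : ℝ} (hq : 0 < q) : IsProbabilityMeasure (expLaw q) := by
  have := isProbabilityMeasure_expMeasure hq
  exact Measure.isProbabilityMeasure_map measurable_real_toNNReal.aemeasurable

/-- Lets end points and the countably many discontinuities of a monotone function be ignored. -/
instance nullSingletonClass_expMeasure (q : ℝ) : NullSingletonClass (expMeasure q) where
  measure_singleton x := by
    have : expMeasure q ≪ volume := withDensity_absolutelyContinuous _ _
    exact this Real.volume_singleton

theorem expMeasure_Iic {q : ℝ} (hq : 0 < q) {s : ℝ} (hs : 0 ≤ s) :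
    expMeasure q (Iic s) = ENNReal.ofReal (1 - Real.exp (-q * s)) := by
  have := isProbabilityMeasure_expMeasure hq
  rw [← ofReal_cdf, cdf_expMeasure_eq hq, if_pos hs, neg_mul]

theorem expMeasure_Ici {q : ℝ} (hq : 0 < q) {s : ℝ} (hs : 0 ≤ s) :
    expMeasure q (Ici s) = ENNReal.ofReal (Real.exp (-q * s)) := by
  have := isProbabilityMeasure_expMeasure hq
  rw [← measure_congr Ioi_ae_eq_Ici, ← compl_Iic, prob_compl_eq_one_sub measurableSet_Iic,
    expMeasure_Iic hq hs, ← ENNReal.ofReal_one, ← ENNReal.ofReal_sub]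
  · congr 1
    ring
  · rw [sub_nonneg, Real.exp_le_one_iff]
    nlinarith

theorem ae_nonneg_expMeasure {q : ℝ} (hq : 0 < q) : ∀ᵐ s ∂expMeasure q, 0 ≤ s := by
  have h : expMeasure q (Iic 0) = 0 := by simp [expMeasure_Iic hq le_rfl]
  rw [ae_iff]
  refine measure_mono_null (fun s hs => ?_) h
  simp only [mem_ofPred_eq, not_le] at hs
  exact hs.le

theorem discount_coe (q : ℝ) (t : ℝ≥0) : discount q t = Real.exp (-q * t) := by
  simp [discount]

theorem discount_top (q : ℝ) : discount q ∞ = 0 := by simp [discount]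

/-- A discount factor is the probability that an exponential time falls at or after `T`, so sums of
discount factors are expected counts at that time. -/
theorem expLaw_setOf_le {q : ℝ} (hq : 0 < q) (T : ℝ≥0∞) :
    expLaw q {t : ℝ≥0 | T ≤ t} = ediscount q T := by
  rcases eq_or_ne T ∞ with rfl | hT
  · simp [ediscount, discount_top]
  · lift T to ℝ≥0 using hT
    have h : {t : ℝ≥0 | (T : ℝ≥0∞) ≤ t} = Ici T := by
      ext t
      simp
    rw [h, expLaw, Measure.map_apply measurable_real_toNNReal measurableSet_Ici, ediscount,
      discount_coe]
    rw [← expMeasure_Ici hq (NNReal.coe_nonneg T)]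
    -- At `T = 0` the preimage under `Real.toNNReal` is the whole line, not `Ici 0`.
    rcases eq_or_ne T 0 with rfl | hT0
    · have h1 := isProbabilityMeasure_expMeasure hq
      have h2 : Real.toNNReal ⁻¹' Ici (0 : ℝ≥0) = univ := by ext; simp
      rw [h2, measure_univ, NNReal.coe_zero, expMeasure_Ici hq le_rfl]
      simp
    · congr 1
      ext s
      simp [Real.le_toNNReal_iff_coe_le' (pos_iff_ne_zero.2 hT0)]

theorem monotone_extendByZero {A : ℝ≥0 → ℝ} (hA : Monotone A) (h0 : 0 ≤ A 0) :
    Monotone (extendByZero A) := by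
  intro s t hst
  unfold extendByZero
  split_ifs with h1 h2
  · exact hA (Real.toNNReal_mono hst)
  · exact absurd (h1.trans hst) h2
  · exact h0.trans (hA zero_le)
  · exact le_rfl

/-- Tonelli: write `e^{-qt}` as the probability that an exponential time `S` is at least `t` and
exchange the integrals, which leaves the expectation of `A` at `S`. Present values are compared in
this way without comparing Stieltjes measures. -/
theorem presentValue_eq {q : ℝ} (hq : 0 < q) {A : ℝ≥0 → ℝ} (hA : Monotone A) (h0 : 0 ≤ A 0) :
    presentValue q A = ∫⁻ t, ENNReal.ofReal (A t) ∂expLaw q := by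
  have hm := monotone_extendByZero hA h0
  have hprob := isProbabilityMeasure_expMeasure hq
  rw [presentValue, dif_pos hm]
  set μ := hm.stieltjesFunction.measure with hμ
  have hright : ∀ t < 0, hm.stieltjesFunction t = 0 := by
    intro t ht
    rw [Monotone.stieltjesFunction_eq]
    refine rightLim_eq_of_tendsto ?_
    refine tendsto_const_nhds.congr' ?_
    filter_upwards [Ioo_mem_nhdsGT ht] with s hs
    simp [extendByZero, hs.2]
  have hleft : Function.leftLim hm.stieltjesFunction 0 = 0 := by
    refine leftLim_eq_of_tendsto ?_
    refine tendsto_const_nhds.congr' ?_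
    filter_upwards [self_mem_nhdsWithin] with s hs
    exact (hright s hs).symm
  have h1 : ∫⁻ t in Ici (0 : ℝ), ENNReal.ofReal (Real.exp (-q * t)) ∂μ
      = ∫⁻ t in Ici (0 : ℝ), ∫⁻ s, (Ici t).indicator 1 s ∂expMeasure q ∂μ := by
    refine setLIntegral_congr_fun measurableSet_Ici fun t ht => ?_
    rw [lintegral_indicator_one measurableSet_Ici, expMeasure_Ici hq ht]
  have hmeas : Measurable (Function.uncurry fun t s : ℝ => (Ici t).indicator (1 : ℝ → ℝ≥0∞) s) := by
    have : (Function.uncurry fun t s : ℝ => (Ici t).indicator (1 : ℝ → ℝ≥0∞) s)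
        = {p : ℝ × ℝ | p.1 ≤ p.2}.indicator 1 := by
      ext ⟨t, s⟩
      simp [indicator]
    rw [this]
    exact measurable_one.indicator (measurableSet_le measurable_fst measurable_snd)
  rw [h1, lintegral_lintegral_swap hmeas.aemeasurable, expLaw,
    lintegral_map (hA.measurable.ennreal_ofReal) measurable_real_toNNReal]
  refine lintegral_congr_ae ?_
  -- The Stieltjes function is the right limit of `A` and equals `A` off a countable, hence null,
  -- set; right continuity of `A` never has to be proved.
  have hcount := hm.countable_not_continuousAt
  filter_upwards [ae_nonneg_expMeasure hq, hcount.ae_notMem (expMeasure q)] with s hs hcont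
  have h2 : ∫⁻ t in Ici (0 : ℝ), (Ici t).indicator (1 : ℝ → ℝ≥0∞) s ∂μ = μ (Icc 0 s) := by
    have : (fun t : ℝ => (Ici t).indicator (1 : ℝ → ℝ≥0∞) s) = (Iic s).indicator 1 := by
      ext t
      simp [indicator]
    rw [this, lintegral_indicator_one measurableSet_Iic, Measure.restrict_apply measurableSet_Iic,
      inter_comm, Ici_inter_Iic]
  rw [h2, hμ, StieltjesFunction.measure_Icc, hleft, sub_zero, Monotone.stieltjesFunction_eq]
  simp only [not_not] at hcont
  rw [hcont.tendsto.mono_left nhdsWithin_le_nhds |> rightLim_eq_of_tendsto]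
  simp [extendByZero, hs]

/-! ### Pathwise bounds of present values -/

variable {w : ℝ≥0 → ℝ} {a b q : ℝ}

/-- The number of upper phases begun by time `t`. -/
def upCount (w : ℝ≥0 → ℝ) (a : ℝ) (t : ℝ≥0) : ℝ≥0∞ :=
  ∑' k, {t : ℝ≥0 | upTime w a k ≤ t}.indicator 1 t

/-- The number of lower phases begun by time `t` after an upper phase. -/
def downCount (w : ℝ≥0 → ℝ) (a : ℝ) (t : ℝ≥0) : ℝ≥0∞ :=
  ∑' k, {t : ℝ≥0 | drawdownTime w a (upTime w a k) ≤ t}.indicator 1 t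

theorem measurableSet_le_coe (T : ℝ≥0∞) : MeasurableSet {t : ℝ≥0 | T ≤ t} :=
  measurableSet_le measurable_const measurable_coe_nnreal_ennreal

theorem measurable_upCount : Measurable (upCount w a) :=
  Measurable.tsum fun _ => measurable_one.indicator (measurableSet_le_coe _)

theorem measurable_downCount : Measurable (downCount w a) :=
  Measurable.tsum fun _ => measurable_one.indicator (measurableSet_le_coe _)

theorem lintegral_upCount (hq : 0 < q) :
    ∫⁻ t, upCount w a t ∂expLaw q = ∑' k, ediscount q (upTime w a k) := by
  unfold upCount
  rw [lintegral_tsum fun _ => (measurable_one.indicator (measurableSet_le_coe _)).aemeasurable]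
  refine tsum_congr fun k => ?_
  rw [lintegral_indicator_one (measurableSet_le_coe _), expLaw_setOf_le hq]

theorem lintegral_downCount (hq : 0 < q) :
    ∫⁻ t, downCount w a t ∂expLaw q = ∑' k, ediscount q (drawdownTime w a (upTime w a k)) := by
  unfold downCount
  rw [lintegral_tsum fun _ => (measurable_one.indicator (measurableSet_le_coe _)).aemeasurable]
  refine tsum_congr fun k => ?_
  rw [lintegral_indicator_one (measurableSet_le_coe _), expLaw_setOf_le hq]

theorem tsum_indicator_eq {f : ℕ → ℝ≥0∞} {t : ℝ≥0} {m : ℕ} (h : ∀ k, f k ≤ t ↔ k < m) :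
    ∑' k, {t : ℝ≥0 | f k ≤ t}.indicator (1 : ℝ≥0 → ℝ≥0∞) t = m := by
  rw [tsum_eq_sum (s := Finset.range m)]
  · rw [Finset.sum_congr rfl (g := fun _ => (1 : ℝ≥0∞))]
    · simp
    · intro k hk
      simp [(h k).2 (Finset.mem_range.1 hk)]
  · intro k hk
    have : ¬ f k ≤ t := fun hle => hk (Finset.mem_range.2 ((h k).1 hle))
    simpa using this

/-- The strategy at `b` is measured against the one at `a` as competitor, so the count is that of
level `b`. Exchanging the roles gives the opposite bound, with the count of level `a`. -/
theorem IsCadlag.dividends_add_le (hw : IsCadlag w) (ha : 0 < a) (hab : a ≤ b) (t : ℝ≥0) :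
    ENNReal.ofReal (dividends b w t) + ENNReal.ofReal (b - a) * upCount w b t
      ≤ ENNReal.ofReal (dividends a w t) := by
  obtain ⟨m, n, hm, hn, h⟩ := exists_count hw (ha.trans_le hab) t
  have hb := reflects_doubleBarrier hw (ha.trans_le hab)
  rw [upCount, tsum_indicator_eq hm, ← ENNReal.ofReal_natCast,
    ← ENNReal.ofReal_mul (by linarith), ← ENNReal.ofReal_add (hb.left_nonneg' t)
      (mul_nonneg (by linarith) (Nat.cast_nonneg m))]
  refine ENNReal.ofReal_le_ofReal ?_
  have := (h a _ _ (reflects_doubleBarrier hw ha)).1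
  linarith

theorem IsCadlag.dividends_le_add (hw : IsCadlag w) (ha : 0 < a) (hab : a ≤ b) (t : ℝ≥0) :
    ENNReal.ofReal (dividends a w t)
      ≤ ENNReal.ofReal (dividends b w t) + ENNReal.ofReal (b - a) * upCount w a t := by
  obtain ⟨m, n, hm, hn, h⟩ := exists_count hw ha t
  have hb := reflects_doubleBarrier hw (ha.trans_le hab)
  rw [upCount, tsum_indicator_eq hm, ← ENNReal.ofReal_natCast,
    ← ENNReal.ofReal_mul (by linarith), ← ENNReal.ofReal_add (hb.left_nonneg' t)
      (mul_nonneg (by linarith) (Nat.cast_nonneg m))]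
  refine ENNReal.ofReal_le_ofReal ?_
  have := (h b _ _ hb).1
  linarith

theorem IsCadlag.injections_add_le (hw : IsCadlag w) (ha : 0 < a) (hab : a ≤ b) (t : ℝ≥0) :
    ENNReal.ofReal (injections b w t) + ENNReal.ofReal (b - a) * downCount w b t
      ≤ ENNReal.ofReal (injections a w t) := by
  obtain ⟨m, n, hm, hn, h⟩ := exists_count hw (ha.trans_le hab) t
  have hb := reflects_doubleBarrier hw (ha.trans_le hab)
  rw [downCount, tsum_indicator_eq hn, ← ENNReal.ofReal_natCast,
    ← ENNReal.ofReal_mul (by linarith), ← ENNReal.ofReal_add (hb.right_nonneg' t)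
      (mul_nonneg (by linarith) (Nat.cast_nonneg n))]
  refine ENNReal.ofReal_le_ofReal ?_
  have := (h a _ _ (reflects_doubleBarrier hw ha)).2
  linarith

theorem IsCadlag.injections_le_add (hw : IsCadlag w) (ha : 0 < a) (hab : a ≤ b) (t : ℝ≥0) :
    ENNReal.ofReal (injections a w t)
      ≤ ENNReal.ofReal (injections b w t) + ENNReal.ofReal (b - a) * downCount w a t := by
  obtain ⟨m, n, hm, hn, h⟩ := exists_count hw ha t
  have hb := reflects_doubleBarrier hw (ha.trans_le hab)
  rw [downCount, tsum_indicator_eq hn, ← ENNReal.ofReal_natCast,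
    ← ENNReal.ofReal_mul (by linarith), ← ENNReal.ofReal_add (hb.right_nonneg' t)
      (mul_nonneg (by linarith) (Nat.cast_nonneg n))]
  refine ENNReal.ofReal_le_ofReal ?_
  have := (h b _ _ hb).2
  linarith

theorem IsCadlag.presentValue_dividends (hw : IsCadlag w) (hq : 0 < q) (ha : 0 < a) :
    presentValue q (dividends a w) = ∫⁻ t, ENNReal.ofReal (dividends a w t) ∂expLaw q :=
  have h := reflects_doubleBarrier hw ha
  presentValue_eq hq h.monotone_left h.left_nonneg

theorem IsCadlag.presentValue_injections (hw : IsCadlag w) (hq : 0 < q) (ha : 0 < a) :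
    presentValue q (injections a w) = ∫⁻ t, ENNReal.ofReal (injections a w t) ∂expLaw q :=
  have h := reflects_doubleBarrier hw ha
  presentValue_eq hq h.monotone_right h.right_nonneg

theorem IsCadlag.presentValue_dividends_add_le (hw : IsCadlag w) (hq : 0 < q) (ha : 0 < a)
    (hab : a ≤ b) :
    presentValue q (dividends b w) + ENNReal.ofReal (b - a) * ∑' k, ediscount q (upTime w b k)
      ≤ presentValue q (dividends a w) := by
  rw [hw.presentValue_dividends hq ha, hw.presentValue_dividends hq (ha.trans_le hab),
    ← lintegral_upCount hq, ← lintegral_const_mul _ measurable_upCount,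
    ← lintegral_add_right _ (measurable_upCount.const_mul _)]
  exact lintegral_mono fun t => hw.dividends_add_le ha hab t

theorem IsCadlag.presentValue_dividends_le_add (hw : IsCadlag w) (hq : 0 < q) (ha : 0 < a)
    (hab : a ≤ b) :
    presentValue q (dividends a w) ≤ presentValue q (dividends b w)
      + ENNReal.ofReal (b - a) * ∑' k, ediscount q (upTime w a k) := by
  rw [hw.presentValue_dividends hq ha, hw.presentValue_dividends hq (ha.trans_le hab),
    ← lintegral_upCount hq, ← lintegral_const_mul _ measurable_upCount,
    ← lintegral_add_right _ (measurable_upCount.const_mul _)]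
  exact lintegral_mono fun t => hw.dividends_le_add ha hab t

theorem IsCadlag.presentValue_injections_add_le (hw : IsCadlag w) (hq : 0 < q) (ha : 0 < a)
    (hab : a ≤ b) :
    presentValue q (injections b w)
      + ENNReal.ofReal (b - a) * ∑' k, ediscount q (drawdownTime w b (upTime w b k))
      ≤ presentValue q (injections a w) := by
  rw [hw.presentValue_injections hq ha, hw.presentValue_injections hq (ha.trans_le hab),
    ← lintegral_downCount hq, ← lintegral_const_mul _ measurable_downCount,
    ← lintegral_add_right _ (measurable_downCount.const_mul _)]
  exact lintegral_mono fun t => hw.injections_add_le ha hab t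

theorem IsCadlag.presentValue_injections_le_add (hw : IsCadlag w) (hq : 0 < q) (ha : 0 < a)
    (hab : a ≤ b) :
    presentValue q (injections a w) ≤ presentValue q (injections b w)
      + ENNReal.ofReal (b - a) * ∑' k, ediscount q (drawdownTime w a (upTime w a k)) := by
  rw [hw.presentValue_injections hq ha, hw.presentValue_injections hq (ha.trans_le hab),
    ← lintegral_downCount hq, ← lintegral_const_mul _ measurable_downCount,
    ← lintegral_add_right _ (measurable_downCount.const_mul _)]
  exact lintegral_mono fun t => hw.injections_le_add ha hab t

/-! ### Pathwise bounds for finiteness of the values -/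

theorem IsCadlag.exists_lt_firstUpTime (hw : IsCadlag w) (ha : 0 < a) (t : ℝ≥0) :
    ∃ n : ℕ, (t : ℝ≥0∞) < firstUpTime w (a + n) := by
  obtain ⟨C, hC⟩ := hw.exists_bound (t + 1)
  obtain ⟨n, hn⟩ := exists_nat_gt (2 * C)
  refine ⟨n, lt_of_lt_of_le (b := ((t + 1 : ℝ≥0) : ℝ≥0∞))
    (by exact_mod_cast lt_add_one t) (le_firstTime ?_)⟩
  rintro s hs
  by_contra! hlt
  have hst : s < t + 1 := by exact_mod_cast hlt
  have h1 := abs_le.1 (hC s hst.le)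
  rcases hs with hs | ⟨u, hus, hs⟩
  · linarith
  · have h2 := abs_le.1 (hC u (hus.trans hst.le))
    linarith

/-- Raising the level by `1` loses at most the number of upper phases begun at the lower level. The
path is bounded up to `t`, so after finitely many steps no dividends are left. -/
theorem IsCadlag.dividends_le_tsum (hw : IsCadlag w) (ha : 0 < a) (t : ℝ≥0) :
    ENNReal.ofReal (dividends a w t) ≤ ∑' n : ℕ, upCount w (a + n) t := by
  have hpos : ∀ n : ℕ, 0 < a + n := fun n => by positivity
  have key : ∀ n : ℕ, ENNReal.ofReal (dividends a w t)
      ≤ ∑ j ∈ Finset.range n, upCount w (a + j) t + ENNReal.ofReal (dividends (a + n) w t) := by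
    intro n
    induction n with
    | zero => simp
    | succ n ih =>
      refine ih.trans ?_
      rw [Finset.sum_range_succ, add_assoc]
      gcongr
      have := hw.dividends_le_add (hpos n) (b := a + (n + 1 : ℕ)) (by push_cast; linarith) t
      rw [show a + (n + 1 : ℕ) - (a + n) = 1 by push_cast; ring, ENNReal.ofReal_one,
        one_mul] at this
      rwa [add_comm (upCount _ _ _)]
  obtain ⟨n, hn⟩ := hw.exists_lt_firstUpTime ha t
  refine (key n).trans ?_
  rw [dividends_eq_zero hw (hpos n) hn, ENNReal.ofReal_zero, add_zero]
  exact ENNReal.sum_le_tsum _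

theorem IsCadlag.presentValue_dividends_le_tsum (hw : IsCadlag w) (hq : 0 < q) (ha : 0 < a) :
    presentValue q (dividends a w)
      ≤ ∑' n : ℕ, ∑' k, ediscount q (upTime w (a + n) k) := by
  rw [hw.presentValue_dividends hq ha]
  simp only [← lintegral_upCount hq]
  rw [← lintegral_tsum fun _ => measurable_upCount.aemeasurable]
  exact lintegral_mono fun t => hw.dividends_le_tsum ha t

theorem IsCadlag.presentValue_injections_le (hw : IsCadlag w) (hq : 0 < q) (ha : 0 < a) :
    presentValue q (injections a w) ≤ ENNReal.ofReal a
      + ∫⁻ t, ENNReal.ofReal |w t| ∂expLaw q + presentValue q (dividends a w) := by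
  have hr := reflects_doubleBarrier hw ha
  have := isProbabilityMeasure_expLaw hq
  rw [hw.presentValue_dividends hq ha, hw.presentValue_injections hq ha]
  calc ∫⁻ t, ENNReal.ofReal (injections a w t) ∂expLaw q
      ≤ ∫⁻ t, (ENNReal.ofReal a + ENNReal.ofReal |w t|) + ENNReal.ofReal (dividends a w t)
          ∂expLaw q := by
        refine lintegral_mono fun t => ?_
        rw [← ENNReal.ofReal_add ha.le (abs_nonneg _),
          ← ENNReal.ofReal_add (by positivity) (hr.left_nonneg' t)]
        exact ENNReal.ofReal_le_ofReal (hr.right_le t)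
    _ = _ := by
        rw [lintegral_add_right _ hr.monotone_left.measurable.ennreal_ofReal,
          lintegral_add_left measurable_const]
        simp

end DoubleBarrier

end

noncomputable section

namespace DoubleBarrier

/-! ### Lévy processes all of whose paths are càdlàg -/

/-- A Lévy process started at `0` all of whose paths are càdlàg. -/
structure IsCadlagLevy {Ω : Type*} [MeasurableSpace Ω] (X : ℝ≥0 → Ω → ℝ) (P : Measure Ω) :
    Prop where
  measurable : ∀ t, Measurable (X t)
  zero : ∀ ω, X 0 ω = 0
  indep : HasIndepIncrements X P
  stationary : ∀ s t, IdentDistrib (fun ω => X (s + t) ω - X s ω) (X t) P P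
  cadlag : ∀ ω, IsCadlag (fun t => X t ω)

variable {Ω : Type*} [MeasurableSpace Ω] {X : ℝ≥0 → Ω → ℝ} {P : Measure Ω}

/-- The process is replaced by the zero path on a measurable null set containing all bad paths,
which preserves laws and independence of increments. -/
theorem IsLevyProcess.exists_cadlag (hX : IsLevyProcess X P) :
    ∃ X' : ℝ≥0 → Ω → ℝ, IsCadlagLevy X' P ∧ ∀ᵐ ω ∂P, ∀ t, X' t ω = X t ω := by
  classical
  have hae : ∀ᵐ ω ∂P, X 0 ω = 0 ∧ IsCadlag (fun t => X t ω) := by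
    filter_upwards [hX.zero, hX.cadlag] with ω h0 h
    exact ⟨h0, fun t => (h t).1, fun t => (h t).2⟩
  obtain ⟨N, hN, hNm, hN0⟩ := exists_measurable_superset_of_null hae
  have hgood : ∀ ω ∉ N, X 0 ω = 0 ∧ IsCadlag (fun t => X t ω) := fun ω hω => by
    by_contra hcon
    exact hω (hN hcon)
  set X' : ℝ≥0 → Ω → ℝ := fun t => Nᶜ.indicator (X t) with hX'
  have haeq : ∀ᵐ ω ∂P, ∀ t, X' t ω = X t ω := by
    have : ∀ᵐ ω ∂P, ω ∉ N := by rwa [ae_iff, show {ω | ¬ ω ∉ N} = N by ext; simp]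
    filter_upwards [this] with ω hω t
    simp [hX', hω]
  have haeq' : ∀ t, X' t =ᵐ[P] X t := fun t => by filter_upwards [haeq] with ω h using h t
  have hm : ∀ t, Measurable (X' t) := fun t => (hX.measurable t).indicator hNm.compl
  refine ⟨X', ⟨hm, fun ω => ?_, fun n t ht => ?_, fun s t => ?_, fun ω => ?_⟩, haeq⟩
  · by_cases hω : ω ∈ N
    · simp [hX', hω]
    · simp [hX', hω, (hgood ω hω).1]
  · exact (hX.indep n t ht).congr fun i => ((haeq' _).sub (haeq' _)).symm
  · refine ((IdentDistrib.of_ae_eq ?_ ?_).trans (hX.stationary s t)).trans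
      (IdentDistrib.of_ae_eq (hX.measurable t).aemeasurable (haeq' t).symm)
    · exact ((hm _).sub (hm _)).aemeasurable
    · exact (haeq' _).sub (haeq' _)
  · by_cases hω : ω ∈ N
    · simp only [hX', indicator_of_notMem (show ω ∉ Nᶜ by simpa using hω)]
      exact ⟨fun t => continuousWithinAt_const, fun t => ⟨0, tendsto_const_nhds⟩⟩
    · simp only [hX', indicator_of_mem (show ω ∈ Nᶜ from hω)]
      exact (hgood ω hω).2

/-! ### Stationarity and independence of the shifted process -/

/-- The increments of the process after time `s`. -/
def shifted (X : ℝ≥0 → Ω → ℝ) (s : ℝ≥0) (ω : Ω) : ℝ≥0 → ℝ := fun r => X (s + r) ω - X s ω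

/-- The events observed by time `s`. -/
abbrev past (X : ℝ≥0 → Ω → ℝ) (s : ℝ≥0) : MeasurableSpace Ω :=
  MeasurableSpace.comap (fun ω (r : Iic s) => X r ω) inferInstance

/-- Finitely many times, arranged as an eventually constant monotone sequence from `0`: values at
these times become partial sums of consecutive increments. -/
theorem exists_monotone_enum (K : Finset ℝ≥0) (h0 : 0 ∈ K) :
    ∃ t : ℕ → ℝ≥0, Monotone t ∧ t 0 = 0 ∧ ∀ k ∈ K, ∃ n, t n = k := by
  have hc : 0 < K.card := Finset.card_pos.2 ⟨0, h0⟩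
  have hmono : Monotone fun n => K.orderEmbOfFin rfl ⟨min n (K.card - 1), by omega⟩ :=
    fun m n hmn => (K.orderEmbOfFin rfl).monotone (Fin.mk_le_mk.2 (by omega))
  have hsurj : ∀ k ∈ K, ∃ n, K.orderEmbOfFin rfl ⟨min n (K.card - 1), by omega⟩ = k := by
    intro k hk
    have : k ∈ Set.range (K.orderEmbOfFin rfl) := by
      rw [Finset.range_orderEmbOfFin]
      exact hk
    obtain ⟨i, hi⟩ := this
    refine ⟨i, ?_⟩
    rw [← hi]
    congr 2
    omega
  refine ⟨_, hmono, ?_, hsurj⟩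
  obtain ⟨n, hn⟩ := hsurj 0 h0
  exact le_antisymm (hn ▸ hmono (Nat.zero_le n)) zero_le

namespace IsCadlagLevy

theorem measurable_shifted (hX : IsCadlagLevy X P) (s : ℝ≥0) : Measurable (shifted X s) :=
  measurable_pi_lambda _ fun r => (hX.measurable (s + r)).sub (hX.measurable s)

theorem measurable_path (hX : IsCadlagLevy X P) : Measurable fun ω t => X t ω :=
  measurable_pi_lambda _ hX.measurable

/-- Finite-dimensional laws suffice. Each is the same function of a sequence of independent
increments, whose marginal laws agree by stationarity. -/
theorem identDistrib_shifted [IsProbabilityMeasure P] (hX : IsCadlagLevy X P) (s : ℝ≥0) :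
    IdentDistrib (shifted X s) (fun ω t => X t ω) P P := by
  refine (identDistrib_iff_forall_finset_identDistrib (X := fun r ω => shifted X s ω r)
    (hX.measurable_shifted s).aemeasurable hX.measurable_path.aemeasurable).2 fun I => ?_
  obtain ⟨t, htm, ht0, hts⟩ := exists_monotone_enum (insert 0 I) (Finset.mem_insert_self _ _)
  choose idx hidx using fun i : I => hts i (Finset.mem_insert_of_mem i.2)
  have hts' : Monotone fun n => s + t n := fun m n h => add_le_add_right (htm h) s
  have hinc : IdentDistrib (fun ω n => X (s + t (n + 1)) ω - X (s + t n) ω)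
      (fun ω n => X (t (n + 1)) ω - X (t n) ω) P P := by
    refine IdentDistrib.pi (X := fun n ω => X (s + t (n + 1)) ω - X (s + t n) ω)
      (Y := fun n ω => X (t (n + 1)) ω - X (t n) ω) (fun n => ?_) (hX.indep.nat hts')
      (hX.indep.nat htm)
    have h1 := hX.stationary (s + t n) (t (n + 1) - t n)
    have h2 := hX.stationary (t n) (t (n + 1) - t n)
    rw [add_assoc, add_tsub_cancel_of_le (htm (Nat.le_succ n))] at h1
    rw [add_tsub_cancel_of_le (htm (Nat.le_succ n))] at h2
    exact h1.trans h2.symm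
  have hF : Measurable fun (e : ℕ → ℝ) (i : I) => ∑ n ∈ Finset.range (idx i), e n := by fun_prop
  have h := hinc.comp hF
  convert! h using 1
  · ext ω i
    simp only [Finset.restrict, Function.comp_apply, shifted]
    rw [Finset.sum_range_sub (fun n => X (s + t n) ω), hidx, ht0, add_zero]
  · ext ω i
    simp only [Finset.restrict, Function.comp_apply]
    rw [Finset.sum_range_sub (fun n => X (t n) ω), hidx, ht0, hX.zero, sub_zero]

/-- Along a common enumeration, past values are sums of increments with index below `m`, later ones
sums with index at least `m`; disjoint blocks are independent. -/
theorem indepFun_shifted [IsProbabilityMeasure P] (hX : IsCadlagLevy X P) (s : ℝ≥0) :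
    IndepFun (fun ω (r : Iic s) => X r ω) (shifted X s) P := by
  refine IndepFun.process_indepFun_process (X := fun (r : Iic s) ω => X r ω)
    (Y := fun r ω => shifted X s ω r) (fun r => hX.measurable r)
    (fun r => (hX.measurable _).sub (hX.measurable _)) fun I J => ?_
  classical
  obtain ⟨t, htm, ht0, hts⟩ := exists_monotone_enum
    (insert 0 (insert s (I.image Subtype.val ∪ J.image (s + ·)))) (Finset.mem_insert_self _ _)
  obtain ⟨m, hm⟩ := hts s (by simp)
  choose idI hidI using fun i : I => hts i (Finset.mem_insert_of_mem (Finset.mem_insert_of_mem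
    (Finset.mem_union_left _ (Finset.mem_image_of_mem _ i.2))))
  choose idJ hidJ using fun j : J => hts (s + j) (by simp)
  obtain ⟨M, hM⟩ : ∃ M, ∀ j, idJ j ≤ M := ⟨Finset.univ.sup idJ, fun j => Finset.le_sup (by simp)⟩
  have hS : Disjoint (Finset.range m) (Finset.Ico m M) := by
    rw [Finset.disjoint_left]
    intro k hk hk'
    simp at hk hk'
    omega
  have h := (hX.indep.nat htm).indepFun_finset _ _ hS
    (fun n => (hX.measurable _).sub (hX.measurable _))
  have hF : Measurable fun (e : Finset.range m → ℝ) (i : I) =>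
      ∑ n ∈ Finset.univ.filter (fun n : Finset.range m => n.1 < idI i), e n := by fun_prop
  have hG : Measurable fun (e : Finset.Ico m M → ℝ) (j : J) =>
      ∑ n ∈ Finset.univ.filter (fun n : Finset.Ico m M => n.1 < idJ j), e n := by fun_prop
  have h2 := h.comp hF hG
  convert! h2 using 1
  · ext ω i
    simp only [Function.comp_apply]
    rw [Finset.sum_filter, Finset.sum_coe_sort (Finset.range m)
      (fun n => if n < idI i then X (t (n + 1)) ω - X (t n) ω else 0), ← Finset.sum_filter]
    -- The enumeration may repeat values, so the index of a time up to `s` can exceed `m`.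
    -- Truncation at `m` does no harm, because `t` is monotone and `t m = s`.
    have h3 : (Finset.range m).filter (fun n => n < idI i) = Finset.range (min m (idI i)) := by
      ext n
      simp
    have h4 : t (min m (idI i)) = (i : Iic s) := by
      rw [htm.map_min, hm, hidI]
      exact min_eq_right i.1.2
    rw [h3, Finset.sum_range_sub (fun n => X (t n) ω), h4, ht0, hX.zero, sub_zero]
  · ext ω j
    simp only [Function.comp_apply, shifted]
    rw [Finset.sum_filter, Finset.sum_coe_sort (Finset.Ico m M)
      (fun n => if n < idJ j then X (t (n + 1)) ω - X (t n) ω else 0), ← Finset.sum_filter]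
    have h3 : (Finset.Ico m M).filter (fun n => n < idJ j) = Finset.Ico m (max m (idJ j)) := by
      ext n
      have := hM j
      simp only [Finset.mem_filter, Finset.mem_Ico]
      omega
    have h4 : t (max m (idJ j)) = s + j := by
      rw [htm.map_max, hm, hidJ]
      exact max_eq_right le_self_add
    rw [h3, Finset.sum_Ico_sub (fun n => X (t n) ω) (le_max_left _ _), h4, hm]

end IsCadlagLevy

theorem past_le (hX : IsCadlagLevy X P) (s : ℝ≥0) : past X s ≤ ‹MeasurableSpace Ω› :=
  (measurable_pi_lambda _ fun r : Iic s => hX.measurable r).comap_le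

theorem measurable_past {Ω : Type*} {X : ℝ≥0 → Ω → ℝ} {r s : ℝ≥0} (h : r ≤ s) : Measurable[past X s] (X r) :=
  (measurable_pi_apply (⟨r, h⟩ : Iic s)).comp
    (comap_measurable fun ω (r : Iic s) => X r ω)

theorem past_mono {Ω : Type*} {X : ℝ≥0 → Ω → ℝ} {r s : ℝ≥0} (h : r ≤ s) : past X r ≤ past X s := by
  rw [past, ← measurable_iff_comap_le]
  exact @measurable_pi_lambda _ _ _ (past X s) _ _
    fun i : Iic r => measurable_past (le_trans i.2 h)

/-- The Markov property at a fixed time. -/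
theorem IsCadlagLevy.setLIntegral_shifted [IsProbabilityMeasure P] (hX : IsCadlagLevy X P)
    {s : ℝ≥0} {A : Set Ω} (hA : MeasurableSet[past X s] A) {F : (ℝ≥0 → ℝ) → ℝ≥0∞}
    (hF : Measurable F) :
    ∫⁻ ω in A, F (shifted X s ω) ∂P = P A * ∫⁻ ω, F (fun t => X t ω) ∂P := by
  have hA' := past_le hX s _ hA
  obtain ⟨B, hB, hBA⟩ := hA
  have h1 : ∀ ω, A.indicator (fun ω => F (shifted X s ω)) ω
      = B.indicator (1 : (Iic s → ℝ) → ℝ≥0∞) (fun r : Iic s => X r ω) * F (shifted X s ω) := by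
    intro ω
    by_cases hω : ω ∈ A
    · have : (fun r : Iic s => X r ω) ∈ B := by rw [← hBA] at hω; exact hω
      simp [hω, this]
    · have : (fun r : Iic s => X r ω) ∉ B := by rw [← hBA] at hω; exact hω
      simp [hω, this]
  have hpm : Measurable fun ω (r : Iic s) => X r ω :=
    measurable_pi_lambda _ fun r : Iic s => hX.measurable r
  have hi : IndepFun (fun ω => B.indicator (1 : (Iic s → ℝ) → ℝ≥0∞) (fun r : Iic s => X r ω))
      (fun ω => F (shifted X s ω)) P :=
    (hX.indepFun_shifted s).comp (measurable_one.indicator hB) hF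
  have h2 := lintegral_mul_eq_lintegral_mul_lintegral_of_indepFun''
    (f := fun ω => B.indicator (1 : (Iic s → ℝ) → ℝ≥0∞) (fun r : Iic s => X r ω))
    (g := fun ω => F (shifted X s ω)) ((measurable_one.indicator hB).comp hpm).aemeasurable
    (hF.comp (hX.measurable_shifted s)).aemeasurable hi
  rw [← lintegral_indicator hA', lintegral_congr h1, h2]
  congr 1
  · rw [← lintegral_indicator_one hA']
    refine lintegral_congr fun ω => ?_
    by_cases hω : ω ∈ A
    · have : (fun r : Iic s => X r ω) ∈ B := by rw [← hBA] at hω; exact hω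
      simp [hω, this]
    · have : (fun r : Iic s => X r ω) ∉ B := by rw [← hBA] at hω; exact hω
      simp [hω, this]
  · exact ((hX.identDistrib_shifted s).comp hF).lintegral_eq

theorem IsCadlagLevy.lintegral_shifted [IsProbabilityMeasure P] (hX : IsCadlagLevy X P)
    (s : ℝ≥0) {F : (ℝ≥0 → ℝ) → ℝ≥0∞} (hF : Measurable F) :
    ∫⁻ ω, F (shifted X s ω) ∂P = ∫⁻ ω, F (fun t => X t ω) ∂P :=
  ((hX.identDistrib_shifted s).comp hF).lintegral_eq

end DoubleBarrier

end

noncomputable section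

namespace DoubleBarrier

/-! ### Discount factors -/

theorem antitone_discount {q : ℝ} (hq : 0 < q) : Antitone (discount q) := by
  intro S T hST
  unfold discount
  split_ifs with h1 h2 h2
  · exact le_rfl
  · exact (Real.exp_pos _).le
  · exact absurd (top_le_iff.1 (h2 ▸ hST)) h1
  · have := ENNReal.toReal_mono h1 hST
    exact Real.exp_le_exp.2 (by nlinarith)

theorem discount_nonneg (q : ℝ) (T : ℝ≥0∞) : 0 ≤ discount q T := by
  unfold discount
  split_ifs
  · exact le_rfl
  · exact (Real.exp_pos _).le

theorem discount_zero (q : ℝ) : discount q 0 = 1 := by simp [discount]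

theorem discount_le_one {q : ℝ} (hq : 0 < q) (T : ℝ≥0∞) : discount q T ≤ 1 :=
  discount_zero q ▸ antitone_discount hq zero_le

theorem discount_lt_one {q : ℝ} (hq : 0 < q) {T : ℝ≥0∞} (hT : 0 < T) : discount q T < 1 := by
  unfold discount
  split_ifs with h
  · exact one_pos
  · have := ENNReal.toReal_pos hT.ne' h
    exact (Real.exp_lt_exp.2 (by nlinarith)).trans_eq Real.exp_zero

theorem continuous_discount {q : ℝ} (hq : 0 < q) : Continuous (discount q) := by
  refine continuous_iff_continuousAt.2 fun T => ?_
  rcases eq_or_ne T ∞ with rfl | hT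
  · rw [ContinuousAt, discount_top, tendsto_order]
    refine ⟨fun l hl => Eventually.of_forall fun S => hl.trans_le (discount_nonneg q S),
      fun u hu => ?_⟩
    have h1 : Tendsto (fun n : ℕ => Real.exp (-q * (n : ℝ))) atTop (𝓝 0) := by
      refine Real.tendsto_exp_atBot.comp ?_
      exact tendsto_natCast_atTop_atTop.const_mul_atTop_of_neg (by linarith)
    obtain ⟨n, hn⟩ := (h1.eventually_lt_const hu).exists
    filter_upwards [Ioi_mem_nhds (ENNReal.natCast_lt_top n)] with S hS
    refine lt_of_le_of_lt (antitone_discount hq (le_of_lt hS)) ?_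
    simpa [discount] using hn
  · have h1 : ContinuousAt (fun S : ℝ≥0∞ => Real.exp (-q * S.toReal)) T :=
      Real.continuous_exp.continuousAt.comp
        (continuousAt_const.mul (ENNReal.continuousAt_toReal hT))
    refine h1.congr ?_
    filter_upwards [isOpen_ne.mem_nhds hT] with S hS
    simp [discount, show S ≠ ∞ from hS]

theorem continuous_ediscount {q : ℝ} (hq : 0 < q) : Continuous (ediscount q) :=
  ENNReal.continuous_ofReal.comp (continuous_discount hq)

theorem antitone_ediscount {q : ℝ} (hq : 0 < q) : Antitone (ediscount q) :=
  fun _ _ h => ENNReal.ofReal_le_ofReal (antitone_discount hq h)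

theorem ediscount_le_one {q : ℝ} (hq : 0 < q) (T : ℝ≥0∞) : ediscount q T ≤ 1 := by
  simpa [ediscount] using discount_le_one hq T

theorem ediscount_top (q : ℝ) : ediscount q ∞ = 0 := by simp [ediscount, discount_top]

theorem ediscount_add (q : ℝ) (S T : ℝ≥0∞) :
    ediscount q (S + T) = ediscount q S * ediscount q T := by
  rw [ediscount, ediscount, ediscount, ← ENNReal.ofReal_mul (discount_nonneg q S)]
  congr 1
  by_cases hS : S = ∞
  · simp [discount, hS]
  by_cases hT : T = ∞
  · simp [discount, hT]
  simp only [discount, hS, hT, ENNReal.add_eq_top, or_self, if_false, ← Real.exp_add]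
  rw [ENNReal.toReal_add hS hT]
  ring_nf

/-! ### Measurability of drawdown times -/

/-- Drawdowns see only increments after `s`; this splits the discount factor into a constant and a
functional of the shifted process. -/
theorem drawdownTime_coe (w : ℝ≥0 → ℝ) (a : ℝ) (s : ℝ≥0) :
    drawdownTime w a s = s + drawdownTime (fun r => w (s + r) - w s) a 0 := by
  refine le_antisymm ?_ (le_firstTime ?_)
  · by_contra! hlt
    have h1 := lt_tsub_iff_left.2 hlt
    obtain ⟨r, ⟨u, hur, -, h⟩, hr⟩ := firstTime_lt_iff.1 h1
    have h2 : drawdownTime w a s ≤ ((s + r : ℝ≥0) : ℝ≥0∞) :=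
      firstTime_le ⟨s + u, add_le_add_right hur s, by exact_mod_cast le_self_add, by linarith⟩
    have h3 := lt_tsub_iff_left.1 hr
    push_cast at h2
    exact h3.not_ge h2
  · rintro t ⟨u, hut, hsu, h⟩
    have hsu' : s ≤ u := by exact_mod_cast hsu
    have h1 : drawdownTime (fun r => w (s + r) - w s) a 0 ≤ ((t - s : ℝ≥0) : ℝ≥0∞) := by
      refine firstTime_le ⟨u - s, tsub_le_tsub_right hut s, zero_le, ?_⟩
      simp only [add_tsub_cancel_of_le hsu', add_tsub_cancel_of_le (hsu'.trans hut)]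
      linarith
    refine (add_le_add_right h1 _).trans ?_
    rw [← ENNReal.coe_add, add_tsub_cancel_of_le (hsu'.trans hut)]

/-- The drawdown time as observed along the dense sequence of times. -/
def gridDrawdownTime (w : ℝ≥0 → ℝ) (a : ℝ) : ℝ≥0∞ :=
  firstTime {t | ∃ m n, 0 < grid m ∧ grid m ≤ grid n ∧ t = grid n ∧ a < w (grid m) - w (grid n)}

theorem gridDrawdownTime_lt_iff {w : ℝ≥0 → ℝ} {a : ℝ} {τ : ℝ≥0∞} :
    gridDrawdownTime w a < τ ↔ ∃ m n, 0 < grid m ∧ grid m ≤ grid n ∧ (grid n : ℝ≥0∞) < τ ∧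
      a < w (grid m) - w (grid n) := by
  rw [gridDrawdownTime, firstTime_lt_iff]
  constructor
  · rintro ⟨_, ⟨m, n, h1, h2, rfl, h3⟩, h4⟩
    exact ⟨m, n, h1, h2, h4, h3⟩
  · rintro ⟨m, n, h1, h2, h3, h4⟩
    exact ⟨_, ⟨m, n, h1, h2, rfl, h4⟩, h3⟩

theorem IsCadlag.gridDrawdownTime_eq {w : ℝ≥0 → ℝ} (hw : IsCadlag w) {a : ℝ} (ha : 0 < a) :
    gridDrawdownTime w a = drawdownTime w a 0 := by
  refine eq_of_forall_gt_iff fun τ => ?_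
  rw [gridDrawdownTime_lt_iff, hw.drawdownTime_lt_iff ha]
  simp

/-- The Markov property needs a functional measurable on all functions, hence depending on countably
many coordinates; on càdlàg paths it equals the drawdown time. The factor `c` is later `1` or `-1`.
-/
theorem measurable_gridDrawdownTime (a c : ℝ) :
    Measurable fun w : ℝ≥0 → ℝ => gridDrawdownTime (fun t => c * w t) a := by
  refine measurable_of_Iio fun τ => ?_
  have : (fun w : ℝ≥0 → ℝ => gridDrawdownTime (fun t => c * w t) a) ⁻¹' Iio τ
      = ⋃ m, ⋃ n, ⋃ (_ : 0 < grid m ∧ grid m ≤ grid n ∧ (grid n : ℝ≥0∞) < τ),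
        {w : ℝ≥0 → ℝ | a < c * w (grid m) - c * w (grid n)} := by
    ext w
    simp only [mem_preimage, mem_Iio, gridDrawdownTime_lt_iff, mem_iUnion, mem_ofPred_eq,
      exists_prop, and_assoc]
  rw [this]
  refine MeasurableSet.iUnion fun m => MeasurableSet.iUnion fun n => MeasurableSet.iUnion
    fun _ => measurableSet_lt measurable_const ?_
  fun_prop

theorem IsCadlag.const_mul {w : ℝ≥0 → ℝ} (hw : IsCadlag w) (c : ℝ) :
    IsCadlag (fun t => c * w t) where
  right t := continuousWithinAt_const.mul (hw.right t)
  left t := by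
    obtain ⟨l, hl⟩ := hw.left t
    exact ⟨c * l, hl.const_mul c⟩

theorem IsCadlag.shift {w : ℝ≥0 → ℝ} (hw : IsCadlag w) (s : ℝ≥0) :
    IsCadlag (fun r => w (s + r) - w s) where
  right t := by
    refine ContinuousWithinAt.sub ?_ continuousWithinAt_const
    refine (hw.right (s + t)).comp (continuous_const_add s).continuousWithinAt ?_
    intro r hr
    exact add_le_add_right (show t ≤ r from hr) s
  left t := by
    obtain ⟨l, hl⟩ := hw.left (s + t)
    refine ⟨l - w s, Tendsto.sub_const (hl.comp ?_) _⟩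
    refine tendsto_nhdsWithin_iff.2 ⟨((continuous_const_add s).tendsto t).mono_left
      nhdsWithin_le_nhds, ?_⟩
    filter_upwards [self_mem_nhdsWithin] with r hr
    exact (add_lt_add_iff_left s).2 hr

theorem IsCadlag.tendsto_drawdownTime {w : ℝ≥0 → ℝ} (hw : IsCadlag w) {a : ℝ} (ha : 0 < a)
    (s : ℝ≥0∞) :
    Tendsto (drawdownTime w a) (𝓝[>] s) (𝓝 (drawdownTime w a s)) := by
  rw [tendsto_order]
  constructor
  · intro l hl
    filter_upwards [self_mem_nhdsWithin] with s' hs'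
    exact hl.trans_le (drawdownTime_mono le_rfl (le_of_lt hs'))
  · intro u hu
    obtain ⟨s', hs', b, hb, h⟩ := hw.exists_drawdownTime_lt ha hu
    filter_upwards [Ioo_mem_nhdsGT hs'] with s'' hs''
    exact (drawdownTime_mono hb.le hs''.2.le).trans_lt h

theorem IsCadlag.tendsto_drawdownTime_level {w : ℝ≥0 → ℝ} (hw : IsCadlag w) {a : ℝ} (ha : 0 < a)
    (s : ℝ≥0∞) :
    Tendsto (fun b => drawdownTime w b s) (𝓝[>] a) (𝓝 (drawdownTime w a s)) := by
  rw [tendsto_order]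
  constructor
  · intro l hl
    filter_upwards [self_mem_nhdsWithin] with b hb
    exact hl.trans_le (drawdownTime_mono (le_of_lt hb) le_rfl)
  · intro u hu
    obtain ⟨s', hs', b, hb, h⟩ := hw.exists_drawdownTime_lt ha hu
    filter_upwards [Ioo_mem_nhdsGT hb] with b' hb'
    exact (drawdownTime_mono hb'.2.le hs'.le).trans_lt h

theorem tendsto_firstUpTime_level (w : ℝ≥0 → ℝ) (a : ℝ) :
    Tendsto (fun b => firstUpTime w b) (𝓝[>] a) (𝓝 (firstUpTime w a)) := by
  rw [tendsto_order]
  constructor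
  · intro l hl
    filter_upwards [self_mem_nhdsWithin] with b hb
    exact hl.trans_le (firstUpTime_mono (le_of_lt hb))
  · intro u hu
    obtain ⟨b, hb, h⟩ := exists_firstUpTime_lt hu
    filter_upwards [Ioo_mem_nhdsGT hb] with b' hb'
    exact (firstUpTime_mono hb'.2.le).trans_lt h

/-! ### Optional times and the strong Markov property -/

variable {Ω : Type*} [MeasurableSpace Ω] {X : ℝ≥0 → Ω → ℝ} {P : Measure Ω} {a c q : ℝ}
  {T : Ω → ℝ≥0∞}

/-- A random time such that whether it has occurred strictly before `τ` is known at time `τ`. -/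
def IsOptionalTime {Ω : Type*} (X : ℝ≥0 → Ω → ℝ) (T : Ω → ℝ≥0∞) : Prop :=
  ∀ τ : ℝ≥0, MeasurableSet[past X τ] {ω | T ω < τ}

theorem IsOptionalTime.measurable (hX : IsCadlagLevy X P) (hT : IsOptionalTime X T) :
    Measurable T := by
  refine measurable_of_Iio fun τ => ?_
  have : T ⁻¹' Iio τ = ⋃ n, {ω | T ω < grid n ∧ (grid n : ℝ≥0∞) ≤ τ} := by
    ext ω
    simp only [mem_preimage, mem_Iio, mem_iUnion, mem_ofPred_eq]
    constructor
    · intro h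
      obtain ⟨u, hu1, hu2⟩ := ENNReal.lt_iff_exists_nnreal_btwn.1 h
      obtain ⟨v, hv1, hv2⟩ := ENNReal.lt_iff_exists_nnreal_btwn.1 hu2
      obtain ⟨n, hn1, hn2, -⟩ := exists_grid_of_eventually (p := fun _ => True)
        (by simp) (by exact_mod_cast hv1 : u < v)
      exact ⟨n, hu1.trans (by exact_mod_cast hn1), (lt_trans (by exact_mod_cast hn2) hv2).le⟩
    · rintro ⟨n, h1, h2⟩
      exact h1.trans_le h2
  rw [this]
  exact MeasurableSet.iUnion fun n => (past_le hX _ _ (hT _)).inter (MeasurableSet.const _)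

/-- In the grid description `T` enters only through `T < grid m`, an event already known at time
`grid m`. -/
theorem IsOptionalTime.drawdownTime (hX : IsCadlagLevy X P) (hT : IsOptionalTime X T)
    (ha : 0 < a) (c : ℝ) :
    IsOptionalTime X fun ω => drawdownTime (fun t => c * X t ω) a (T ω) := by
  intro τ
  have : {ω | DoubleBarrier.drawdownTime (fun t => c * X t ω) a (T ω) < τ}
      = ⋃ m, ⋃ n, ⋃ (_ : grid m ≤ grid n ∧ grid n < τ),
        {ω | T ω < grid m} ∩ {ω | a < c * X (grid m) ω - c * X (grid n) ω} := by
    ext ω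
    simp only [mem_ofPred_eq, ((hX.cadlag ω).const_mul c).drawdownTime_lt_iff ha, mem_iUnion,
      mem_inter_iff, exists_prop, ENNReal.coe_lt_coe]
    constructor
    · rintro ⟨m, n, h1, h2, h3, h4⟩
      exact ⟨m, n, ⟨h2, h3⟩, h1, h4⟩
    · rintro ⟨m, n, ⟨h2, h3⟩, h1, h4⟩
      exact ⟨m, n, h1, h2, h3, h4⟩
  rw [this]
  refine MeasurableSet.iUnion fun m => MeasurableSet.iUnion fun n => MeasurableSet.iUnion
    fun h => ?_
  refine MeasurableSet.inter (past_mono (h.1.trans h.2.le) _ (hT (grid m))) ?_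
  refine measurableSet_lt measurable_const (Measurable.sub ?_ ?_)
  · exact (measurable_past (h.1.trans h.2.le)).const_mul c
  · exact (measurable_past h.2.le).const_mul c

theorem isOptionalTime_firstUpTime (hX : IsCadlagLevy X P) (ha : 0 < a) (x : ℝ) :
    IsOptionalTime X fun ω => firstUpTime (path X x ω) a := by
  intro τ
  have : {ω | firstUpTime (path X x ω) a < τ}
      = (⋃ n, ⋃ (_ : grid n < τ), {ω | a < x + X (grid n) ω}) ∪
        ⋃ m, ⋃ n, ⋃ (_ : grid m ≤ grid n ∧ grid n < τ),
        {ω | a < (x + X (grid n) ω) - (x + X (grid m) ω)} := by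
    ext ω
    have hw : IsCadlag (path X x ω) := (hX.cadlag ω).const_add x
    simp only [mem_ofPred_eq, hw.firstUpTime_lt_iff ha, mem_iUnion, mem_union, exists_prop,
      ENNReal.coe_lt_coe, path, and_assoc]
  rw [this]
  refine MeasurableSet.union (MeasurableSet.iUnion fun n => MeasurableSet.iUnion fun h => ?_)
    (MeasurableSet.iUnion fun m => MeasurableSet.iUnion fun n => MeasurableSet.iUnion fun h => ?_)
  · exact measurableSet_lt measurable_const ((measurable_past h.le).const_add x)
  · exact measurableSet_lt measurable_const (((measurable_past h.2.le).const_add x).sub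
      ((measurable_past (h.1.trans h.2.le)).const_add x))

/-- `𝔼[e^{-qD}]`, where `D` is the drawdown time of `c * X`. -/
def drawdownValue (X : ℝ≥0 → Ω → ℝ) (P : Measure Ω) (q c a : ℝ) : ℝ≥0∞ :=
  ∫⁻ ω, ediscount q (drawdownTime (fun t => c * X t ω) a 0) ∂P

theorem setLIntegral_ediscount_drawdownTime [IsProbabilityMeasure P] (hX : IsCadlagLevy X P)
    (hq : 0 < q) (ha : 0 < a) {s : ℝ≥0} {A : Set Ω} (hA : MeasurableSet[past X s] A) :
    ∫⁻ ω in A, ediscount q (drawdownTime (fun t => c * X t ω) a s) ∂P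
      = drawdownValue X P q c a * ∫⁻ _ in A, ediscount q s ∂P := by
  have hF : Measurable fun w : ℝ≥0 → ℝ => ediscount q (gridDrawdownTime (fun t => c * w t) a) :=
    (continuous_ediscount hq).measurable.comp (measurable_gridDrawdownTime a c)
  have h1 : ∀ ω, ediscount q (drawdownTime (fun t => c * X t ω) a s)
      = ediscount q s * ediscount q (gridDrawdownTime (fun t => c * shifted X s ω t) a) := by
    intro ω
    have hw : IsCadlag (fun t => c * shifted X s ω t) := ((hX.cadlag ω).shift s).const_mul c
    rw [drawdownTime_coe, ediscount_add, hw.gridDrawdownTime_eq ha]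
    simp only [shifted, mul_sub]
  have h2 := hX.setLIntegral_shifted hA hF
  have h3 : ∫⁻ ω, ediscount q (gridDrawdownTime (fun t => c * X t ω) a) ∂P
      = drawdownValue X P q c a :=
    lintegral_congr fun ω => by rw [((hX.cadlag ω).const_mul c).gridDrawdownTime_eq ha]
  have h4 : Measurable fun ω => ediscount q (gridDrawdownTime (fun t => c * shifted X s ω t) a) :=
    hF.comp (hX.measurable_shifted s)
  simp only [h1]
  rw [lintegral_const_mul _ h4, h2, h3, setLIntegral_const]
  ring

theorem tendsto_floor_div (t : ℝ≥0) :
    Tendsto (fun N : ℕ => (((⌊t * (N + 1)⌋₊ + 1) / (N + 1) : ℝ≥0) : ℝ≥0∞)) atTop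
      (𝓝[>] (t : ℝ≥0∞)) := by
  have hlt : ∀ N : ℕ, t < (⌊t * (N + 1)⌋₊ + 1) / (N + 1) := fun N => by
    rw [lt_div_iff₀ (by positivity)]
    exact Nat.lt_floor_add_one _
  refine tendsto_nhdsWithin_iff.2 ⟨?_, Eventually.of_forall fun N => by
    simpa only [mem_Ioi, ENNReal.coe_lt_coe] using hlt N⟩
  refine ENNReal.tendsto_coe.2 ?_
  have h1 : Tendsto (fun N : ℕ => t + 1 / ((N : ℝ≥0) + 1)) atTop (𝓝 (t + 0)) :=
    tendsto_const_nhds.add tendsto_one_div_add_atTop_nhds_zero_nat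
  rw [add_zero] at h1
  refine tendsto_of_tendsto_of_tendsto_of_le_of_le tendsto_const_nhds h1
    (fun N => (hlt N).le) fun N => ?_
  have h2 : (⌊t * (N + 1)⌋₊ : ℝ≥0) ≤ t * (N + 1) := Nat.floor_le zero_le
  have h3 : (0 : ℝ≥0) < N + 1 := by positivity
  simp only
  rw [div_le_iff₀ h3, add_mul, one_div, inv_mul_cancel₀ h3.ne']
  gcongr

/-- The event that the time `T` falls into the `j`-th cell of mesh `1 / (N + 1)`. -/
def cell {Ω : Type*} (T : Ω → ℝ≥0∞) (N j : ℕ) : Set Ω :=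
  {ω | T ω < ((j + 1) / (N + 1) : ℝ≥0)} \ {ω | T ω < (j / (N + 1) : ℝ≥0)}

theorem IsOptionalTime.measurableSet_cell {Ω : Type*} {X : ℝ≥0 → Ω → ℝ}
    {T : Ω → ℝ≥0∞} (hT : IsOptionalTime X T) (N j : ℕ) :
    MeasurableSet[past X ((j + 1) / (N + 1))] (cell T N j) :=
  MeasurableSet.diff (hT _) (past_mono (by gcongr; exact le_self_add) _ (hT _))

theorem mem_cell_iff {Ω : Type*} {T : Ω → ℝ≥0∞} {t : ℝ≥0} {ω : Ω} (hT : T ω = t) (N j : ℕ) :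
    ω ∈ cell T N j ↔ j = ⌊t * (N + 1)⌋₊ := by
  have h3 : (0 : ℝ≥0) < N + 1 := by positivity
  simp only [cell, Set.mem_sdiff, mem_ofPred_eq, hT, ENNReal.coe_lt_coe, not_lt]
  rw [lt_div_iff₀ h3, div_le_iff₀ h3, eq_comm, Nat.floor_eq_iff zero_le, and_comm]

/-- On each cell `T` is replaced by the right end point, where the cell is already observed. These
points decrease strictly to `T` as the mesh refines, so right continuity and domination by `1`
apply. Paths with `T = ∞` lie in no cell, which matches `g ∞ = 0`. -/
theorem tendsto_lintegral_cell [IsProbabilityMeasure P] (hX : IsCadlagLevy X P)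
    (hT : IsOptionalTime X T) {g : ℝ≥0∞ → Ω → ℝ≥0∞} (hg : ∀ s : ℝ≥0, Measurable (g s))
    (hg1 : ∀ s ω, g s ω ≤ 1) (hgtop : ∀ ω, g ∞ ω = 0)
    (hgr : ∀ ω s, Tendsto (fun s => g s ω) (𝓝[>] s) (𝓝 (g s ω))) :
    Tendsto (fun N : ℕ => ∑' j : ℕ, ∫⁻ ω in cell T N j, g ((j + 1) / (N + 1) : ℝ≥0) ω ∂P) atTop
      (𝓝 (∫⁻ ω, g (T ω) ω ∂P)) := by
  have hcell : ∀ N j, MeasurableSet (cell T N j) := fun N j =>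
    past_le hX _ _ (hT.measurableSet_cell N j)
  have hmeas : ∀ N j : ℕ, Measurable
      ((cell T N j).indicator (g ((j + 1) / (N + 1) : ℝ≥0))) := fun N j =>
    (hg _).indicator (hcell N j)
  have h1 : ∀ N : ℕ, ∑' j : ℕ, ∫⁻ ω in cell T N j, g ((j + 1) / (N + 1) : ℝ≥0) ω ∂P
      = ∫⁻ ω, ∑' j : ℕ, (cell T N j).indicator (g ((j + 1) / (N + 1) : ℝ≥0)) ω ∂P := by
    intro N
    rw [lintegral_tsum fun j => (hmeas N j).aemeasurable]
    exact tsum_congr fun j => (lintegral_indicator (hcell N j) _).symm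
  have h2 : ∀ (N : ℕ) ω (t : ℝ≥0), T ω = t →
      ∑' j : ℕ, (cell T N j).indicator (g ((j + 1) / (N + 1) : ℝ≥0)) ω
        = g ((⌊t * (N + 1)⌋₊ + 1) / (N + 1) : ℝ≥0) ω := by
    intro N ω t ht
    rw [tsum_eq_single ⌊t * (N + 1)⌋₊]
    · rw [indicator_of_mem ((mem_cell_iff ht N _).2 rfl)]
    · intro j hj
      rw [indicator_of_notMem fun h => hj ((mem_cell_iff ht N _).1 h)]
  have h3 : ∀ (N : ℕ) ω, T ω = ∞ →
      ∑' j : ℕ, (cell T N j).indicator (g ((j + 1) / (N + 1) : ℝ≥0)) ω = 0 := by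
    intro N ω ht
    refine ENNReal.tsum_eq_zero.2 fun j => indicator_of_notMem (fun h => ?_) _
    have := h.1
    simp only [mem_ofPred_eq, ht] at this
    exact not_top_lt this
  simp only [h1]
  refine tendsto_lintegral_of_dominated_convergence (fun _ => 1)
    (fun N => Measurable.tsum fun j => hmeas N j) (fun N => ae_of_all _ fun ω => ?_) (by simp)
    (ae_of_all _ fun ω => ?_)
  · by_cases ht : T ω = ∞
    · simp only [h3 N ω ht, zero_le]
    · simp only [h2 N ω _ (ENNReal.coe_toNNReal ht).symm]
      exact hg1 _ _
  · by_cases ht : T ω = ∞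
    · simp only [h3 _ ω ht, ht, hgtop]
      exact tendsto_const_nhds
    · have ht' := (ENNReal.coe_toNNReal ht).symm
      simp only [h2 _ ω _ ht']
      rw [ht']
      exact (hgr ω _).comp (tendsto_floor_div _)

/-- The strong Markov property, for the discounted drawdown time. -/
theorem lintegral_ediscount_drawdownTime [IsProbabilityMeasure P] (hX : IsCadlagLevy X P)
    (hq : 0 < q) (ha : 0 < a) (hT : IsOptionalTime X T) :
    ∫⁻ ω, ediscount q (drawdownTime (fun t => c * X t ω) a (T ω)) ∂P
      = drawdownValue X P q c a * ∫⁻ ω, ediscount q (T ω) ∂P := by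
  have hw : ∀ ω, IsCadlag fun t => c * X t ω := fun ω => (hX.cadlag ω).const_mul c
  have h1 := tendsto_lintegral_cell hX hT
    (g := fun s ω => ediscount q (drawdownTime (fun t => c * X t ω) a s)) (fun s => ?_)
    (fun s ω => ediscount_le_one hq _) (fun ω => ?_) (fun ω s => ?_)
  · have h2 := tendsto_lintegral_cell hX hT (g := fun s _ => ediscount q s)
      (fun s => measurable_const) (fun s ω => ediscount_le_one hq _) (fun ω => ediscount_top q)
      (fun ω s => ((continuous_ediscount hq).tendsto s).mono_left nhdsWithin_le_nhds)
    have hne : drawdownValue X P q c a ≠ ∞ := by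
      refine ((lintegral_mono fun ω => ediscount_le_one hq _).trans_lt ?_).ne
      simp
    have h3 := ENNReal.Tendsto.const_mul h2 (Or.inr hne)
    -- Both sides are discretised alike and agree cell by cell, by the Markov property at a fixed
    -- time.
    refine tendsto_nhds_unique h1 (h3.congr fun N => ?_)
    rw [← ENNReal.tsum_mul_left]
    exact tsum_congr fun j =>
      (setLIntegral_ediscount_drawdownTime hX hq ha (hT.measurableSet_cell N j)).symm
  · have hs : IsOptionalTime X fun _ => (s : ℝ≥0∞) := fun _ => MeasurableSet.const _
    exact (continuous_ediscount hq).measurable.comp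
      ((hs.drawdownTime hX ha c).measurable hX)
  · have : drawdownTime (fun t => c * X t ω) a ∞ = ∞ := top_le_iff.1 le_drawdownTime
    simp only [this, ediscount_top]
  · exact ((continuous_ediscount hq).tendsto _).comp ((hw ω).tendsto_drawdownTime ha s)

end DoubleBarrier

end

noncomputable section

namespace DoubleBarrier

/-! ### The running supremum of a Lévy process is integrable -/

/-- The maximum of the path along the points of mesh `1 / (N + 1)` of the unit interval. -/
def meshMax (w : ℝ≥0 → ℝ) (N : ℕ) : ℝ :=
  (Finset.range (N + 1 + 1)).sup' Finset.nonempty_range_add_one fun k => |w (k / (N + 1))|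

/-- A measurable upper bound of a càdlàg path on the unit interval. -/
def unitSup (w : ℝ≥0 → ℝ) : ℝ≥0∞ := liminf (fun N => ENNReal.ofReal (meshMax w N)) atTop

theorem measurable_meshMax (N : ℕ) : Measurable fun w => meshMax w N :=
  Finset.measurable_range_sup'' fun _ _ => (measurable_pi_apply _).abs

theorem measurable_unitSup : Measurable unitSup :=
  Measurable.liminf fun N => (measurable_meshMax N).ennreal_ofReal

theorem le_meshMax (w : ℝ≥0 → ℝ) {N k : ℕ} (hk : k ≤ N + 1) : |w (k / (N + 1))| ≤ meshMax w N :=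
  Finset.le_sup' (fun k : ℕ => |w (k / (N + 1))|) (Finset.mem_range.2 (by omega))

/-- Right continuity recovers `w u` from the mesh points just after `u`, and `1` is itself a mesh
point. The `liminf` is the form to which Fatou's lemma applies. -/
theorem IsCadlag.le_unitSup {w : ℝ≥0 → ℝ} (hw : IsCadlag w) {u : ℝ≥0} (hu : u ≤ 1) :
    ENNReal.ofReal |w u| ≤ unitSup w := by
  rcases hu.lt_or_eq with hu | rfl
  · have hv := tendsto_floor_div u
    set v : ℕ → ℝ≥0 := fun N => (⌊u * (N + 1)⌋₊ + 1) / (N + 1) with hvdef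
    have hv' : Tendsto v atTop (𝓝[≥] u) := by
      obtain ⟨h1, h2⟩ := tendsto_nhdsWithin_iff.1 hv
      refine tendsto_nhdsWithin_iff.2 ⟨ENNReal.tendsto_coe.1 h1, h2.mono fun N hN => ?_⟩
      have : u < v N := by exact_mod_cast (show (u : ℝ≥0∞) < v N from hN)
      exact this.le
    have h1 : Tendsto (fun N => ENNReal.ofReal |w (v N)|) atTop (𝓝 (ENNReal.ofReal |w u|)) :=
      (ENNReal.continuous_ofReal.tendsto _).comp (((hw.right u).abs).tendsto.comp hv')
    rw [← h1.liminf_eq]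
    refine liminf_le_liminf ?_
    have h2 : ∀ᶠ N in atTop, v N < 1 :=
      (hv'.mono_right nhdsWithin_le_nhds).eventually_lt_const hu
    filter_upwards [h2] with N hN
    refine ENNReal.ofReal_le_ofReal ?_
    have h3 : (0 : ℝ≥0) < N + 1 := by positivity
    rw [hvdef, div_lt_one h3] at hN
    have h4 : ⌊u * (N + 1)⌋₊ + 1 < N + 1 := by exact_mod_cast hN
    have := le_meshMax w h4.le
    rw [hvdef]
    simpa using this
  · refine le_liminf_of_le (by isBoundedDefault) (Eventually.of_forall fun N => ?_)
    refine ENNReal.ofReal_le_ofReal ?_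
    have := le_meshMax w (le_refl (N + 1))
    rwa [Nat.cast_add, Nat.cast_one, div_self (by positivity)] at this

variable {Ω : Type*} [MeasurableSpace Ω] {X : ℝ≥0 → Ω → ℝ} {P : Measure Ω} {a q x : ℝ}

/-- Supplies the hypothesis of Ottaviani's inequality. Paths are bounded on `[0, 2]`, so a large
level works with probability above `1/2`; going up to `2` leaves room for grid times to the right of
`r = 1`. -/
theorem IsCadlagLevy.exists_half_le [IsProbabilityMeasure P] (hX : IsCadlagLevy X P) :
    ∃ β : ℝ, 0 ≤ β ∧ ∀ r ≤ 1, 1 / 2 ≤ P {ω | |X r ω| ≤ β} := by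
  set G : ℕ → Set Ω := fun n => {ω | ∀ m, grid m ≤ 2 → |X (grid m) ω| ≤ n} with hG
  have hmono : Monotone G := fun m n hmn ω hω k hk =>
    (hω k hk).trans (Nat.cast_le.2 hmn)
  have huniv : ⋃ n, G n = univ := by
    refine eq_univ_of_forall fun ω => ?_
    obtain ⟨C, hC⟩ := (hX.cadlag ω).exists_bound 2
    obtain ⟨n, hn⟩ := exists_nat_ge C
    exact mem_iUnion.2 ⟨n, fun m hm => (hC _ hm).trans hn⟩
  have ht := tendsto_measure_iUnion_atTop (μ := P) hmono
  rw [huniv, measure_univ] at ht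
  obtain ⟨n, hn⟩ := (ht.eventually_const_lt (u := 1 / 2) (by norm_num)).exists
  refine ⟨n, Nat.cast_nonneg n, fun r hr => hn.le.trans (measure_mono fun ω hω => ?_)⟩
  by_contra hlt
  simp only [mem_ofPred_eq, not_le] at hlt
  have h1 : ∀ᶠ v in 𝓝[≥] r, (n : ℝ) < |X v ω| :=
    (((hX.cadlag ω).right r).abs).eventually_const_lt hlt
  obtain ⟨m, hm1, hm2, hm3⟩ := exists_grid_of_eventually h1
    (lt_of_le_of_lt hr one_lt_two : r < 2)
  exact hm3.not_ge (hω m hm2.le)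

/-- Ottaviani's inequality along the points of mesh `1 / (N + 1)`. -/
theorem IsCadlagLevy.measure_lt_meshMax_le [IsProbabilityMeasure P] (hX : IsCadlagLevy X P)
    {β : ℝ} (hβ : ∀ r ≤ 1, 1 / 2 ≤ P {ω | |X r ω| ≤ β}) (α : ℝ) (N : ℕ) :
    P {ω | α + β < meshMax (fun t => X t ω) N} ≤ 2 * P {ω | α < |X 1 ω|} := by
  set t : ℕ → ℝ≥0 := fun k => k / (N + 1) with ht
  have h0 : (0 : ℝ≥0) < N + 1 := by positivity
  have htm : Monotone t := fun i j hij => by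
    simp only [ht]
    gcongr
  have ht1 : ∀ k ∈ Finset.range (N + 1 + 1), t k ≤ 1 := fun k hk => by
    have : k ≤ N + 1 := by
      have := Finset.mem_range.1 hk
      omega
    simp only [ht]
    rw [div_le_one h0]
    exact_mod_cast this
  -- `A k`: the mesh path first exceeds `α + β` at step `k`. `B k`: the increment from there to time
  -- `1` is at most `β`. On both, `|X 1| > α`.
  set A : ℕ → Set Ω := fun k => {ω | α + β < |X (t k) ω|} ∩
    ⋂ j, ⋂ (_ : j < k), {ω | |X (t j) ω| ≤ α + β} with hA
  set B : ℕ → Set Ω := fun k => {ω | |shifted X (t k) ω (1 - t k)| ≤ β} with hB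
  have hAm : ∀ k, MeasurableSet[past X (t k)] (A k) := fun k => by
    refine MeasurableSet.inter (measurableSet_lt measurable_const
      (continuous_abs.measurable.comp (measurable_past le_rfl))) (MeasurableSet.iInter fun j => MeasurableSet.iInter fun hj => ?_)
    exact measurableSet_le (continuous_abs.measurable.comp (measurable_past (htm hj.le)))
      measurable_const
  have hAm' : ∀ k, MeasurableSet (A k) := fun k => past_le hX _ _ (hAm k)
  have hBm : ∀ k, MeasurableSet (B k) := fun k =>
    measurableSet_le ((measurable_pi_apply _).comp (hX.measurable_shifted (t k))).abs
      measurable_const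
  have hdisj : Pairwise (Function.onFun Disjoint A) := by
    have : ∀ i j, i < j → Disjoint (A i) (A j) := fun i j hij => by
      refine disjoint_left.2 fun ω hi hj => ?_
      have h1 : α + β < |X (t i) ω| := hi.1
      have h2 := hj.2
      simp only [mem_iInter] at h2
      have h3 : |X (t i) ω| ≤ α + β := h2 i hij
      linarith
    intro i j hij
    rcases lt_or_gt_of_ne hij with h | h
    · exact this i j h
    · exact (this j i h).symm
  -- `A k` belongs to the past of `t k` and `B k` concerns the later increment, so they are
  -- independent, and `B k` has probability at least `1/2`.
  have hAB : ∀ k ∈ Finset.range (N + 1 + 1), P (A k) ≤ 2 * P (A k ∩ B k) := by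
    intro k hk
    have hS : MeasurableSet {w : ℝ≥0 → ℝ | |w (1 - t k)| ≤ β} :=
      measurableSet_le (measurable_pi_apply _).abs measurable_const
    have h1 := hX.setLIntegral_shifted (hAm k)
      (F := {w : ℝ≥0 → ℝ | |w (1 - t k)| ≤ β}.indicator 1) (measurable_one.indicator hS)
    have h2 : ∫⁻ ω in A k, {w : ℝ≥0 → ℝ | |w (1 - t k)| ≤ β}.indicator 1 (shifted X (t k) ω) ∂P
        = P (A k ∩ B k) := by
      have : (fun ω => {w : ℝ≥0 → ℝ | |w (1 - t k)| ≤ β}.indicator (1 : (ℝ≥0 → ℝ) → ℝ≥0∞)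
          (shifted X (t k) ω)) = (B k).indicator 1 := by
        ext ω
        simp [indicator, hB]
      rw [this, lintegral_indicator_one (hBm k), Measure.restrict_apply (hBm k), inter_comm]
    have h3 : ∫⁻ ω, {w : ℝ≥0 → ℝ | |w (1 - t k)| ≤ β}.indicator 1 (fun t => X t ω) ∂P
        = P {ω | |X (1 - t k) ω| ≤ β} := by
      have : (fun ω => {w : ℝ≥0 → ℝ | |w (1 - t k)| ≤ β}.indicator (1 : (ℝ≥0 → ℝ) → ℝ≥0∞)
          (fun t => X t ω)) = {ω | |X (1 - t k) ω| ≤ β}.indicator 1 := by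
        ext ω
        simp [indicator]
      rw [this, lintegral_indicator_one
        (measurableSet_le (hX.measurable _).abs measurable_const)]
    rw [h2, h3] at h1
    rw [h1]
    calc P (A k) = 2 * (P (A k) * (1 / 2)) := by
          rw [mul_comm (P (A k)), ← mul_assoc, one_div, ENNReal.mul_inv_cancel (by simp) (by simp),
            one_mul]
      _ ≤ _ := by
          gcongr
          exact hβ _ tsub_le_self
  have hsub : {ω | α + β < meshMax (fun t => X t ω) N}
      ⊆ ⋃ k ∈ Finset.range (N + 1 + 1), A k := by
    intro ω hω
    simp only [mem_ofPred_eq, meshMax, Finset.lt_sup'_iff] at hω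
    classical
    have hex : ∃ k, α + β < |X (t k) ω| := by
      obtain ⟨k, -, hk⟩ := hω
      exact ⟨k, hk⟩
    obtain ⟨k, hk, hk'⟩ := hω
    simp only [mem_iUnion, exists_prop]
    refine ⟨Nat.find hex, Finset.mem_range.2
      ((Nat.find_min' hex hk').trans_lt (Finset.mem_range.1 hk)), Nat.find_spec hex, ?_⟩
    simp only [mem_iInter]
    exact fun j hj => not_lt.1 (Nat.find_min hex hj)
  calc P {ω | α + β < meshMax (fun t => X t ω) N}
      ≤ ∑ k ∈ Finset.range (N + 1 + 1), P (A k) :=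
        (measure_mono hsub).trans (measure_biUnion_finset_le _ _)
    _ ≤ ∑ k ∈ Finset.range (N + 1 + 1), 2 * P (A k ∩ B k) := Finset.sum_le_sum hAB
    _ = 2 * P (⋃ k ∈ Finset.range (N + 1 + 1), A k ∩ B k) := by
        rw [← Finset.mul_sum, measure_biUnion_finset]
        · intro i _ j _ hij
          exact (hdisj hij).mono inter_subset_left inter_subset_left
        · exact fun k _ => (hAm' k).inter (hBm k)
    _ ≤ 2 * P {ω | α < |X 1 ω|} := by
        gcongr
        refine iUnion₂_subset fun k hk ω hω => ?_
        have h1 : α + β < |X (t k) ω| := hω.1.1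
        have h2 : |X (t k + (1 - t k)) ω - X (t k) ω| ≤ β := hω.2
        rw [add_tsub_cancel_of_le (ht1 k hk)] at h2
        have h3 := abs_sub_abs_le_abs_sub (X (t k) ω) (X 1 ω)
        rw [abs_sub_comm] at h3
        simp only [mem_ofPred_eq]
        linarith

/-- Integrating Ottaviani's inequality over `α` bounds the mean of the positive part of `meshMax -
β` by twice the mean of `|X 1|`, uniformly in the mesh; Fatou's lemma passes to the limit. -/
theorem IsCadlagLevy.lintegral_unitSup_lt_top [IsProbabilityMeasure P] (hX : IsCadlagLevy X P)
    (hX1 : Integrable (X 1) P) : ∫⁻ ω, unitSup (fun t => X t ω) ∂P < ∞ := by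
  obtain ⟨β, hβ0, hβ⟩ := hX.exists_half_le
  have hm : ∀ N, Measurable fun ω => meshMax (fun t => X t ω) N := fun N =>
    (measurable_meshMax N).comp hX.measurable_path
  have hbound : ∀ N, ∫⁻ ω, ENNReal.ofReal (meshMax (fun t => X t ω) N) ∂P
      ≤ ENNReal.ofReal β + 2 * ∫⁻ ω, ENNReal.ofReal |X 1 ω| ∂P := by
    intro N
    have h1 : ∀ ω, ENNReal.ofReal (meshMax (fun t => X t ω) N) ≤ ENNReal.ofReal β
        + ENNReal.ofReal (max (meshMax (fun t => X t ω) N - β) 0) := fun ω => by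
      rw [← ENNReal.ofReal_add hβ0 (le_max_right _ _)]
      exact ENNReal.ofReal_le_ofReal (by
        linarith [le_max_left (meshMax (fun t => X t ω) N - β) 0])
    refine (lintegral_mono h1).trans ?_
    rw [lintegral_add_left measurable_const, lintegral_const, measure_univ, mul_one]
    gcongr
    rw [lintegral_eq_lintegral_meas_lt P
        (f := fun ω => max (meshMax (fun t => X t ω) N - β) 0)
        (ae_of_all _ fun ω => le_max_right _ _) (((hm N).sub_const β).max measurable_const).aemeasurable,
      lintegral_eq_lintegral_meas_lt P (ae_of_all _ fun ω => abs_nonneg _)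
        (hX.measurable 1).abs.aemeasurable,
      ← lintegral_const_mul' _ _ (by simp)]
    refine setLIntegral_mono' measurableSet_Ioi fun α hα => ?_
    refine le_trans (measure_mono fun ω hω => ?_) (hX.measure_lt_meshMax_le hβ α N)
    simp only [mem_ofPred_eq, lt_max_iff] at hω ⊢
    rcases hω with hω | hω
    · linarith
    · exact absurd hω (not_lt.2 (le_of_lt hα))
  have hfin : ENNReal.ofReal β + 2 * ∫⁻ ω, ENNReal.ofReal |X 1 ω| ∂P < ∞ := by
    have := hX1.hasFiniteIntegral
    rw [HasFiniteIntegral] at this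
    simp only [Real.enorm_eq_ofReal_abs] at this
    exact ENNReal.add_lt_top.2 ⟨ENNReal.ofReal_lt_top, ENNReal.mul_lt_top (by simp) this⟩
  refine lt_of_le_of_lt ?_ hfin
  refine (lintegral_liminf_le fun N => (hm N).ennreal_ofReal).trans ?_
  exact liminf_le_of_le (by isBoundedDefault) fun b hb => by
    obtain ⟨N, hN⟩ := hb.exists
    exact hN.trans (hbound N)

/-! ### An integrable envelope and the number of levels reached -/

/-- A nondecreasing bound of the absolute value of the process. -/
def envelope {Ω : Type*} (X : ℝ≥0 → Ω → ℝ) (ω : Ω) (t : ℝ≥0) : ℝ≥0∞ :=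
  ∑' i : ℕ, {t : ℝ≥0 | (((i : ℕ) : ℝ≥0) : ℝ≥0∞) ≤ t}.indicator (fun _ => unitSup (shifted X i ω)) t

/-- The discounted integral of the envelope. -/
def discountedEnvelope {Ω : Type*} (X : ℝ≥0 → Ω → ℝ) (q : ℝ) (ω : Ω) : ℝ≥0∞ :=
  ∑' i : ℕ, ediscount q ((i : ℕ) : ℝ≥0) * unitSup (shifted X i ω)

theorem lintegral_envelope {Ω : Type*} {X : ℝ≥0 → Ω → ℝ} (hq : 0 < q) (ω : Ω) :
    ∫⁻ t, envelope X ω t ∂expLaw q = discountedEnvelope X q ω := by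
  unfold envelope discountedEnvelope
  rw [lintegral_tsum fun i => (measurable_const.indicator (measurableSet_le_coe _)).aemeasurable]
  refine tsum_congr fun i => ?_
  rw [lintegral_indicator (measurableSet_le_coe _), setLIntegral_const, expLaw_setOf_le hq,
    mul_comm]

theorem IsCadlagLevy.measurable_discountedEnvelope (hX : IsCadlagLevy X P) :
    Measurable (discountedEnvelope X q) :=
  Measurable.tsum fun i => (measurable_unitSup.comp (hX.measurable_shifted i)).const_mul _

theorem tsum_ediscount_ne_top (hq : 0 < q) : ∑' i : ℕ, ediscount q ((i : ℕ) : ℝ≥0) ≠ ∞ := by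
  have h1 : ∀ i : ℕ, ediscount q ((i : ℕ) : ℝ≥0) = ENNReal.ofReal (Real.exp (-q)) ^ i := by
    intro i
    rw [ediscount, discount_coe, ← ENNReal.ofReal_pow (Real.exp_pos _).le, ← Real.exp_nat_mul]
    congr 2
    push_cast
    ring
  simp only [h1]
  rw [ENNReal.tsum_geometric]
  refine ENNReal.inv_ne_top.2 (tsub_pos_of_lt ?_).ne'
  rw [ENNReal.ofReal_lt_one, Real.exp_lt_one_iff]
  linarith

theorem IsCadlagLevy.lintegral_discountedEnvelope_lt_top [IsProbabilityMeasure P]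
    (hX : IsCadlagLevy X P) (hX1 : Integrable (X 1) P) (hq : 0 < q) :
    ∫⁻ ω, discountedEnvelope X q ω ∂P < ∞ := by
  unfold discountedEnvelope
  have hm : ∀ i : ℕ, Measurable fun ω => unitSup (shifted X i ω) := fun i =>
    measurable_unitSup.comp (hX.measurable_shifted i)
  rw [lintegral_tsum fun i => ((hm i).const_mul _).aemeasurable]
  have h1 : ∀ i : ℕ, ∫⁻ ω, ediscount q ((i : ℕ) : ℝ≥0) * unitSup (shifted X i ω) ∂P
      = ediscount q ((i : ℕ) : ℝ≥0) * ∫⁻ ω, unitSup (fun t => X t ω) ∂P := fun i => by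
    rw [lintegral_const_mul _ (hm i), hX.lintegral_shifted i measurable_unitSup]
  simp only [h1]
  rw [ENNReal.tsum_mul_right]
  exact ENNReal.mul_lt_top (tsum_ediscount_ne_top hq).lt_top (hX.lintegral_unitSup_lt_top hX1)

theorem IsCadlagLevy.le_sum_unitSup (hX : IsCadlagLevy X P) (ω : Ω) (k : ℕ) :
    ∀ t : ℝ≥0, t ≤ k →
      ENNReal.ofReal |X t ω| ≤ ∑ i ∈ Finset.range k, unitSup (shifted X i ω) := by
  induction k with
  | zero =>
    intro t ht
    have : t = 0 := by simpa using ht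
    simp [this, hX.zero]
  | succ k ih =>
    intro t ht
    rw [Finset.sum_range_succ]
    rcases le_total t k with h | h
    · exact (ih t h).trans le_self_add
    · have h1 : t - k ≤ 1 := tsub_le_iff_left.2 (by exact_mod_cast ht)
      have h2 : |X t ω| ≤ |X k ω| + |shifted X k ω (t - k)| := by
        rw [shifted, add_tsub_cancel_of_le h]
        have := abs_add_le (X k ω) (X t ω - X k ω)
        rwa [add_sub_cancel] at this
      refine (ENNReal.ofReal_le_ofReal h2).trans ?_
      rw [ENNReal.ofReal_add (abs_nonneg _) (abs_nonneg _)]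
      exact add_le_add (ih k le_rfl) (((hX.cadlag ω).shift k).le_unitSup h1)

theorem envelope_eq_sum {Ω : Type*} (X : ℝ≥0 → Ω → ℝ) (ω : Ω) (t : ℝ≥0) :
    envelope X ω t = ∑ i ∈ Finset.range (⌊t⌋₊ + 1), unitSup (shifted X i ω) := by
  have h : ∀ i : ℕ, (((i : ℕ) : ℝ≥0) : ℝ≥0∞) ≤ t ↔ i < ⌊t⌋₊ + 1 := fun i => by
    rw [ENNReal.coe_le_coe, Nat.lt_succ_iff, Nat.le_floor_iff zero_le]
  unfold envelope
  rw [tsum_eq_sum (s := Finset.range (⌊t⌋₊ + 1))]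
  · refine Finset.sum_congr rfl fun i hi => indicator_of_mem ?_ _
    exact (h i).2 (Finset.mem_range.1 hi)
  · intro i hi
    rw [indicator_of_notMem]
    exact fun hle => hi (Finset.mem_range.2 ((h i).1 hle))

/-- The bound reaches slightly beyond `t` on purpose: a first time at most `t` only yields witnesses
in every interval to the right of `t`. -/
theorem IsCadlagLevy.le_envelope (hX : IsCadlagLevy X P) (ω : Ω) {s t : ℝ≥0}
    (h : s < ⌊t⌋₊ + 1) : ENNReal.ofReal |X s ω| ≤ envelope X ω t := by
  rw [envelope_eq_sum]
  exact hX.le_sum_unitSup ω _ s (by exact_mod_cast h.le)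

theorem tsum_indicator_nat_le {S : Set ℕ} {Y : ℝ≥0∞} (h : ∀ n ∈ S, (n : ℝ≥0∞) ≤ Y) :
    ∑' n, S.indicator (1 : ℕ → ℝ≥0∞) n ≤ Y + 1 := by
  rcases eq_or_ne Y ∞ with rfl | hY
  · simp
  lift Y to ℝ≥0 using hY
  have hS : ∀ n ∈ S, n ∈ Finset.range (⌊Y⌋₊ + 1) := fun n hn => by
    rw [Finset.mem_range, Nat.lt_succ_iff, Nat.le_floor_iff zero_le]
    exact_mod_cast h n hn
  rw [tsum_eq_sum (s := Finset.range (⌊Y⌋₊ + 1))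
    fun n hn => indicator_of_notMem (f := (1 : ℕ → ℝ≥0∞)) (fun hS' => hn (hS n hS'))]
  calc ∑ n ∈ Finset.range (⌊Y⌋₊ + 1), S.indicator (1 : ℕ → ℝ≥0∞) n
      ≤ ∑ n ∈ Finset.range (⌊Y⌋₊ + 1), 1 := by
        refine Finset.sum_le_sum fun n _ => ?_
        by_cases hn : n ∈ S <;> simp [hn]
    _ = ((⌊Y⌋₊ : ℝ≥0) : ℝ≥0∞) + 1 := by simp
    _ ≤ Y + 1 := by
        gcongr
        exact_mod_cast Nat.floor_le zero_le

/-- Reaching level `a + n` forces the path above it or a rise of more than that size, so `n` is at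
most `|x|` plus two values of `|X|`. -/
theorem IsCadlagLevy.tsum_firstUpTime_le (hX : IsCadlagLevy X P) (ha : 0 < a) (ω : Ω) (t : ℝ≥0) :
    ∑' n : ℕ, {t : ℝ≥0 | firstUpTime (path X x ω) (a + n) ≤ t}.indicator 1 t
      ≤ (ENNReal.ofReal |x| + 2 * envelope X ω t) + 1 := by
  refine tsum_indicator_nat_le
    (S := {n : ℕ | firstUpTime (path X x ω) (a + n) ≤ t}) fun n hn => ?_
  have h1 : firstUpTime (path X x ω) (a + n) < ((⌊t⌋₊ + 1 : ℝ≥0) : ℝ≥0∞) :=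
    lt_of_le_of_lt hn (by exact_mod_cast Nat.lt_floor_add_one t)
  obtain ⟨s, hs, hst⟩ := firstTime_lt_iff.1 h1
  have hst' : s < ⌊t⌋₊ + 1 := by exact_mod_cast hst
  have hE := hX.le_envelope ω hst'
  obtain ⟨u, hu, h2⟩ : ∃ u : ℝ≥0, u < ⌊t⌋₊ + 1 ∧ (n : ℝ) ≤ |x| + (|X s ω| + |X u ω|) := by
    have h3 := le_abs_self x
    have h4 := le_abs_self (X s ω)
    rcases hs with hs | ⟨u, hus, hs⟩
    · refine ⟨0, zero_le.trans_lt hst', ?_⟩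
      simp only [path] at hs
      have := abs_nonneg (X 0 ω)
      linarith
    · refine ⟨u, lt_of_le_of_lt hus hst', ?_⟩
      simp only [path] at hs
      have := neg_abs_le (X u ω)
      have := abs_nonneg x
      linarith
  calc (n : ℝ≥0∞) = ENNReal.ofReal n := (ENNReal.ofReal_natCast n).symm
    _ ≤ ENNReal.ofReal (|x| + (|X s ω| + |X u ω|)) := ENNReal.ofReal_le_ofReal h2
    _ = ENNReal.ofReal |x| + (ENNReal.ofReal |X s ω| + ENNReal.ofReal |X u ω|) := by
        rw [ENNReal.ofReal_add (abs_nonneg _) (by positivity),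
          ENNReal.ofReal_add (abs_nonneg _) (abs_nonneg _)]
    _ ≤ ENNReal.ofReal |x| + 2 * envelope X ω t := by
        rw [two_mul]
        gcongr
        exact hX.le_envelope ω hu

theorem IsCadlagLevy.lintegral_tsum_firstUpTime_lt_top [IsProbabilityMeasure P]
    (hX : IsCadlagLevy X P) (hX1 : Integrable (X 1) P) (hq : 0 < q) (ha : 0 < a) (x : ℝ) :
    ∫⁻ ω, ∑' n : ℕ, ediscount q (firstUpTime (path X x ω) (a + n)) ∂P < ∞ := by
  have hprob := isProbabilityMeasure_expLaw hq
  have henv : ∀ ω, Measurable (envelope X ω) := fun ω =>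
    Measurable.tsum fun i => measurable_const.indicator (measurableSet_le_coe _)
  have h1 : ∀ ω, ∑' n : ℕ, ediscount q (firstUpTime (path X x ω) (a + n))
      ≤ (ENNReal.ofReal |x| + 2 * discountedEnvelope X q ω) + 1 := by
    intro ω
    have h2 : ∑' n : ℕ, ediscount q (firstUpTime (path X x ω) (a + n))
        = ∫⁻ t, ∑' n : ℕ, {t : ℝ≥0 | firstUpTime (path X x ω) (a + n) ≤ t}.indicator 1 t
          ∂expLaw q := by
      rw [lintegral_tsum fun n =>
        (measurable_one.indicator (measurableSet_le_coe _)).aemeasurable]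
      refine tsum_congr fun n => ?_
      rw [lintegral_indicator_one (measurableSet_le_coe _), expLaw_setOf_le hq]
    rw [h2]
    refine (lintegral_mono fun t => hX.tsum_firstUpTime_le ha ω t).trans ?_
    rw [lintegral_add_right _ measurable_const, lintegral_add_left measurable_const,
      lintegral_const_mul _ (henv ω), lintegral_envelope hq]
    simp
  refine (lintegral_mono h1).trans_lt ?_
  rw [lintegral_add_right _ measurable_const, lintegral_add_left measurable_const,
    lintegral_const_mul _ hX.measurable_discountedEnvelope]
  simp only [lintegral_const, measure_univ, mul_one]
  exact ENNReal.add_lt_top.2 ⟨ENNReal.add_lt_top.2 ⟨ENNReal.ofReal_lt_top,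
    ENNReal.mul_lt_top (by simp) (hX.lintegral_discountedEnvelope_lt_top hX1 hq)⟩, by simp⟩

theorem IsCadlagLevy.lintegral_abs_path_le [IsProbabilityMeasure P] (hX : IsCadlagLevy X P)
    (hq : 0 < q) (x : ℝ) (ω : Ω) :
    ∫⁻ t, ENNReal.ofReal |path X x ω t| ∂expLaw q
      ≤ ENNReal.ofReal |x| + discountedEnvelope X q ω := by
  have hprob := isProbabilityMeasure_expLaw hq
  calc ∫⁻ t, ENNReal.ofReal |path X x ω t| ∂expLaw q
      ≤ ∫⁻ t, (ENNReal.ofReal |x| + envelope X ω t) ∂expLaw q := by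
        refine lintegral_mono fun t => ?_
        refine (ENNReal.ofReal_le_ofReal (abs_add_le x (X t ω))).trans ?_
        rw [ENNReal.ofReal_add (abs_nonneg _) (abs_nonneg _)]
        gcongr
        exact hX.le_envelope ω (Nat.lt_floor_add_one t)
    _ = _ := by
        rw [lintegral_add_left measurable_const, lintegral_envelope hq]
        simp

end DoubleBarrier

end

noncomputable section

namespace DoubleBarrier

/-! ### Expected present values -/

variable {Ω : Type*} [MeasurableSpace Ω] {X : ℝ≥0 → Ω → ℝ} {P : Measure Ω} {a b c q x : ℝ}

theorem drawdownTime_congr {w v : ℝ≥0 → ℝ} (h : ∀ u t, w u - w t = v u - v t) (a : ℝ)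
    (s : ℝ≥0∞) : drawdownTime w a s = drawdownTime v a s := by
  simp only [drawdownTime, h]

theorem drawdownTime_path {Ω : Type*} (X : ℝ≥0 → Ω → ℝ) (x : ℝ) (ω : Ω) (a : ℝ) (s : ℝ≥0∞) :
    drawdownTime (path X x ω) a s = drawdownTime (fun t => 1 * X t ω) a s :=
  drawdownTime_congr (fun u t => by simp only [path]; ring) a s

theorem drawdownTime_neg_path {Ω : Type*} (X : ℝ≥0 → Ω → ℝ) (x : ℝ) (ω : Ω) (a : ℝ)
    (s : ℝ≥0∞) : drawdownTime (-path X x ω) a s = drawdownTime (fun t => -1 * X t ω) a s :=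
  drawdownTime_congr (fun u t => by simp only [path, Pi.neg_apply]; ring) a s

theorem IsCadlagLevy.cadlag_path (hX : IsCadlagLevy X P) (x : ℝ) (ω : Ω) :
    IsCadlag (path X x ω) :=
  (hX.cadlag ω).const_add x

theorem isOptionalTime_upTime (hX : IsCadlagLevy X P) (ha : 0 < a) (x : ℝ) (k : ℕ) :
    IsOptionalTime X (fun ω => upTime (path X x ω) a k) ∧
      IsOptionalTime X fun ω => drawdownTime (path X x ω) a (upTime (path X x ω) a k) := by
  have step : ∀ k, IsOptionalTime X (fun ω => upTime (path X x ω) a k) →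
      IsOptionalTime X fun ω => drawdownTime (path X x ω) a (upTime (path X x ω) a k) := by
    intro k hk
    simp only [drawdownTime_path]
    exact hk.drawdownTime hX ha 1
  induction k with
  | zero =>
    have h := isOptionalTime_firstUpTime hX ha x
    exact ⟨h, step 0 h⟩
  | succ k ih =>
    have h : IsOptionalTime X (fun ω => upTime (path X x ω) a (k + 1)) := by
      simp only [upTime, drawdownTime_neg_path]
      exact ih.2.drawdownTime hX ha (-1)
    exact ⟨h, step _ h⟩

theorem measurable_ediscount_upTime (hX : IsCadlagLevy X P) (hq : 0 < q) (ha : 0 < a) (x : ℝ)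
    (k : ℕ) : Measurable fun ω => ediscount q (upTime (path X x ω) a k) :=
  (continuous_ediscount hq).measurable.comp
    ((isOptionalTime_upTime hX ha x k).1.measurable hX)

theorem measurable_ediscount_downTime (hX : IsCadlagLevy X P) (hq : 0 < q) (ha : 0 < a) (x : ℝ)
    (k : ℕ) :
    Measurable fun ω => ediscount q (drawdownTime (path X x ω) a (upTime (path X x ω) a k)) :=
  (continuous_ediscount hq).measurable.comp
    ((isOptionalTime_upTime hX ha x k).2.measurable hX)

theorem measurable_ediscount_drawdownTime (hX : IsCadlagLevy X P) (hq : 0 < q) (ha : 0 < a)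
    (c : ℝ) : Measurable fun ω => ediscount q (drawdownTime (fun t => c * X t ω) a 0) := by
  have h0 : IsOptionalTime X fun _ => (0 : ℝ≥0∞) := fun _ => MeasurableSet.const _
  exact (continuous_ediscount hq).measurable.comp ((h0.drawdownTime hX ha c).measurable hX)

/-- `𝔼_x[e^{-qρ}]`, where `ρ` is the first time at which dividends are paid. -/
def firstUpValue (X : ℝ≥0 → Ω → ℝ) (P : Measure Ω) (q x a : ℝ) : ℝ≥0∞ :=
  ∫⁻ ω, ediscount q (firstUpTime (path X x ω) a) ∂P

/-- The expected discounted number of upper phases. -/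
def upValue (X : ℝ≥0 → Ω → ℝ) (P : Measure Ω) (q x a : ℝ) : ℝ≥0∞ :=
  ∫⁻ ω, ∑' k, ediscount q (upTime (path X x ω) a k) ∂P

/-- The expected discounted number of lower phases that follow an upper phase. -/
def downValue (X : ℝ≥0 → Ω → ℝ) (P : Measure Ω) (q x a : ℝ) : ℝ≥0∞ :=
  ∫⁻ ω, ∑' k, ediscount q (drawdownTime (path X x ω) a (upTime (path X x ω) a k)) ∂P

/-! ### The renewal structure of the switching times -/

theorem lintegral_ediscount_downTime [IsProbabilityMeasure P] (hX : IsCadlagLevy X P)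
    (hq : 0 < q) (ha : 0 < a) (x : ℝ) (k : ℕ) :
    ∫⁻ ω, ediscount q (drawdownTime (path X x ω) a (upTime (path X x ω) a k)) ∂P
      = drawdownValue X P q 1 a * ∫⁻ ω, ediscount q (upTime (path X x ω) a k) ∂P := by
  simp only [drawdownTime_path]
  exact lintegral_ediscount_drawdownTime hX hq ha (isOptionalTime_upTime hX ha x k).1

theorem lintegral_ediscount_upTime [IsProbabilityMeasure P] (hX : IsCadlagLevy X P)
    (hq : 0 < q) (ha : 0 < a) (x : ℝ) (k : ℕ) :
    ∫⁻ ω, ediscount q (upTime (path X x ω) a k) ∂P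
      = firstUpValue X P q x a * (drawdownValue X P q 1 a * drawdownValue X P q (-1) a) ^ k := by
  induction k with
  | zero => simp [firstUpValue, upTime]
  | succ k ih =>
    have h := lintegral_ediscount_drawdownTime (c := -1) hX hq ha
      (isOptionalTime_upTime hX ha x k).2
    rw [lintegral_ediscount_downTime hX hq ha x k, ih] at h
    simp only [upTime, drawdownTime_neg_path]
    rw [h, pow_succ]
    ring

theorem measurable_ediscount_firstUpTime (hX : IsCadlagLevy X P) (hq : 0 < q) (ha : 0 < a)
    (x : ℝ) : Measurable fun ω => ediscount q (firstUpTime (path X x ω) a) :=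
  measurable_ediscount_upTime hX hq ha x 0

theorem upValue_eq [IsProbabilityMeasure P] (hX : IsCadlagLevy X P) (hq : 0 < q) (ha : 0 < a)
    (x : ℝ) : upValue X P q x a = firstUpValue X P q x a *
      (1 - drawdownValue X P q 1 a * drawdownValue X P q (-1) a)⁻¹ := by
  rw [upValue, lintegral_tsum fun k => (measurable_ediscount_upTime hX hq ha x k).aemeasurable]
  simp only [lintegral_ediscount_upTime hX hq ha x]
  rw [ENNReal.tsum_mul_left, ENNReal.tsum_geometric]

theorem downValue_eq [IsProbabilityMeasure P] (hX : IsCadlagLevy X P) (hq : 0 < q) (ha : 0 < a)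
    (x : ℝ) : downValue X P q x a = drawdownValue X P q 1 a * upValue X P q x a := by
  rw [downValue, upValue,
    lintegral_tsum fun k => (measurable_ediscount_upTime hX hq ha x k).aemeasurable,
    lintegral_tsum fun k => (measurable_ediscount_downTime hX hq ha x k).aemeasurable,
    ← ENNReal.tsum_mul_left]
  exact tsum_congr fun k => lintegral_ediscount_downTime hX hq ha x k

/-- By right continuity the drawdown time is positive on every path, so its discount factor is
strictly below `1`. This is why the geometric series converges. -/
theorem drawdownValue_lt_one [IsProbabilityMeasure P] (hX : IsCadlagLevy X P) (hq : 0 < q)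
    (ha : 0 < a) (c : ℝ) : drawdownValue X P q c a < 1 := by
  have h : ∫⁻ ω, ediscount q (drawdownTime (fun t => c * X t ω) a 0) ∂P < ∫⁻ _, 1 ∂P := by
    refine lintegral_strict_mono (IsProbabilityMeasure.ne_zero P) aemeasurable_const
      ((lintegral_mono fun ω => ediscount_le_one hq _).trans_lt (by simp)).ne
      (ae_of_all _ fun ω => ?_)
    rw [ediscount, ENNReal.ofReal_lt_one]
    exact discount_lt_one hq (((hX.cadlag ω).const_mul c).lt_drawdownTime ha (by simp))
  rwa [lintegral_const, measure_univ, mul_one] at h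

theorem drawdownValue_mul_lt_one [IsProbabilityMeasure P] (hX : IsCadlagLevy X P) (hq : 0 < q)
    (ha : 0 < a) : drawdownValue X P q 1 a * drawdownValue X P q (-1) a < 1 := by
  have h1 := drawdownValue_lt_one hX hq ha 1
  have h2 := drawdownValue_lt_one hX hq ha (-1)
  calc _ ≤ 1 * drawdownValue X P q (-1) a := by gcongr
    _ < 1 := by rwa [one_mul]

theorem drawdownValue_anti (hq : 0 < q) (hab : a ≤ b) (c : ℝ) :
    drawdownValue X P q c b ≤ drawdownValue X P q c a :=
  lintegral_mono fun _ => antitone_ediscount hq (drawdownTime_mono hab le_rfl)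

theorem firstUpValue_le_one [IsProbabilityMeasure P] (hq : 0 < q) (x a : ℝ) :
    firstUpValue X P q x a ≤ 1 := by
  have : firstUpValue X P q x a ≤ ∫⁻ _, 1 ∂P := lintegral_mono fun ω => ediscount_le_one hq _
  simpa using this

theorem upValue_ne_top [IsProbabilityMeasure P] (hX : IsCadlagLevy X P) (hq : 0 < q)
    (ha : 0 < a) (x : ℝ) : upValue X P q x a ≠ ∞ := by
  rw [upValue_eq hX hq ha]
  exact ENNReal.mul_ne_top ((firstUpValue_le_one hq x a).trans_lt ENNReal.one_lt_top).ne
    (ENNReal.inv_ne_top.2 (tsub_pos_of_lt (drawdownValue_mul_lt_one hX hq ha)).ne')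

theorem downValue_ne_top [IsProbabilityMeasure P] (hX : IsCadlagLevy X P) (hq : 0 < q)
    (ha : 0 < a) (x : ℝ) : downValue X P q x a ≠ ∞ := by
  rw [downValue_eq hX hq ha]
  exact ENNReal.mul_ne_top ((drawdownValue_lt_one hX hq ha 1).trans ENNReal.one_lt_top).ne
    (upValue_ne_top hX hq ha x)

/-! ### Bounds for the decrements of the values, and finiteness -/

theorem VL_add_le (hX : IsCadlagLevy X P) (hq : 0 < q) (ha : 0 < a) (hab : a ≤ b) (x : ℝ) :
    VL X P q x b + ENNReal.ofReal (b - a) * upValue X P q x b ≤ VL X P q x a := by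
  have hm : Measurable fun ω => ∑' k, ediscount q (upTime (path X x ω) b k) :=
    Measurable.tsum fun k => measurable_ediscount_upTime hX hq (ha.trans_le hab) x k
  -- Only the counting term has to be measurable for the integral to split; measurability of the
  -- present values is never needed.
  rw [VL, VL, upValue, ← lintegral_const_mul _ hm, ← lintegral_add_right _ (hm.const_mul _)]
  exact lintegral_mono fun ω => (hX.cadlag_path x ω).presentValue_dividends_add_le hq ha hab

theorem VL_le_add (hX : IsCadlagLevy X P) (hq : 0 < q) (ha : 0 < a) (hab : a ≤ b) (x : ℝ) :
    VL X P q x a ≤ VL X P q x b + ENNReal.ofReal (b - a) * upValue X P q x a := by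
  have hm : Measurable fun ω => ∑' k, ediscount q (upTime (path X x ω) a k) :=
    Measurable.tsum fun k => measurable_ediscount_upTime hX hq ha x k
  rw [VL, VL, upValue, ← lintegral_const_mul _ hm, ← lintegral_add_right _ (hm.const_mul _)]
  exact lintegral_mono fun ω => (hX.cadlag_path x ω).presentValue_dividends_le_add hq ha hab

theorem VR_add_le (hX : IsCadlagLevy X P) (hq : 0 < q) (ha : 0 < a) (hab : a ≤ b) (x : ℝ) :
    VR X P q x b + ENNReal.ofReal (b - a) * downValue X P q x b ≤ VR X P q x a := by
  have hm : Measurable fun ω =>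
      ∑' k, ediscount q (drawdownTime (path X x ω) b (upTime (path X x ω) b k)) :=
    Measurable.tsum fun k => measurable_ediscount_downTime hX hq (ha.trans_le hab) x k
  rw [VR, VR, downValue, ← lintegral_const_mul _ hm, ← lintegral_add_right _ (hm.const_mul _)]
  exact lintegral_mono fun ω => (hX.cadlag_path x ω).presentValue_injections_add_le hq ha hab

theorem VR_le_add (hX : IsCadlagLevy X P) (hq : 0 < q) (ha : 0 < a) (hab : a ≤ b) (x : ℝ) :
    VR X P q x a ≤ VR X P q x b + ENNReal.ofReal (b - a) * downValue X P q x a := by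
  have hm : Measurable fun ω =>
      ∑' k, ediscount q (drawdownTime (path X x ω) a (upTime (path X x ω) a k)) :=
    Measurable.tsum fun k => measurable_ediscount_downTime hX hq ha x k
  rw [VR, VR, downValue, ← lintegral_const_mul _ hm, ← lintegral_add_right _ (hm.const_mul _)]
  exact lintegral_mono fun ω => (hX.cadlag_path x ω).presentValue_injections_le_add hq ha hab

/-- The geometric factors decrease in the level and are bounded by the one at `a`; what remains is
the expected discounted number of levels `a + n` reached. -/
theorem VL_lt_top [IsProbabilityMeasure P] (hX : IsCadlagLevy X P) (hX1 : Integrable (X 1) P)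
    (hq : 0 < q) (ha : 0 < a) (x : ℝ) : VL X P q x a < ∞ := by
  have hpos : ∀ n : ℕ, 0 < a + n := fun n => by positivity
  have h1 : VL X P q x a ≤ ∑' n : ℕ, upValue X P q x (a + n) := by
    unfold upValue
    rw [← lintegral_tsum fun n => (Measurable.tsum fun k =>
      measurable_ediscount_upTime hX hq (hpos n) x k).aemeasurable]
    exact lintegral_mono fun ω => (hX.cadlag_path x ω).presentValue_dividends_le_tsum hq ha
  have h2 : ∑' n : ℕ, upValue X P q x (a + n) ≤ (∑' n : ℕ, firstUpValue X P q x (a + n)) *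
      (1 - drawdownValue X P q 1 a * drawdownValue X P q (-1) a)⁻¹ := by
    rw [← ENNReal.tsum_mul_right]
    refine ENNReal.tsum_le_tsum fun n => ?_
    have han : a ≤ a + n := by simp
    rw [upValue_eq hX hq (hpos n)]
    gcongr
    · exact drawdownValue_anti hq han 1
    · exact drawdownValue_anti hq han (-1)
  have h3 : ∑' n : ℕ, firstUpValue X P q x (a + n) < ∞ := by
    unfold firstUpValue
    rw [← lintegral_tsum fun n => (measurable_ediscount_firstUpTime hX hq (hpos n) x).aemeasurable]
    exact hX.lintegral_tsum_firstUpTime_lt_top hX1 hq ha x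
  refine (h1.trans h2).trans_lt (ENNReal.mul_lt_top h3 ?_)
  exact (ENNReal.inv_ne_top.2 (tsub_pos_of_lt (drawdownValue_mul_lt_one hX hq ha)).ne').lt_top

theorem VR_lt_top [IsProbabilityMeasure P] (hX : IsCadlagLevy X P) (hX1 : Integrable (X 1) P)
    (hq : 0 < q) (ha : 0 < a) (x : ℝ) : VR X P q x a < ∞ := by
  have h1 : VR X P q x a ≤ ∫⁻ ω, (ENNReal.ofReal a + (ENNReal.ofReal |x|
      + discountedEnvelope X q ω)) + presentValue q (dividends a (path X x ω)) ∂P := by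
    refine lintegral_mono fun ω => ?_
    refine ((hX.cadlag_path x ω).presentValue_injections_le hq ha).trans ?_
    gcongr
    exact hX.lintegral_abs_path_le hq x ω
  refine h1.trans_lt ?_
  have hm : Measurable fun ω =>
      ENNReal.ofReal a + (ENNReal.ofReal |x| + discountedEnvelope X q ω) :=
    measurable_const.add (measurable_const.add hX.measurable_discountedEnvelope)
  rw [lintegral_add_left hm,
    lintegral_add_left measurable_const, lintegral_add_left measurable_const]
  simp only [lintegral_const, measure_univ, mul_one]
  exact ENNReal.add_lt_top.2 ⟨ENNReal.add_lt_top.2 ⟨ENNReal.ofReal_lt_top,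
    ENNReal.add_lt_top.2 ⟨ENNReal.ofReal_lt_top,
      hX.lintegral_discountedEnvelope_lt_top hX1 hq⟩⟩, VL_lt_top hX hX1 hq ha x⟩

/-! ### Continuity in the level -/

theorem tendsto_drawdownValue [IsProbabilityMeasure P] (hX : IsCadlagLevy X P) (hq : 0 < q)
    (ha : 0 < a) (c : ℝ) :
    Tendsto (fun b => drawdownValue X P q c b) (𝓝[>] a) (𝓝 (drawdownValue X P q c a)) := by
  refine tendsto_lintegral_filter_of_dominated_convergence (fun _ => 1) ?_ ?_ (by simp) ?_
  · filter_upwards [self_mem_nhdsWithin] with b hb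
    exact measurable_ediscount_drawdownTime hX hq (ha.trans hb) c
  · exact Eventually.of_forall fun b => ae_of_all _ fun ω => ediscount_le_one hq _
  · exact ae_of_all _ fun ω => ((continuous_ediscount hq).tendsto _).comp
      (((hX.cadlag ω).const_mul c).tendsto_drawdownTime_level ha 0)

theorem tendsto_firstUpValue [IsProbabilityMeasure P] (hX : IsCadlagLevy X P) (hq : 0 < q)
    (ha : 0 < a) (x : ℝ) :
    Tendsto (fun b => firstUpValue X P q x b) (𝓝[>] a) (𝓝 (firstUpValue X P q x a)) := by
  refine tendsto_lintegral_filter_of_dominated_convergence (fun _ => 1) ?_ ?_ (by simp) ?_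
  · filter_upwards [self_mem_nhdsWithin] with b hb
    exact measurable_ediscount_firstUpTime hX hq (ha.trans hb) x
  · exact Eventually.of_forall fun b => ae_of_all _ fun ω => ediscount_le_one hq _
  · exact ae_of_all _ fun ω => ((continuous_ediscount hq).tendsto _).comp
      (tendsto_firstUpTime_level _ a)

theorem tendsto_upValue [IsProbabilityMeasure P] (hX : IsCadlagLevy X P) (hq : 0 < q)
    (ha : 0 < a) (x : ℝ) :
    Tendsto (fun b => upValue X P q x b) (𝓝[>] a) (𝓝 (upValue X P q x a)) := by
  have h1 := tendsto_drawdownValue hX hq ha 1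
  have h2 := tendsto_drawdownValue hX hq ha (-1)
  have h3 := tendsto_firstUpValue hX hq ha x
  have hne : ∀ c, drawdownValue X P q c a ≠ ∞ := fun c =>
    ((drawdownValue_lt_one hX hq ha c).trans ENNReal.one_lt_top).ne
  have h4 : Tendsto (fun b => firstUpValue X P q x b *
      (1 - drawdownValue X P q 1 b * drawdownValue X P q (-1) b)⁻¹) (𝓝[>] a)
      (𝓝 (firstUpValue X P q x a *
        (1 - drawdownValue X P q 1 a * drawdownValue X P q (-1) a)⁻¹)) := by
    refine ENNReal.Tendsto.mul h3 (Or.inr ?_) (tendsto_inv_iff.2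
      (ENNReal.Tendsto.sub tendsto_const_nhds
        (ENNReal.Tendsto.mul h1 (Or.inr (hne _)) h2 (Or.inr (hne _)))
        (Or.inl ENNReal.one_ne_top))) (Or.inr ?_)
    · exact ENNReal.inv_ne_top.2 (tsub_pos_of_lt (drawdownValue_mul_lt_one hX hq ha)).ne'
    · exact ((firstUpValue_le_one hq x a).trans_lt ENNReal.one_lt_top).ne
  rw [upValue_eq hX hq ha]
  refine h4.congr' ?_
  filter_upwards [self_mem_nhdsWithin] with b hb
  rw [upValue_eq hX hq (ha.trans hb)]

theorem tendsto_downValue [IsProbabilityMeasure P] (hX : IsCadlagLevy X P) (hq : 0 < q)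
    (ha : 0 < a) (x : ℝ) :
    Tendsto (fun b => downValue X P q x b) (𝓝[>] a) (𝓝 (downValue X P q x a)) := by
  have h1 := tendsto_drawdownValue hX hq ha 1
  have h2 := tendsto_upValue hX hq ha x
  have h3 := ENNReal.Tendsto.mul h1 (Or.inr (upValue_ne_top hX hq ha x)) h2
    (Or.inr ((drawdownValue_lt_one hX hq ha 1).trans ENNReal.one_lt_top).ne)
  rw [downValue_eq hX hq ha]
  refine h3.congr' ?_
  filter_upwards [self_mem_nhdsWithin] with b hb
  rw [downValue_eq hX hq (ha.trans hb)]

/-! ### Identification of the discount factors -/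

theorem toReal_lintegral_ediscount {T : Ω → ℝ≥0∞}
    (hT : Measurable fun ω => ediscount q (T ω)) :
    (∫⁻ ω, ediscount q (T ω) ∂P).toReal = ∫ ω, discount q (T ω) ∂P := by
  have h : ∀ ω, (ediscount q (T ω)).toReal = discount q (T ω) := fun ω =>
    ENNReal.toReal_ofReal (discount_nonneg q _)
  rw [← integral_toReal hT.aemeasurable (ae_of_all _ fun ω => ENNReal.ofReal_lt_top)]
  simp only [h]

theorem nuUpper_eq (hX : IsCadlagLevy X P) (hq : 0 < q) (ha : 0 < a) (x : ℝ) :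
    nuUpper X P q x a = (firstUpValue X P q x a).toReal := by
  rw [firstUpValue, toReal_lintegral_ediscount (measurable_ediscount_firstUpTime hX hq ha x),
    nuUpper]
  refine integral_congr_ae (ae_of_all _ fun ω => ?_)
  simp only [firstTime_dividends (hX.cadlag_path x ω) ha]

/-- Started at `0`, exceeding `a` is itself a rise by more than `a` from time `0`. Hence the factor
of a lower phase in the renewal series is `ν̄_0(a)`. -/
theorem firstUpValue_zero (hX : IsCadlagLevy X P) (a : ℝ) :
    firstUpValue X P q 0 a = drawdownValue X P q (-1) a := by
  refine lintegral_congr fun ω => ?_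
  congr 1
  rw [firstUpTime, drawdownTime]
  congr 1
  ext t
  simp only [path, mem_ofPred_eq, zero_add]
  constructor
  · rintro (h | ⟨u, hut, h⟩)
    · exact ⟨0, zero_le, zero_le, by rw [hX.zero]; linarith⟩
    · exact ⟨u, hut, zero_le, by linarith⟩
  · rintro ⟨u, hut, -, h⟩
    exact Or.inr ⟨u, hut, by linarith⟩

/-- The running supremum is at least `w 0 = a`, so the positive part in the reflection plays no
role. -/
theorem IsCadlag.firstTime_reflectedAt {w : ℝ≥0 → ℝ} (hw : IsCadlag w) (ha : 0 < a)
    (h0 : w 0 = a) :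
    firstTime {t | 0 < t ∧ reflectedAt a w t < 0} = drawdownTime w a 0 := by
  rw [drawdownTime]
  congr 1
  ext t
  obtain ⟨C, hC⟩ := hw.exists_bound t
  have hbdd : BddAbove (w '' Icc 0 t) := by
    refine ⟨C, ?_⟩
    rintro _ ⟨s, hs, rfl⟩
    exact (abs_le.1 (hC s hs.2)).2
  have hle : a ≤ sSup (w '' Icc 0 t) := h0 ▸ le_csSup hbdd ⟨0, ⟨le_rfl, zero_le⟩, rfl⟩
  have hlt : reflectedAt a w t < 0 ↔ ∃ u ≤ t, (0 : ℝ≥0∞) ≤ u ∧ a < w u - w t := by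
    rw [reflectedAt, max_eq_left (by linarith)]
    have h1 : w t - (sSup (w '' Icc 0 t) - a) < 0 ↔ w t + a < sSup (w '' Icc 0 t) :=
      ⟨fun h => by linarith, fun h => by linarith⟩
    rw [h1, lt_csSup_iff hbdd ⟨_, ⟨0, ⟨le_rfl, zero_le⟩, rfl⟩⟩]
    constructor
    · rintro ⟨_, ⟨u, hu, rfl⟩, h⟩
      exact ⟨u, hu.2, zero_le, by linarith⟩
    · rintro ⟨u, hu, -, h⟩
      exact ⟨_, ⟨u, ⟨zero_le, hu⟩, rfl⟩, by linarith⟩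
  simp only [mem_ofPred_eq, hlt]
  refine ⟨fun h => h.2, fun h => ⟨?_, h⟩⟩
  obtain ⟨u, hut, -, h⟩ := h
  refine pos_iff_ne_zero.2 ?_
  rintro rfl
  have : u = 0 := le_antisymm hut zero_le
  rw [this] at h
  linarith

theorem nuLower_eq (hX : IsCadlagLevy X P) (hq : 0 < q) (ha : 0 < a) :
    nuLower X P q a = (drawdownValue X P q 1 a).toReal := by
  rw [drawdownValue, toReal_lintegral_ediscount (measurable_ediscount_drawdownTime hX hq ha 1),
    nuLower]
  refine integral_congr_ae (ae_of_all _ fun ω => ?_)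
  simp only
  rw [(hX.cadlag_path a ω).firstTime_reflectedAt ha (by simp [path, hX.zero]), drawdownTime_path]

theorem toReal_upValue [IsProbabilityMeasure P] (hX : IsCadlagLevy X P) (hq : 0 < q)
    (ha : 0 < a) (x : ℝ) : (upValue X P q x a).toReal =
      nuUpper X P q x a / (1 - nuLower X P q a * nuUpper X P q 0 a) := by
  rw [upValue_eq hX hq ha, nuUpper_eq hX hq ha, nuUpper_eq hX hq ha, nuLower_eq hX hq ha,
    firstUpValue_zero hX, ENNReal.toReal_mul, ENNReal.toReal_inv,
    ENNReal.toReal_sub_of_le (drawdownValue_mul_lt_one hX hq ha).le ENNReal.one_ne_top,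
    ENNReal.toReal_mul, ENNReal.toReal_one, div_eq_mul_inv]

theorem one_sub_nu_pos [IsProbabilityMeasure P] (hX : IsCadlagLevy X P) (hq : 0 < q)
    (ha : 0 < a) : 0 < 1 - nuLower X P q a * nuUpper X P q 0 a := by
  rw [nuUpper_eq hX hq ha, nuLower_eq hX hq ha, firstUpValue_zero hX, ← ENNReal.toReal_mul,
    sub_pos, ← ENNReal.toReal_one]
  exact (ENNReal.toReal_lt_toReal
    ((drawdownValue_mul_lt_one hX hq ha).trans ENNReal.one_lt_top).ne
    ENNReal.one_ne_top).2 (drawdownValue_mul_lt_one hX hq ha)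

/-! ### From decrement bounds to the right derivative -/

/-- A function whose decrements are controlled by `K` at both ends has right derivative `-K`. -/
theorem tendsto_slope_of_decrement {V K : ℝ → ℝ≥0∞} (ha : 0 < a)
    (hV : ∀ b, 0 < b → V b < ∞) (hK : ∀ b, 0 < b → K b ≠ ∞)
    (h1 : ∀ b, a ≤ b → V b + ENNReal.ofReal (b - a) * K b ≤ V a)
    (h2 : ∀ b, a ≤ b → V a ≤ V b + ENNReal.ofReal (b - a) * K a)
    (hlim : Tendsto K (𝓝[>] a) (𝓝 (K a))) :
    Tendsto (fun ε : ℝ => ((V (a + ε)).toReal - (V a).toReal) / ε) (𝓝[>] 0)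
      (𝓝 (-(K a).toReal)) := by
  have hshift : Tendsto (fun ε : ℝ => a + ε) (𝓝[>] 0) (𝓝[>] a) := by
    refine tendsto_nhdsWithin_iff.2 ⟨?_, ?_⟩
    · have : Tendsto (fun ε : ℝ => a + ε) (𝓝 0) (𝓝 (a + 0)) :=
        (continuous_const.add continuous_id).tendsto 0
      rw [add_zero] at this
      exact this.mono_left nhdsWithin_le_nhds
    · filter_upwards [self_mem_nhdsWithin] with ε hε
      exact lt_add_of_pos_right a hε
  have hlim' : Tendsto (fun ε : ℝ => -(K (a + ε)).toReal) (𝓝[>] 0) (𝓝 (-(K a).toReal)) :=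
    (((ENNReal.tendsto_toReal (hK a ha)).comp hlim).comp hshift).neg
  -- Squeeze: the second decrement bound gives the lower estimate `-K a`, the first the upper
  -- estimate `-K (a + ε)`.
  refine tendsto_of_tendsto_of_tendsto_of_le_of_le' tendsto_const_nhds hlim' ?_ ?_
  · filter_upwards [self_mem_nhdsWithin] with ε hε
    have hε' : 0 < ε := hε
    have hb : 0 < a + ε := by linarith
    have h := ENNReal.toReal_mono (ENNReal.add_ne_top.2 ⟨(hV _ hb).ne,
      ENNReal.mul_ne_top ENNReal.ofReal_ne_top (hK a ha)⟩) (h2 (a + ε) (by linarith))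
    rw [ENNReal.toReal_add (hV _ hb).ne (ENNReal.mul_ne_top ENNReal.ofReal_ne_top (hK a ha)),
      ENNReal.toReal_mul, ENNReal.toReal_ofReal (by linarith)] at h
    rw [le_div_iff₀ hε']
    linarith
  · filter_upwards [self_mem_nhdsWithin] with ε hε
    have hε' : 0 < ε := hε
    have hb : 0 < a + ε := by linarith
    have h := ENNReal.toReal_mono (hV a ha).ne (h1 (a + ε) (by linarith))
    rw [ENNReal.toReal_add (hV _ hb).ne (ENNReal.mul_ne_top ENNReal.ofReal_ne_top (hK _ hb)),
      ENNReal.toReal_mul, ENNReal.toReal_ofReal (by linarith)] at h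
    rw [div_le_iff₀ hε']
    linarith

theorem congr_of_ae_eq {X' : ℝ≥0 → Ω → ℝ} (h : ∀ᵐ ω ∂P, ∀ t, X' t ω = X t ω) (q : ℝ) :
    (∀ x a, VL X' P q x a = VL X P q x a) ∧ (∀ x a, VR X' P q x a = VR X P q x a) ∧
      (∀ x a, nuUpper X' P q x a = nuUpper X P q x a) ∧
      ∀ a, nuLower X' P q a = nuLower X P q a := by
  have hp : ∀ᵐ ω ∂P, ∀ x, path X' x ω = path X x ω := by
    filter_upwards [h] with ω hω x
    funext t
    simp only [path, hω]
  refine ⟨fun x a => lintegral_congr_ae ?_, fun x a => lintegral_congr_ae ?_,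
    fun x a => integral_congr_ae ?_, fun a => integral_congr_ae ?_⟩
  all_goals
    filter_upwards [hp] with ω hω
    simp only [hω]

end DoubleBarrier

end

open DoubleBarrier
theorem lemma4p2 {Ω : Type*} [MeasurableSpace Ω] (P : Measure Ω) [IsProbabilityMeasure P]
    (X : ℝ≥0 → Ω → ℝ) (hX : IsLevyProcess X P) (hX1 : Integrable (X 1) P)
    (q : ℝ) (hq : 0 < q) (x a : ℝ) (ha : 0 < a) :
    (∀ b : ℝ, 0 < b → VL X P q x b < ∞ ∧ VR X P q x b < ∞) ∧
    0 < 1 - nuLower X P q a * nuUpper X P q 0 a ∧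
    Tendsto (fun ε : ℝ => ((VL X P q x (a + ε)).toReal - (VL X P q x a).toReal) / ε) (𝓝[>] 0)
      (𝓝 (-nuUpper X P q x a / (1 - nuLower X P q a * nuUpper X P q 0 a))) ∧
    Tendsto (fun ε : ℝ => ((VR X P q x (a + ε)).toReal - (VR X P q x a).toReal) / ε) (𝓝[>] 0)
      (𝓝 (-(nuUpper X P q x a * nuLower X P q a) /
        (1 - nuLower X P q a * nuUpper X P q 0 a))) := by
  -- All four quantities are integrals over paths, so they may be computed for the modification with
  -- every path càdlàg.
  obtain ⟨X', hX', hae⟩ := hX.exists_cadlag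
  have hX1' : Integrable (X' 1) P := hX1.congr (by filter_upwards [hae] with ω hω using (hω 1).symm)
  obtain ⟨hVL, hVR, hU, hL⟩ := congr_of_ae_eq hae q
  simp only [← hVL, ← hVR, ← hU, ← hL]
  refine ⟨fun b hb => ⟨VL_lt_top hX' hX1' hq hb x, VR_lt_top hX' hX1' hq hb x⟩,
    one_sub_nu_pos hX' hq ha, ?_, ?_⟩
  · rw [neg_div, ← toReal_upValue hX' hq ha]
    exact tendsto_slope_of_decrement ha (fun b hb => VL_lt_top hX' hX1' hq hb x)
      (fun b hb => upValue_ne_top hX' hq hb x) (fun b hab => VL_add_le hX' hq ha hab x)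
      (fun b hab => VL_le_add hX' hq ha hab x) (tendsto_upValue hX' hq ha x)
  · have h : (downValue X' P q x a).toReal = nuUpper X' P q x a * nuLower X' P q a /
        (1 - nuLower X' P q a * nuUpper X' P q 0 a) := by
      rw [downValue_eq hX' hq ha, ENNReal.toReal_mul, toReal_upValue hX' hq ha,
        ← nuLower_eq hX' hq ha]
      ring
    rw [neg_div, ← h]
    exact tendsto_slope_of_decrement ha (fun b hb => VR_lt_top hX' hX1' hq hb x)
      (fun b hb => downValue_ne_top hX' hq hb x) (fun b hab => VR_add_le hX' hq ha hab x)
      (fun b hab => VR_le_add hX' hq ha hab x) (tendsto_downValue hX' hq ha x)
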